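/- **Notation.** Write $\mathbf e(x)=e^{2\pi i x}$, $t=\mathbf e(z)$, $q=\mathbf e(\tau)$ with $z\in\mathbb C$, $\tau\in\mathbb C\setminus\mathbb R$. For $|q|<1$ put $(x;q)_\infty=\prod_{k\ge0}(1-q^kx)$ and $\theta(t;q)=\sum_{k\in\mathbb Z}(-1)^kq^{k(k+1)/2}t^k$; for $|q|>1$ put $(x;q)_\infty=(q^{-1}x;q^{-1})_\infty^{-1}$, $\theta(t;q)=\theta(t^{-1};q^{-1})^{-1}$, and let the symbol $(q;q)_\infty$ mean $(q^{-1};q^{-1})_\infty^{-1}$. For $\gamma=\begin{pmatrix}a&b\\c&d\end{pmatrix}\in\mathrm{SL}_2(\mathbb Z)$ let $\gamma(z,\tau)=\left(\frac{z}{c\tau+d},\frac{a\tau+b}{c\tau+d}\right)$, and let $\mathbb C_\gamma$ be $\mathbb C\setminus(-\infty,-d/c]$ if $c>0$, $\mathbb C\setminus[-d/c,\infty)$ if $c<0$, and $\mathbb C\setminus\mathbb R$ if $c=0$. Let $S=\begin{pmatrix}0&-1\\1&0\end{pmatrix}$. For $\mathrm{Re}\,\mathsf b>0$, Faddeev's quantum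 dilogarithm $\Phi_{\mathsf b}$ is the meromorphic function on $\mathbb C$ with $$\Phi_{\mathsf b}(x)=\exp\left(\int_{\mathbb R+i\varepsilon}\frac{e^{-2ixw}}{4\sinh(\mathsf bw)\sinh(\mathsf b^{-1}w)}\frac{dw}{w}\right)\qquad\text{for } |\mathrm{Im}\,x|<\tfrac12\mathrm{Re}(\mathsf b+\mathsf b^{-1}),$$ where $\varepsilon>0$ is small. **Theorem 1.4.** Consider the equation $(1-qt)f(qt,q)=f(t,q)$, where $q\ne0$ and $|q|\ne1$, with the $1\times1$ fundamental matrices of solutions at $t=0$ and at $t=\infty$ $$U(t,q)=\big((qt;q)_\infty\big),\qquad V(t,q)=\left(\frac{\theta(t;q)}{(t^{-1};q)_\infty(q;q)_\infty}\right),$$ both of weight $0$. All identities below are identities of meromorphic functions, and hold at every point with $t\notin q^{\mathbb Z}$ (that is, $z\notin\mathbb Z+\tau\mathbb Z$). 1. $U$ and $V$ are invertible and solve the equation, and the monodromy matrix $V^{-1}U$ is $(1)$. 2. For $\gamma\in\mathrm{SL}_2(\mathbb Z)$ let $\Omega_{U,\gamma}(z,\tau)=U(\gamma(z,\tau))\,U(z,\tau)^{-1}$,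 where $U$ is regarded as a function of $(z,\tau)$, and define $\Omega_{V,\gamma}$ in the same way. Then $\Omega_{U,\gamma}=\Omega_{V,\gamma}=:\Omega_\gamma$ for all $\gamma$. 3. These cocycles are modular: for every $\gamma\in\mathrm{SL}_2(\mathbb Z)$ there is a finite set $S_\gamma\subset\mathbb C$ such that $\Omega_\gamma$ extends to a meromorphic function of $(z,\tau)\in\mathbb C\times\mathbb C_\gamma$ all of whose poles satisfy $z\in S_\gamma+\mathbb Z+\tau\mathbb Z$. 4. With $\mathsf b=\sqrt\tau$ (the branch with $\mathrm{Re}\,\mathsf b>0$), $$\Omega_S(z,\tau)=\Phi_{\mathsf b}\left(\frac{iz}{\mathsf b}+\frac{i\mathsf b}{2}+\frac{1}{2i\mathsf b}\right)^{-1}$$ for $\tau\in\mathbb C\setminus\mathbb R$, and the right-hand side is the meromorphic extension of $\Omega_S$ to $\mathbb C\times(\mathbb C\setminus(-\infty,0])$, with all poles at $z\in\mathbb Z+\tau\mathbb Z$. -/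

import Mathlib

open scoped Topology

noncomputable section

namespace QModular

/-! ### Variables -/

/-- `e(x) = exp(2πix)`. -/
def e (x : ℂ) : ℂ := Complex.exp (2 * Real.pi * Complex.I * x)

/-- The set `S + ℤ + τℤ`. -/
def latticeTranslates (S : Finset ℂ) (τ : ℂ) : Set ℂ :=
  {z | ∃ s ∈ S, ∃ m n : ℤ, z = s + m + n * τ}

/-! ### `q`-series, for `q ≠ 0`, `|q| ≠ 1`

For `|q| > 1` the symbols are understood through the usual conventions
`(x;q⁻¹)_∞ = (qx;q)_∞⁻¹` and `(q⁻¹;q⁻¹)_∞ = (q;q)_∞⁻¹` (where `|q| < 1`). -/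

/-- The Pochhammer symbol `(x;q)_∞`: it is `∏_{k ≥ 0} (1 - q^k x)` for `|q| < 1` and
`(q⁻¹x;q⁻¹)_∞⁻¹` for `|q| > 1`. -/
def qPoch (x q : ℂ) : ℂ :=
  if ‖q‖ < 1 then ∏' k : ℕ, (1 - q ^ k * x) else (∏' k : ℕ, (1 - q⁻¹ ^ (k + 1) * x))⁻¹

/-- `(q;q)_∞`: it is `∏_{k ≥ 1} (1 - q^k)` for `|q| < 1` and `(q⁻¹;q⁻¹)_∞⁻¹` for `|q| > 1`. -/
def qEuler (q : ℂ) : ℂ :=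
  if ‖q‖ < 1 then ∏' k : ℕ, (1 - q ^ (k + 1)) else (∏' k : ℕ, (1 - q⁻¹ ^ (k + 1)))⁻¹

/-- The lattice sum `∑_{k ∈ ℤ} (-1)^k q^{k(k+1)/2} t^k` (the exponent `k(k+1)/2` is an integer,
so the integer division is exact). -/
def thetaSeries (t q : ℂ) : ℂ := ∑' k : ℤ, (-1) ^ k * q ^ (k * (k + 1) / 2) * t ^ k

/-- The Jacobi theta function `θ(t;q)`. For `|q| > 1`, the conventions above turn the product
`(qt;q)_∞ (t⁻¹;q)_∞ (q;q)_∞` into `θ(t⁻¹;q⁻¹)⁻¹`. -/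
def theta (t q : ℂ) : ℂ :=
  if ‖q‖ < 1 then thetaSeries t q else (thetaSeries t⁻¹ q⁻¹)⁻¹

/-! ### Fundamental matrices, monodromy, cocycles -/

/-- The Wronskian matrix `W(f₁,…,f_r)_{ij} = σ^{i-1} f_j`, with `(σf)(t,q) = f(qt,q)`. -/
def wronskian {r : ℕ} (f : Fin r → ℂ → ℂ → ℂ) (t q : ℂ) : Matrix (Fin r) (Fin r) ℂ :=
  Matrix.of fun i j => f j (q ^ (i : ℕ) * t) q

/-- The monodromy matrix `V⁻¹ U`. -/
def monodromy {r : ℕ} (U V : ℂ → ℂ → Matrix (Fin r) (Fin r) ℂ) (t q : ℂ) :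
    Matrix (Fin r) (Fin r) ℂ :=
  (V t q)⁻¹ * U t q

/-- A function of `(t,q)` as a function of `(z,τ)`, where `t = e(z)` and `q = e(τ)`. -/
def inJacobi {r : ℕ} (U : ℂ → ℂ → Matrix (Fin r) (Fin r) ℂ) (p : ℂ × ℂ) :
    Matrix (Fin r) (Fin r) ℂ :=
  U (e p.1) (e p.2)

/-- `cτ + d`. -/
def autFactor (γ : Matrix.SpecialLinearGroup (Fin 2) ℤ) (τ : ℂ) : ℂ :=
  (γ 1 0 : ℂ) * τ + (γ 1 1 : ℂ)

/-- `γ(z,τ) = (z/(cτ+d), (aτ+b)/(cτ+d))`. -/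
def jacobiAct (γ : Matrix.SpecialLinearGroup (Fin 2) ℤ) (p : ℂ × ℂ) : ℂ × ℂ :=
  (p.1 / autFactor γ p.2, ((γ 0 0 : ℂ) * p.2 + (γ 0 1 : ℂ)) / autFactor γ p.2)

/-- The slash operator
`(F|_κ γ)(z,τ) = F(γ(z,τ)) diag((cτ+d)^{-κ₁},…,(cτ+d)^{-κ_r})`. -/
def slash {r : ℕ} (κ : Fin r → ℤ) (F : ℂ × ℂ → Matrix (Fin r) (Fin r) ℂ)
    (γ : Matrix.SpecialLinearGroup (Fin 2) ℤ) (p : ℂ × ℂ) : Matrix (Fin r) (Fin r) ℂ :=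
  F (jacobiAct γ p) * Matrix.diagonal fun i => autFactor γ p.2 ^ (-κ i)

/-- The cocycle `Ω_{U,γ} = (U|_κ γ) U⁻¹`. -/
def cocycle {r : ℕ} (κ : Fin r → ℤ) (U : ℂ → ℂ → Matrix (Fin r) (Fin r) ℂ)
    (γ : Matrix.SpecialLinearGroup (Fin 2) ℤ) (p : ℂ × ℂ) : Matrix (Fin r) (Fin r) ℂ :=
  slash κ (inJacobi U) γ p * (inJacobi U p)⁻¹

/-! ### Modularity -/

/-- The domain `ℂ_γ`: `ℂ ∖ (-∞,-d/c]` if `c > 0`, `ℂ ∖ [-d/c,∞)` if `c < 0`, and `ℂ ∖ ℝ` if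
`c = 0`. -/
def cutPlane (γ : Matrix.SpecialLinearGroup (Fin 2) ℤ) : Set ℂ :=
  {τ | (0 < γ 1 0 → ∀ x : ℝ, x ≤ -(γ 1 1 : ℝ) / (γ 1 0 : ℝ) → τ ≠ x) ∧
    (γ 1 0 < 0 → ∀ x : ℝ, -(γ 1 1 : ℝ) / (γ 1 0 : ℝ) ≤ x → τ ≠ x) ∧
    (γ 1 0 = 0 → ∀ x : ℝ, τ ≠ x)}

/-- A function of two complex variables is meromorphic at `p` if near `p` it is a quotient `g / h`
of analytic functions, where `h` does not vanish identically near `p` (values on the zero set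
of `h` are irrelevant). -/
def Meromorphic₂At (F : ℂ × ℂ → ℂ) (p : ℂ × ℂ) : Prop :=
  ∃ g h : ℂ × ℂ → ℂ, AnalyticAt ℂ g p ∧ AnalyticAt ℂ h p ∧ (∃ᶠ x in 𝓝 p, h x ≠ 0) ∧
    ∀ᶠ x in 𝓝 p, h x ≠ 0 → F x = g x / h x

/-- `F` is a meromorphic extension of `Ω` from `ℂ × (ℂ ∖ ℝ)` to `ℂ × ℂ_γ`, with all its poles at
points `(z,τ)` such that `z ∈ S + ℤ + τℤ`. -/
structure IsMeromorphicExtension {r : ℕ} (γ : Matrix.SpecialLinearGroup (Fin 2) ℤ)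
    (Ω : ℂ × ℂ → Matrix (Fin r) (Fin r) ℂ) (S : Finset ℂ)
    (F : ℂ × ℂ → Matrix (Fin r) (Fin r) ℂ) : Prop where
  meromorphic : ∀ p : ℂ × ℂ, p.2 ∈ cutPlane γ → ∀ i j, Meromorphic₂At (fun x => F x i j) p
  analytic : ∀ p : ℂ × ℂ, p.2 ∈ cutPlane γ → p.1 ∉ latticeTranslates S p.2 →
    ∀ i j, AnalyticAt ℂ (fun x => F x i j) p
  extends_cocycle : ∀ p : ℂ × ℂ, p.2.im ≠ 0 → p.1 ∉ latticeTranslates S p.2 → F p = Ω p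

/-- A cocycle `Ω` is modular if for every `γ ∈ SL₂(ℤ)` the function `Ω_γ` extends to a meromorphic
function on `ℂ × ℂ_γ` with poles at `z ∈ S_γ + ℤ + τℤ` for a finite set `S_γ`. -/
def IsModular {r : ℕ}
    (Ω : Matrix.SpecialLinearGroup (Fin 2) ℤ → ℂ × ℂ → Matrix (Fin r) (Fin r) ℂ) : Prop :=
  ∀ γ, ∃ (S : Finset ℂ) (F : ℂ × ℂ → Matrix (Fin r) (Fin r) ℂ),
    IsMeromorphicExtension γ (Ω γ) S F

/-! ### Faddeev's quantum dilogarithm -/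

/-- `∫_{ℝ+iε} e^{-2ixw} / (4 sinh(bw) sinh(b⁻¹w)) dw/w` for `Re b > 0`. Any height
`0 < ε < π min(Re b, Re b⁻¹)` (above the pole at `0`, below all poles in the upper half-plane)
gives the same value; here `ε = min(Re b, Re b⁻¹)`. -/
def faddeevIntegral (b x : ℂ) : ℂ :=
  ∫ u : ℝ, (fun w : ℂ => Complex.exp (-2 * Complex.I * x * w) /
      (4 * Complex.sinh (b * w) * Complex.sinh (b⁻¹ * w) * w))
    (u + (min b.re b⁻¹.re : ℝ) * Complex.I)

/-- `Φ` is Faddeev's quantum dilogarithm with parameter `b`: the meromorphic function on `ℂ`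
which in the strip `|Im x| < Re (b + b⁻¹) / 2` is the exponential of Faddeev's integral.
(Normal form fixes the value at poles to be `0`, so that there is only one such `Φ`.) -/
def IsFaddeevDilog (b : ℂ) (Φ : ℂ → ℂ) : Prop :=
  MeromorphicNFOn Φ Set.univ ∧
    ∀ x : ℂ, |x.im| < (b + b⁻¹).re / 2 → Φ x = Complex.exp (faddeevIntegral b x)

open Classical in
/-- Faddeev's quantum dilogarithm `Φ_b`, for `Re b > 0`. -/
def faddeevDilog (b : ℂ) : ℂ → ℂ :=
  if h : ∃ Φ : ℂ → ℂ, IsFaddeevDilog b Φ then h.choose else 0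

/-! ### The equation `(1 - qt) f(qt,q) = f(t,q)` -/

/-- The equation at the point `(t,q)`. -/
def PochEq (f : ℂ → ℂ → ℂ) (t q : ℂ) : Prop := (1 - q * t) * f (q * t) q = f t q

/-- The solution `f⁽⁰⁾(t,q) = (qt;q)_∞` at `t = 0`. -/
def f0 (t q : ℂ) : ℂ := qPoch (q * t) q

/-- The solution `g⁽¹⁾(t,q) = θ(t;q) / ((t⁻¹;q)_∞ (q;q)_∞)` at `t = ∞`. -/
def g1 (t q : ℂ) : ℂ := theta t q / (qPoch t⁻¹ q * qEuler q)

/-- The fundamental matrix `U = W(f⁽⁰⁾)` at `t = 0`. -/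
def U : ℂ → ℂ → Matrix (Fin 1) (Fin 1) ℂ := wronskian ![f0]

/-- The fundamental matrix `V = W(g⁽¹⁾)` at `t = ∞`. -/
def V : ℂ → ℂ → Matrix (Fin 1) (Fin 1) ℂ := wronskian ![g1]

/-- The function `Φ_b(iz/b + ib/2 + 1/(2ib))⁻¹` of `(z,τ)`, where `b = √τ` (principal branch, so
that `Re b > 0` for `τ ∈ ℂ ∖ (-∞,0]`). -/
def invDilog (p : ℂ × ℂ) : ℂ :=
  let b : ℂ := p.2 ^ (1 / 2 : ℂ)
  (faddeevDilog b (Complex.I * p.1 / b + Complex.I * b / 2 + 1 / (2 * Complex.I * b)))⁻¹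

end QModular

end

open scoped Topology

noncomputable section

namespace QModular

open Complex Filter MeasureTheory Set
open scoped BoundedContinuousFunction

/-! ### Shifting horizontal lines of integration -/

/-! Write u(z,τ) for f⁽⁰⁾ at t = e(z), q = e(τ) (`uFun`). The Jacobi triple product gives g⁽¹⁾ =
f⁽⁰⁾ off q^ℤ, for |q| > 1 by applying it at (t⁻¹,q⁻¹). This settles the monodromy and the equality
of the two cocycles (`g1_eq_f0`), and only u remains to be studied.

For S, the quotient u(z/τ,-1/τ)/u(z,τ) is multiplied by 1 - e(z+τ) under z ↦ z+τ and by 1 - e(z/τ)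
under z ↦ z+1. The exponential of minus Faddeev's integral obeys the same two rules where its strip
allows. Indeed, the difference of the integrals at x ± ib/2 cancels sinh(bw), and the x-derivative
of what is left is ∫ e^{-2ixw}/sinh(b⁻¹w) dw, which a contour shift and the residue at 0 evaluate
(`exp_faddeevIntegral_shift`). The second rule is the first one under the symmetry b ↔ b⁻¹. The
first rule continues the exponential to a function D of (z,τ), with τ in the slit plane
(`dilogExt`); D has zeros and poles on ℤ+τℤ only, and D⁻¹ is the quantum dilogarithm up to an affine
change of variable.

For τ off the real line, the ratio of D to the S-quotient is invariant under ℤ+τℤ, and both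
functions tend to 1 along suitable translates of z. Hence the ratio is 1 at z
(`omegaS_eq_dilogExt`), and D extends the cocycle at S across the positive reals.

For c ≠ 0, splitting the product for u by residues modulo c writes u(z,τ) through functions u(·,cτ).
Since c·γτ = a - 1/(cτ+d), the cocycle at γ becomes a finite product of values D(·,cτ+d), or its
inverse if c < 0 (`uFun_moebius_div_eq_prod`). These continue as long as cτ+d avoids (-∞,0]. For c =
0 the cocycle is trivial or a product of two values of D, reflecting S² = -1.

Joint analyticity in (z,τ) comes from dominated bounds on Faddeev's integral together with Osgood's
lemma. -/

theorem tendsto_integral_sub_of_strip {f : ℂ → ℂ} {a b : ℝ} (hab : a ≤ b)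
    (hf : DifferentiableOn ℂ f (im ⁻¹' Icc a b)) {g : ℝ → ℝ} (hg : Tendsto g atTop (𝓝 0))
    (h₁ : ∀ᶠ T : ℝ in atTop, ∀ y ∈ Icc a b, ‖f (T + y * I)‖ ≤ g T)
    (h₂ : ∀ᶠ T : ℝ in atTop, ∀ y ∈ Icc a b, ‖f ((-T : ℝ) + y * I)‖ ≤ g T) :
    Tendsto (fun T : ℝ => (∫ u in (-T)..T, f (u + a * I)) - ∫ u in (-T)..T, f (u + b * I))
      atTop (𝓝 0) := by
  have key : ∀ T : ℝ, (∫ u in (-T)..T, f (u + a * I)) - (∫ u in (-T)..T, f (u + b * I)) =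
      I * (∫ y in a..b, f ((-T : ℝ) + y * I)) - I * ∫ y in a..b, f (T + y * I) := by
    intro T
    have := integral_boundary_rect_eq_zero_of_differentiableOn f ((-T : ℝ) + a * I : ℂ)
      ((T : ℝ) + b * I : ℂ) (hf.mono (by
        intro w hw
        have := hw.2
        simpa [uIcc_of_le hab] using this))
    simp only [add_re, ofReal_re, mul_re, I_re, mul_zero, ofReal_im, I_im, mul_one, sub_self,
      add_zero, add_im, mul_im, zero_add, smul_eq_mul] at this
    linear_combination this
  have hlim : Tendsto (fun T : ℝ => 2 * (b - a) * g T) atTop (𝓝 0) := by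
    simpa using hg.const_mul (2 * (b - a))
  refine squeeze_zero_norm' ?_ hlim
  filter_upwards [h₁, h₂] with T hT₁ hT₂
  rw [key T]
  have e₁ : ‖∫ y in a..b, f ((-T : ℝ) + y * I)‖ ≤ g T * |b - a| :=
    intervalIntegral.norm_integral_le_of_norm_le_const fun y hy =>
      hT₂ y (Ioc_subset_Icc_self (by rwa [uIoc_of_le hab] at hy))
  have e₂ : ‖∫ y in a..b, f ((T : ℝ) + y * I)‖ ≤ g T * |b - a| :=
    intervalIntegral.norm_integral_le_of_norm_le_const fun y hy =>
      hT₁ y (Ioc_subset_Icc_self (by rwa [uIoc_of_le hab] at hy))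
  rw [abs_of_nonneg (by linarith)] at e₁ e₂
  calc _ ≤ _ := norm_sub_le _ _
    _ ≤ g T * (b - a) + g T * (b - a) := by
      rw [norm_mul, norm_mul, norm_I, one_mul, one_mul]; exact add_le_add e₁ e₂
    _ = _ := by ring

/-- `f` decays exponentially along horizontal lines, locally uniformly in the height. -/
def LineDecay (f : ℂ → ℂ) (y₀ : ℝ) : Prop :=
  ∃ C δ : ℝ, 0 < δ ∧ ∀ᶠ y : ℝ in 𝓝 y₀, ∀ u : ℝ, ‖f (u + y * I)‖ ≤ C * Real.exp (-δ * |u|)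

theorem integrable_exp_neg_mul_abs {δ : ℝ} (hδ : 0 < δ) (C : ℝ) :
    Integrable fun u : ℝ => C * Real.exp (-δ * |u|) := by
  refine Integrable.const_mul ?_ C
  rw [← integrableOn_univ, ← Iic_union_Ioi (a := (0 : ℝ))]
  refine IntegrableOn.union ?_ ?_
  · refine (integrableOn_exp_mul_Iic hδ 0).congr_fun (fun u hu => ?_) measurableSet_Iic
    simp [abs_of_nonpos (show u ≤ 0 from hu)]
  · refine (integrableOn_exp_mul_Ioi (neg_lt_zero.2 hδ) 0).congr_fun (fun u hu => ?_)
      measurableSet_Ioi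
    simp [abs_of_pos (show 0 < u from hu)]

theorem tendsto_exp_neg_mul {δ : ℝ} (hδ : 0 < δ) (C : ℝ) :
    Tendsto (fun T : ℝ => C * Real.exp (-δ * T)) atTop (𝓝 0) := by
  have : Tendsto (fun T : ℝ => -δ * T) atTop atBot := tendsto_id.const_mul_atTop_of_neg (by linarith)
  simpa using (Real.tendsto_exp_atBot.comp this).const_mul C

theorem LineDecay.uniform {f : ℂ → ℂ} {K : Set ℝ} (hK : IsCompact K)
    (h : ∀ y ∈ K, LineDecay f y) :
    ∃ C δ : ℝ, 0 < δ ∧ ∀ y ∈ K, ∀ u : ℝ, ‖f (u + y * I)‖ ≤ C * Real.exp (-δ * |u|) := by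
  refine hK.induction_on (p := fun s => ∃ C δ : ℝ, 0 < δ ∧ ∀ y ∈ s, ∀ u : ℝ,
    ‖f (u + y * I)‖ ≤ C * Real.exp (-δ * |u|)) ⟨0, 1, one_pos, by simp⟩ ?_ ?_ ?_
  · rintro s t hst ⟨C, δ, hδ, H⟩
    exact ⟨C, δ, hδ, fun y hy => H y (hst hy)⟩
  · rintro s t ⟨C, δ, hδ, H⟩ ⟨C', δ', hδ', H'⟩
    -- The constant is made nonnegative so that lowering the rate can only enlarge the bound.
    refine ⟨max (max C C') 0, min δ δ', lt_min hδ hδ', fun y hy u => ?_⟩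
    have hm : ∀ D η, D ≤ max C C' → min δ δ' ≤ η →
        D * Real.exp (-η * |u|) ≤ max (max C C') 0 * Real.exp (-min δ δ' * |u|) := by
      intro D η hD hη
      refine mul_le_mul (hD.trans (le_max_left _ _)) (Real.exp_le_exp.2 ?_) (Real.exp_pos _).le
        (le_max_right _ _)
      nlinarith [abs_nonneg u]
    rcases hy with hy | hy
    · exact (H y hy u).trans (hm _ _ (le_max_left _ _) (min_le_left _ _))
    · exact (H' y hy u).trans (hm _ _ (le_max_right _ _) (min_le_right _ _))
  · intro y hy
    obtain ⟨C, δ, hδ, H⟩ := h y hy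
    exact ⟨_, mem_nhdsWithin_of_mem_nhds H, C, δ, hδ, fun y hy => hy⟩

theorem continuous_line {f : ℂ → ℂ} {s : Set ℝ} (hf : ContinuousOn f (im ⁻¹' s)) {y : ℝ}
    (hy : y ∈ s) : Continuous fun u : ℝ => f (u + y * I) :=
  hf.comp_continuous (by fun_prop) fun u => by simpa using hy

theorem LineDecay.integrable {f : ℂ → ℂ} {s : Set ℝ} (hf : ContinuousOn f (im ⁻¹' s)) {y : ℝ}
    (hy : y ∈ s) (h : LineDecay f y) : Integrable fun u : ℝ => f (u + y * I) := by
  obtain ⟨C, δ, hδ, H⟩ := h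
  exact (integrable_exp_neg_mul_abs hδ C).mono' (continuous_line hf hy).aestronglyMeasurable
    (Eventually.of_forall H.self_of_nhds)

/-- Exponentially decaying functions have the same integral along all lines of a strip. -/
theorem integral_line_eq {f : ℂ → ℂ} {a b : ℝ} (hab : a ≤ b)
    (hf : DifferentiableOn ℂ f (im ⁻¹' Icc a b)) (h : ∀ y ∈ Icc a b, LineDecay f y) :
    ∫ u : ℝ, f (u + a * I) = ∫ u : ℝ, f (u + b * I) := by
  obtain ⟨C, δ, hδ, H⟩ := LineDecay.uniform isCompact_Icc h
  have hlim := tendsto_integral_sub_of_strip hab hf (tendsto_exp_neg_mul hδ C)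
    (by
      filter_upwards [eventually_ge_atTop 0] with T hT y hy
      simpa [abs_of_nonneg hT] using H y hy T)
    (by
      filter_upwards [eventually_ge_atTop 0] with T hT y hy
      simpa [abs_of_nonneg hT] using H y hy (-T))
  have hi : ∀ y ∈ Icc a b, Tendsto (fun T : ℝ => ∫ u in (-T)..T, f (u + y * I)) atTop
      (𝓝 (∫ u : ℝ, f (u + y * I))) := fun y hy =>
    intervalIntegral_tendsto_integral ((h y hy).integrable hf.continuousOn hy)
      tendsto_neg_atTop_atBot tendsto_id
  have := (hi a (left_mem_Icc.2 hab)).sub (hi b (right_mem_Icc.2 hab))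
  exact sub_eq_zero.1 (tendsto_nhds_unique this hlim)

/-! ### Lower bounds for the hyperbolic sine -/

/-- The zeros of sinh(aw) are the points πik/a, at heights kπ Re(a⁻¹); a line at any other height
avoids them. -/
theorem sinh_ne_zero_of_im {a : ℂ} {w : ℂ} (ha : a ≠ 0)
    (hw : ∀ k : ℤ, w.im ≠ k * (Real.pi * a⁻¹.re)) : sinh (a * w) ≠ 0 := by
  intro h
  have h' : sin (a * w * I) = 0 := by rw [sin_mul_I, h, zero_mul]
  obtain ⟨k, hk⟩ := sin_eq_zero_iff.1 h'
  have : w = a⁻¹ * ((-k * Real.pi : ℝ) * I) := by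
    field_simp
    push_cast
    linear_combination (-I) * hk + a * w * I_mul_I
  apply hw (-k)
  rw [this]
  simp
  ring

theorem sinh_ne_zero_of_strip {a : ℂ} {w : ℂ} (ha : 0 < a.re) (h₀ : 0 < w.im)
    (h₁ : w.im < Real.pi * a⁻¹.re) : sinh (a * w) ≠ 0 := by
  refine sinh_ne_zero_of_im (fun h => by simp [h] at ha) fun k hk => ?_
  rw [hk] at h₀ h₁
  have hp : 0 < Real.pi * a⁻¹.re := by
    by_contra hcon
    have : (0 : ℝ) < Real.pi * a⁻¹.re := h₀.trans h₁ |>.trans_le le_rfl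
    exact hcon this
  have k0 : 0 < k := by exact_mod_cast pos_of_mul_pos_left h₀ hp.le
  have k1 : (k : ℝ) < 1 := by nlinarith
  have : k < 1 := by exact_mod_cast k1
  omega

/-- Of the two exponentials in 2 sinh v, one has norm e^{|Re v|} ≥ 2 and the other has norm at most
1, so at least half of the larger one survives. -/
theorem exp_abs_re_le_norm_sinh {v : ℂ} (hv : 1 ≤ |v.re|) :
    Real.exp |v.re| / 4 ≤ ‖sinh v‖ := by
  have h2 : 2 * sinh v = exp v - exp (-v) := two_sinh v
  have hn : 2 * ‖sinh v‖ = ‖exp v - exp (-v)‖ := by rw [← h2]; simp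
  have e1 : Real.exp (-|v.re|) ≤ 1 := Real.exp_le_one_iff.2 (by simp)
  have e2 : 2 ≤ Real.exp |v.re| := by
    have := Real.add_one_le_exp |v.re|
    linarith
  have : Real.exp |v.re| - Real.exp (-|v.re|) ≤ ‖exp v - exp (-v)‖ := by
    rcases abs_cases v.re with ⟨h, _⟩ | ⟨h, _⟩
    · have := norm_sub_norm_le (exp v) (exp (-v))
      rw [norm_exp, norm_exp, neg_re] at this
      rwa [h]
    · have := norm_sub_norm_le (exp (-v)) (exp v)
      rw [norm_exp, norm_exp, neg_re, norm_sub_rev] at this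
      rwa [h, neg_neg]
  linarith

theorem norm_sinh_mul_lower {a : ℂ} {y M u : ℝ} (hM : |y * a.im| ≤ M) (hu : 1 + M ≤ a.re * |u|) :
    Real.exp (-M) / 4 * Real.exp (a.re * |u|) ≤ ‖sinh (a * (u + y * I))‖ := by
  have hre : (a * (u + y * I)).re = a.re * u - y * a.im := by simp; ring
  have hM0 : 0 ≤ M := (abs_nonneg _).trans hM
  have hau : |a.re * u| = |a.re| * |u| := abs_mul _ _
  have hau' : a.re * |u| ≤ |a.re * u| := by
    rw [hau]; exact mul_le_mul_of_nonneg_right (le_abs_self _) (abs_nonneg _)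
  have hlow : a.re * |u| - M ≤ |(a * (u + y * I)).re| := by
    rw [hre]
    have := abs_sub_abs_le_abs_sub (a.re * u) (y * a.im)
    linarith
  refine le_trans ?_ (exp_abs_re_le_norm_sinh (by linarith))
  rw [div_mul_eq_mul_div, ← Real.exp_add]
  have := Real.exp_le_exp.2 hlow
  rw [show -M + a.re * |u| = a.re * |u| - M by ring]
  linarith

/-- Locally uniform exponential lower bound for `sinh (a w)` along horizontal lines between the
zeros `0` and `πi/a`. -/
theorem eventually_le_norm_sinh {a₀ : ℂ} {y₀ : ℝ} (ha : 0 < a₀.re) (hy : 0 < y₀)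
    (hy' : y₀ < Real.pi * a₀⁻¹.re) :
    ∃ c > 0, ∀ᶠ p : ℂ × ℝ in 𝓝 (a₀, y₀), ∀ u : ℝ,
      c * Real.exp (p.1.re * |u|) ≤ ‖sinh (p.1 * (u + p.2 * I))‖ := by
  set M : ℝ := |y₀ * a₀.im| + 1 with hMdef
  set m : ℝ := a₀.re / 2 with hm
  have hm0 : 0 < m := by positivity
  -- Beyond R one has m|u| ≥ 1 + M, so the explicit bound `norm_sinh_mul_lower` applies for all
  -- nearby parameters; on [-R, R] compactness takes over.
  set R : ℝ := (1 + M) / m with hR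
  have evM : ∀ᶠ p : ℂ × ℝ in 𝓝 (a₀, y₀), |p.2 * p.1.im| < M :=
    ContinuousAt.eventually_lt (by fun_prop) continuousAt_const (by simp [hMdef])
  have evm : ∀ᶠ p : ℂ × ℝ in 𝓝 (a₀, y₀), m < p.1.re :=
    ContinuousAt.eventually_lt continuousAt_const (by fun_prop) (by simp [hm, ha])
  have hcont : Continuous fun p : (ℂ × ℝ) × ℝ =>
      ‖sinh (p.1.1 * (p.2 + p.1.2 * I))‖ * Real.exp (-(p.1.1.re * |p.2|)) := by fun_prop
  have hpos : ∀ u : ℝ, 0 < ‖sinh (a₀ * (u + y₀ * I))‖ * Real.exp (-(a₀.re * |u|)) := fun u => by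
    have : sinh (a₀ * (u + y₀ * I)) ≠ 0 :=
      sinh_ne_zero_of_strip ha (by simpa using hy) (by simpa using hy')
    positivity
  obtain ⟨c, hc0, hc⟩ : ∃ c > 0, ∀ u ∈ Icc (-R) R,
      c < ‖sinh (a₀ * (u + y₀ * I))‖ * Real.exp (-(a₀.re * |u|)) := by
    have hRn : (Icc (-R) R).Nonempty := ⟨0, by
      have : 0 ≤ R := by positivity
      constructor <;> linarith⟩
    obtain ⟨u₀, -, hu₀⟩ := isCompact_Icc.exists_isMinOn hRn
      (hcont.comp (Continuous.prodMk_right (a₀, y₀))).continuousOn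
    refine ⟨_, half_pos (hpos u₀), fun u hu => ?_⟩
    have := hu₀ hu
    simp only [mem_ofPred_eq, Function.comp] at this
    exact (half_lt_self (hpos u₀)).trans_le this
  -- Tube lemma: a strict inequality along the compact slice persists for all nearby parameters.
  have evc : ∀ᶠ p : ℂ × ℝ in 𝓝 (a₀, y₀), ∀ u ∈ Icc (-R) R,
      c < ‖sinh (p.1 * (u + p.2 * I))‖ * Real.exp (-(p.1.re * |u|)) := by
    refine isCompact_Icc.eventually_forall_of_forall_eventually fun u hu => ?_
    exact continuousAt_const.eventually_lt hcont.continuousAt (hc u hu)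
  refine ⟨min c (Real.exp (-M) / 4), by positivity, ?_⟩
  filter_upwards [evM, evm, evc] with p hp₁ hp₂ hp₃ u
  have hexp := Real.exp_pos (p.1.re * |u|)
  by_cases hu : u ∈ Icc (-R) R
  · refine (mul_le_mul_of_nonneg_right (min_le_left _ _) hexp.le).trans ?_
    have := (mul_lt_mul_of_pos_right (hp₃ u hu) hexp).le
    rwa [mul_assoc, ← Real.exp_add, neg_add_cancel, Real.exp_zero, mul_one] at this
  · refine (mul_le_mul_of_nonneg_right (min_le_right _ _) hexp.le).trans ?_
    refine norm_sinh_mul_lower hp₁.le ?_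
    have hu' : R ≤ |u| := by
      by_contra hcon
      exact hu (abs_le.1 (not_le.1 hcon).le)
    calc 1 + M = m * R := by rw [hR]; field_simp
      _ ≤ p.1.re * |u| := by
        have hR0 : 0 ≤ R := by positivity
        have hp0 : 0 ≤ p.1.re := hm0.le.trans hp₂.le
        gcongr

/-! ### The kernels `e^{-2ixw}/sinh(aw)` and `e^{-2ixw}/(w sinh(aw))` -/

theorem norm_exp_kernel_le (x : ℂ) (u y : ℝ) :
    ‖exp (-2 * I * x * (u + y * I))‖ ≤
      Real.exp (2 * |x.re * y|) * Real.exp (2 * |x.im| * |u|) := by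
  rw [norm_exp, ← Real.exp_add]
  refine Real.exp_le_exp.2 ?_
  have : (-2 * I * x * (u + y * I)).re = 2 * (x.re * y) + 2 * (x.im * u) := by
    simp; ring
  rw [this]
  have h1 := le_abs_self (x.re * y)
  have h2 := le_abs_self (x.im * u)
  rw [abs_mul x.im u] at h2
  linarith

/-- The kernel `e^{-2ixw}/sinh(aw)`. -/
def sinhKernel (a x w : ℂ) : ℂ := exp (-2 * I * x * w) / sinh (a * w)

theorem sinhKernel_bound {a x₀ : ℂ} {y₀ : ℝ} (hx : 2 * |x₀.im| < a.re) (hy : 0 < y₀)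
    (hy' : y₀ < Real.pi * a⁻¹.re) :
    ∃ C δ : ℝ, 0 < δ ∧ ∀ᶠ p : ℂ × ℝ in 𝓝 (x₀, y₀), ∀ u : ℝ,
      ‖sinhKernel a p.1 (u + p.2 * I)‖ ≤ C * Real.exp (-δ * |u|) := by
  have ha : 0 < a.re := (by positivity : (0 : ℝ) ≤ 2 * |x₀.im|).trans_lt hx
  obtain ⟨c, hc, H⟩ := eventually_le_norm_sinh ha hy hy'
  have H' : ∀ᶠ p : ℂ × ℝ in 𝓝 (x₀, y₀), ∀ u : ℝ,
      c * Real.exp (a.re * |u|) ≤ ‖sinh (a * (u + p.2 * I))‖ := by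
    have : Tendsto (fun p : ℂ × ℝ => (a, p.2)) (𝓝 (x₀, y₀)) (𝓝 (a, y₀)) :=
      ContinuousAt.tendsto (f := fun p : ℂ × ℝ => (a, p.2)) (x := (x₀, y₀)) (by fun_prop)
    exact this.eventually H
  -- Half the gap between the growth rates of denominator and numerator; the other half lets x move.
  set δ := (a.re - 2 * |x₀.im|) / 2 with hδ
  have e₁ : ∀ᶠ p : ℂ × ℝ in 𝓝 (x₀, y₀), 2 * |p.1.im| < a.re - δ :=
    ContinuousAt.eventually_lt (by fun_prop) continuousAt_const (by simp only [hδ]; linarith)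
  have e₂ : ∀ᶠ p : ℂ × ℝ in 𝓝 (x₀, y₀), 2 * |p.1.re * p.2| < 2 * |x₀.re * y₀| + 1 :=
    ContinuousAt.eventually_lt (by fun_prop) continuousAt_const (by simp)
  refine ⟨Real.exp (2 * |x₀.re * y₀| + 1) / c, δ, by simp only [hδ]; linarith, ?_⟩
  filter_upwards [H', e₁, e₂] with p hp h₁ h₂ u
  rw [sinhKernel, norm_div]
  have hs : 0 < c * Real.exp (a.re * |u|) := by positivity
  calc _ ≤ Real.exp (2 * |p.1.re * p.2|) * Real.exp (2 * |p.1.im| * |u|) /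
        (c * Real.exp (a.re * |u|)) :=
        div_le_div₀ (by positivity) (norm_exp_kernel_le _ _ _) hs (hp u)
    _ ≤ Real.exp (2 * |x₀.re * y₀| + 1) * Real.exp ((a.re - δ) * |u|) /
        (c * Real.exp (a.re * |u|)) := by
        gcongr
    _ = _ := by
        have : Real.exp ((a.re - δ) * |u|) = Real.exp (-δ * |u|) * Real.exp (a.re * |u|) := by
          rw [← Real.exp_add]; ring_nf
        rw [this]
        field_simp

theorem sinhKernel_lineDecay {a x : ℂ} {y : ℝ} (hx : 2 * |x.im| < a.re) (hy : 0 < y)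
    (hy' : y < Real.pi * a⁻¹.re) : LineDecay (sinhKernel a x) y := by
  obtain ⟨C, δ, hδ, H⟩ := sinhKernel_bound hx hy hy'
  have ht : Tendsto (fun y : ℝ => (x, y)) (𝓝 y) (𝓝 (x, y)) :=
    (Continuous.prodMk_right x).tendsto y
  exact ⟨C, δ, hδ, ht.eventually H⟩

theorem sinhKernel_differentiableOn {a x : ℂ} (ha : 0 < a.re) :
    DifferentiableOn ℂ (sinhKernel a x) (im ⁻¹' Ioo 0 (Real.pi * a⁻¹.re)) := by
  unfold sinhKernel
  refine DifferentiableOn.div (by fun_prop) (by fun_prop) fun w hw => ?_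
  exact sinh_ne_zero_of_strip ha hw.1 hw.2

/-- `∫ e^{-2ixw}/sinh(aw) dw` along the line at height `y`. -/
def sinhLine (a x : ℂ) (y : ℝ) : ℂ := ∫ u : ℝ, sinhKernel a x (u + y * I)

theorem sinhKernel_integrable {a x : ℂ} {y : ℝ} (hx : 2 * |x.im| < a.re) (hy : 0 < y)
    (hy' : y < Real.pi * a⁻¹.re) : Integrable fun u : ℝ => sinhKernel a x (u + y * I) :=
  (sinhKernel_lineDecay hx hy hy').integrable
    (sinhKernel_differentiableOn (by have := abs_nonneg x.im; linarith)).continuousOn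
    (s := Ioo 0 (Real.pi * a⁻¹.re)) ⟨hy, hy'⟩

theorem sinhLine_eq_of_le {a x : ℂ} {y₁ y₂ : ℝ} (hx : 2 * |x.im| < a.re) (h₁ : 0 < y₁)
    (h₁₂ : y₁ ≤ y₂) (h₂ : y₂ < Real.pi * a⁻¹.re) : sinhLine a x y₁ = sinhLine a x y₂ :=
  integral_line_eq h₁₂
    ((sinhKernel_differentiableOn (by have := abs_nonneg x.im; linarith)).mono
      (preimage_mono fun _ hy => ⟨h₁.trans_le hy.1, hy.2.trans_lt h₂⟩))
    fun _ hy => sinhKernel_lineDecay hx (h₁.trans_le hy.1) (hy.2.trans_lt h₂)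

theorem sinhLine_eq {a x : ℂ} {y₁ y₂ : ℝ} (hx : 2 * |x.im| < a.re) (h₁ : 0 < y₁)
    (h₁' : y₁ < Real.pi * a⁻¹.re) (h₂ : 0 < y₂) (h₂' : y₂ < Real.pi * a⁻¹.re) :
    sinhLine a x y₁ = sinhLine a x y₂ := by
  rcases le_total y₁ y₂ with h | h
  · exact sinhLine_eq_of_le hx h₁ h h₂'
  · exact (sinhLine_eq_of_le hx h₂ h h₁').symm

theorem sinhKernel_add_period {a : ℂ} (ha : a ≠ 0) (x w : ℂ) :
    sinhKernel a x (w + Real.pi * I * a⁻¹) =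
      -(exp (2 * Real.pi * a⁻¹ * x) * sinhKernel a x w) := by
  have h1 : a * (w + Real.pi * I * a⁻¹) = a * w + Real.pi * I := by field_simp
  have h2 : -2 * I * x * (w + Real.pi * I * a⁻¹) =
      2 * Real.pi * a⁻¹ * x + -2 * I * x * w := by
    linear_combination (-2 * Real.pi * a⁻¹ * x) * I_mul_I
  rw [sinhKernel, sinhKernel, h1, h2, Complex.exp_add, sinh_add, sinh_mul_I, cosh_mul_I,
    ← ofReal_sin, ← ofReal_cos, Real.sin_pi, Real.cos_pi]
  simp [div_neg, mul_div_assoc]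

/-- The kernel is quasi-periodic under w ↦ w + πi/a. The imaginary part of πi/a raises the line, and
its real part only translates the line along itself. -/
theorem sinhLine_reflect {a : ℂ} (ha : a ≠ 0) (x : ℂ) (y : ℝ) :
    sinhLine a x (Real.pi * a⁻¹.re - y) =
      -(exp (2 * Real.pi * a⁻¹ * x) * sinhLine a x (-y)) := by
  have h : ∀ u : ℝ, sinhKernel a x (u + (Real.pi * a⁻¹.re - y : ℝ) * I) =
      -(exp (2 * Real.pi * a⁻¹ * x) *
        sinhKernel a x ((u + Real.pi * a⁻¹.im : ℝ) + (-y : ℝ) * I)) := by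
    intro u
    rw [← sinhKernel_add_period ha]
    congr 1
    push_cast
    linear_combination (Real.pi * I) * re_add_im a⁻¹ - (Real.pi * (a⁻¹.im : ℂ)) * I_mul_I
  rw [sinhLine, integral_congr_ae (Eventually.of_forall h), integral_neg, integral_const_mul,
    integral_add_right_eq_self (fun u : ℝ => sinhKernel a x (u + (-y : ℝ) * I)), sinhLine]

/-- Unlike `sinhKernel_bound`, this allows heights on both sides of the zero of sinh at 0, at the
price of large |T|. It controls the vertical sides of a contour around that zero. -/
theorem sinhKernel_norm_le_of_large {a x : ℂ} {y T : ℝ} {Y : ℝ} (hy : |y| ≤ Y)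
    (hT : 1 + Y * |a.im| ≤ a.re * |T|) :
    ‖sinhKernel a x (T + y * I)‖ ≤ Real.exp (2 * (|x.re| * Y)) /
      (Real.exp (-(Y * |a.im|)) / 4) * Real.exp (-(a.re - 2 * |x.im|) * |T|) := by
  have hM : |y * a.im| ≤ Y * |a.im| := by
    rw [abs_mul]; exact mul_le_mul_of_nonneg_right hy (abs_nonneg _)
  have h := norm_sinh_mul_lower hM hT
  rw [sinhKernel, norm_div]
  have h2 : Real.exp (2 * |x.re * y|) ≤ Real.exp (2 * (|x.re| * Y)) := by
    rw [abs_mul]; gcongr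
  calc _ ≤ Real.exp (2 * (|x.re| * Y)) * Real.exp (2 * |x.im| * |T|) /
        (Real.exp (-(Y * |a.im|)) / 4 * Real.exp (a.re * |T|)) :=
        div_le_div₀ (by positivity) ((norm_exp_kernel_le _ _ _).trans (by gcongr))
          (by positivity) h
    _ = _ := by
        have : Real.exp (2 * |x.im| * |T|) =
            Real.exp (-(a.re - 2 * |x.im|) * |T|) * Real.exp (a.re * |T|) := by
          rw [← Real.exp_add]; ring_nf
        rw [this]
        field_simp

/-- Neither term is integrable, but the difference is 2iy/(u² + y²), a rescaled Cauchy density. -/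
theorem integral_inv_line_sub {y : ℝ} (hy : 0 < y) :
    Integrable (fun u : ℝ => ((u : ℂ) + (-y : ℝ) * I)⁻¹ - ((u : ℂ) + y * I)⁻¹) ∧
    ∫ u : ℝ, (((u : ℂ) + (-y : ℝ) * I)⁻¹ - ((u : ℂ) + y * I)⁻¹) = 2 * Real.pi * I := by
  have hform : (fun u : ℝ => ((u : ℂ) + (-y : ℝ) * I)⁻¹ - ((u : ℂ) + y * I)⁻¹) =
      fun u : ℝ => (2 * I / y) * (((1 + (u / y) ^ 2)⁻¹ : ℝ) : ℂ) := by
    funext u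
    have h1 : (u : ℂ) + (-y : ℝ) * I ≠ 0 := fun h => by
      have := congrArg im h; simp at this; exact hy.ne' this
    have h2 : (u : ℂ) + y * I ≠ 0 := fun h => by
      have := congrArg im h; simp at this; exact hy.ne' this
    have h3 : (1 + ((u : ℂ) / y) ^ 2) ≠ 0 := by
      have : (0 : ℝ) < 1 + (u / y) ^ 2 := by positivity
      exact_mod_cast this.ne'
    have hy0 : (y : ℂ) ≠ 0 := by exact_mod_cast hy.ne'
    have h4 : (y : ℂ) ^ 2 + (u : ℂ) ^ 2 ≠ 0 := by
      have : (0 : ℝ) < y ^ 2 + u ^ 2 := by positivity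
      exact_mod_cast this.ne'
    rw [show (u : ℂ) + (-y : ℝ) * I = u - y * I by push_cast; ring] at h1 ⊢
    push_cast
    rw [show (1 + ((u : ℂ) / y) ^ 2) = (y ^ 2 + u ^ 2) / y ^ 2 by field_simp, inv_div]
    field_simp
    linear_combination (2 * I * y ^ 3) * I_mul_I
  constructor
  · rw [hform]
    exact ((integrable_inv_one_add_sq.comp_div hy.ne').ofReal).const_mul _
  · rw [hform, integral_const_mul, integral_complex_ofReal,
      Measure.integral_comp_div (fun u : ℝ => (1 + u ^ 2)⁻¹) y, integral_univ_inv_one_add_sq,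
      abs_of_pos hy]
    have hy0 : (y : ℂ) ≠ 0 := by exact_mod_cast hy.ne'
    simp only [smul_eq_mul]
    push_cast
    field_simp

/-- The residue of `e^{-2ixw}/sinh(aw)` at `0`. -/
theorem sinhLine_neg_sub {a x : ℂ} {y : ℝ} (hx : 2 * |x.im| < a.re) (hy : 0 < y)
    (hy' : y < Real.pi * a⁻¹.re) :
    sinhLine a x (-y) - sinhLine a x y = 2 * Real.pi * I * a⁻¹ := by
  have ha : 0 < a.re := by have := abs_nonneg x.im; linarith
  have ha0 : a ≠ 0 := fun h => by simp [h] at ha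
  have hπ : 0 < Real.pi * a⁻¹.re := hy.trans hy'
  -- The function sinh(aw)/w with its removable singularity filled in by the value a, so that G
  -- below is w times the kernel and holomorphic at 0.
  set σ : ℂ → ℂ := dslope (fun w => sinh (a * w)) 0 with hσ
  set G : ℂ → ℂ := fun w => exp (-2 * I * x * w) / σ w with hG
  have hd : HasDerivAt (fun w => sinh (a * w)) a 0 := by
    have := ((hasDerivAt_id (0 : ℂ)).const_mul a).csinh
    simpa using this
  have hσ0 : σ 0 = a := by rw [hσ, dslope_same, hd.deriv]
  have hσw : ∀ w, w ≠ 0 → σ w = sinh (a * w) / w := fun w hw => by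
    rw [hσ, dslope_of_ne _ hw, slope_def_field]; simp
  have hσd : Differentiable ℂ σ := by
    rw [← differentiableOn_univ, hσ,
      Complex.differentiableOn_dslope (univ_mem' fun _ => mem_univ _)]
    fun_prop
  set s : Set ℂ := im ⁻¹' Ioo (-(Real.pi * a⁻¹.re)) (Real.pi * a⁻¹.re) with hs
  have hso : IsOpen s := isOpen_Ioo.preimage continuous_im
  have hsinh : ∀ w ∈ s, w ≠ 0 → sinh (a * w) ≠ 0 := by
    intro w hw hw0 h
    -- A zero at a height strictly between ∓π Re(a⁻¹) must have height 0, and the only zero πij/a of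
    -- height 0 is w = 0.
    by_cases hk : ∀ k : ℤ, w.im ≠ k * (Real.pi * a⁻¹.re)
    · exact sinh_ne_zero_of_im ha0 hk h
    push Not at hk
    obtain ⟨k, hk⟩ := hk
    have h1 := hw.1; have h2 := hw.2
    rw [hk] at h1 h2
    have k1 : (k : ℝ) < 1 := by nlinarith
    have k2 : (-1 : ℝ) < k := by nlinarith
    have k1' : k < 1 := by exact_mod_cast k1
    have k2' : -1 < k := by exact_mod_cast k2
    have hk0 : k = 0 := by omega
    have h' : sin (a * w * I) = 0 := by rw [sin_mul_I, h, zero_mul]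
    obtain ⟨j, hj⟩ := sin_eq_zero_iff.1 h'
    have hw' : w = a⁻¹ * ((-j * Real.pi : ℝ) * I) := by
      field_simp
      push_cast
      linear_combination (-I) * hj + a * w * I_mul_I
    have him : w.im = -j * (Real.pi * a⁻¹.re) := by
      rw [hw']; simp; ring
    rw [hk, hk0] at him
    have hj0 : j = 0 := by
      have : (j : ℝ) = 0 := by
        have : (j : ℝ) * (Real.pi * a⁻¹.re) = 0 := by push_cast at him; linarith
        rcases mul_eq_zero.1 this with h | h
        · exact h
        · exact absurd h hπ.ne'
      exact_mod_cast this
    exact hw0 (by rw [hw', hj0]; simp)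
  have hσs : ∀ w ∈ s, σ w ≠ 0 := by
    intro w hw
    by_cases hw0 : w = 0
    · rw [hw0, hσ0]; exact ha0
    · rw [hσw w hw0]; exact div_ne_zero (hsinh w hw hw0) hw0
  have h0s : (0 : ℂ) ∈ s := ⟨by simpa using hπ, hπ⟩
  have hGd : DifferentiableOn ℂ G s :=
    DifferentiableOn.div (by fun_prop) hσd.differentiableOn hσs
  -- The divided difference of G is the kernel minus its polar part a⁻¹/w, so it is holomorphic
  -- across 0.
  have hfd : DifferentiableOn ℂ (dslope G 0) s :=
    (Complex.differentiableOn_dslope (hso.mem_nhds h0s)).2 hGd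
  have hG0 : G 0 = a⁻¹ := by simp [hG, hσ0]
  have hf : ∀ w, w ≠ 0 → dslope G 0 w = sinhKernel a x w - a⁻¹ * w⁻¹ := by
    intro w hw
    rw [dslope_of_ne _ hw, slope_def_field, hG0, sub_zero, sub_div, hG, sinhKernel]
    simp only [hσw w hw]
    field_simp
  have hne : ∀ (y : ℝ) (u : ℝ), y ≠ 0 → (u : ℂ) + y * I ≠ 0 := fun y u hy h => by
    have := congrArg im h; simp at this; exact hy this
  -- the bound on the vertical sides
  set C := Real.exp (2 * (|x.re| * y)) / (Real.exp (-(y * |a.im|)) / 4) with hC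
  set δ := a.re - 2 * |x.im| with hδ
  have hδ0 : 0 < δ := by rw [hδ]; linarith
  -- The polar part decays only like 1/T, so `integral_line_eq` is not available; the limit form of
  -- the contour shift suffices.
  set g : ℝ → ℝ := fun T => C * Real.exp (-δ * T) + ‖a⁻¹‖ * T⁻¹ with hg
  have hg0 : Tendsto g atTop (𝓝 0) := by
    simpa only [mul_zero, add_zero] using
      (tendsto_exp_neg_mul hδ0 C).add (tendsto_inv_atTop_zero.const_mul ‖a⁻¹‖)
  have hb : ∀ᶠ T : ℝ in atTop, ∀ y' ∈ Icc (-y) y, ∀ S : ℝ, |S| = T →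
      ‖dslope G 0 (S + y' * I)‖ ≤ g T := by
    filter_upwards [eventually_gt_atTop 0, eventually_ge_atTop ((1 + y * |a.im|) / a.re)]
      with T hT hT' y' hy₁ S hS
    have hne' : (S : ℂ) + y' * I ≠ 0 := fun h => by
      have := congrArg re h
      simp at this
      rw [this] at hS; simp at hS; linarith
    rw [hf _ hne']
    refine (norm_sub_le _ _).trans (add_le_add ?_ ?_)
    · have := sinhKernel_norm_le_of_large (a := a) (x := x) (T := S) (abs_le.2 hy₁) (by
        rw [hS]; rw [div_le_iff₀ ha] at hT'; linarith)
      rwa [hS] at this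
    · rw [norm_mul, norm_inv ((S : ℂ) + y' * I)]
      gcongr
      have := abs_re_le_norm ((S : ℂ) + y' * I)
      simpa [hS] using this
  have hsub : im ⁻¹' Icc (-y) y ⊆ s :=
    preimage_mono fun _ h => ⟨by linarith [h.1], by linarith [h.2]⟩
  have hlim := tendsto_integral_sub_of_strip (by linarith : -y ≤ y) (hfd.mono hsub) hg0
    (by
      filter_upwards [hb, eventually_ge_atTop 0] with T hT hT0 y' hy₁
      exact hT y' hy₁ T (abs_of_nonneg hT0))
    (by
      filter_upwards [hb, eventually_ge_atTop 0] with T hT hT0 y' hy₁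
      exact hT y' hy₁ (-T) (by rw [abs_neg, abs_of_nonneg hT0]))
  -- integrability of the two lines
  have i₂ := sinhKernel_integrable hx hy hy'
  have i₁ : Integrable fun u : ℝ => sinhKernel a x (u + (-y : ℝ) * I) := by
    -- The kernel changes sign under (x,w) ↦ (-x,-w), which carries the line at height -y to the one
    -- at height y.
    have hx' : 2 * |(-x).im| < a.re := by simpa using hx
    refine ((sinhKernel_integrable hx' hy hy').comp_neg.neg).congr (Eventually.of_forall ?_)
    intro u
    simp only [sinhKernel, Pi.neg_apply]
    rw [show a * (((-u : ℝ) : ℂ) + y * I) = -(a * (u + (-y : ℝ) * I)) by push_cast; ring,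
      sinh_neg, show -2 * I * (-x) * (((-u : ℝ) : ℂ) + y * I) = -2 * I * x * (u + (-y : ℝ) * I) by
        push_cast; ring, div_neg, neg_neg]
  obtain ⟨i₃, h₃⟩ := integral_inv_line_sub hy
  have iF := (i₁.sub i₂).sub (i₃.const_mul a⁻¹)
  have hF := intervalIntegral_tendsto_integral iF tendsto_neg_atTop_atBot tendsto_id
  have hcont : ∀ y' ∈ Icc (-y) y, Continuous fun u : ℝ => dslope G 0 (u + y' * I) :=
    fun y' hy₁ => continuous_line (hfd.mono hsub).continuousOn hy₁
  have heq : ∀ T : ℝ, (∫ u in (-T)..T, dslope G 0 (u + (-y : ℝ) * I)) -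
      (∫ u in (-T)..T, dslope G 0 (u + y * I)) =
      ∫ u in (-T)..T, (sinhKernel a x (u + (-y : ℝ) * I) - sinhKernel a x (u + y * I) -
        a⁻¹ * (((u : ℂ) + (-y : ℝ) * I)⁻¹ - ((u : ℂ) + y * I)⁻¹)) := by
    intro T
    rw [← intervalIntegral.integral_sub
      ((hcont (-y) ⟨le_rfl, by linarith⟩).intervalIntegrable _ _)
      ((hcont y ⟨by linarith, le_rfl⟩).intervalIntegrable _ _)]
    refine intervalIntegral.integral_congr fun u _ => ?_
    rw [hf _ (hne _ _ (neg_ne_zero.2 hy.ne')), hf _ (hne _ _ hy.ne')]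
    ring
  -- The contour shift makes the limit 0, while integrability of the combined integrand makes it the
  -- full integral: the difference of the two lines is the contribution 2πi a⁻¹ of the polar part.
  have h0 := tendsto_nhds_unique (hlim.congr heq) hF
  have i₁₂ : Integrable fun u : ℝ =>
      sinhKernel a x (u + (-y : ℝ) * I) - sinhKernel a x (u + y * I) := i₁.sub i₂
  have e₁ := integral_sub i₁₂ (i₃.const_mul a⁻¹)
  have e₂ := integral_sub i₁ i₂
  rw [integral_const_mul, h₃, e₂] at e₁
  have h1 := h0.trans e₁
  rw [sinhLine, sinhLine]
  linear_combination -h1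

/-- The value of `∫ e^{-2ixw}/sinh(aw) dw`. -/
theorem one_add_exp_mul_sinhLine {a x : ℂ} {y : ℝ} (hx : 2 * |x.im| < a.re) (hy : 0 < y)
    (hy' : y < Real.pi * a⁻¹.re) :
    (1 + exp (2 * Real.pi * a⁻¹ * x)) * sinhLine a x y =
      -(2 * Real.pi * I * a⁻¹ * exp (2 * Real.pi * a⁻¹ * x)) := by
  have ha0 : a ≠ 0 := fun h => by
    have := abs_nonneg x.im
    simp [h] at hx; linarith
  have h1 := sinhLine_reflect ha0 x y
  have h2 := sinhLine_neg_sub hx hy hy'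
  -- The reflected line lies in the same zero-free strip as the original, so quasi-periodicity and
  -- the residue give two linear relations between the values at heights y and -y.
  have h3 := sinhLine_eq hx hy hy' (y₂ := Real.pi * a⁻¹.re - y) (by linarith) (by linarith)
  rw [← h3] at h1
  linear_combination h1 - exp (2 * Real.pi * a⁻¹ * x) * h2

/-! ### Faddeev's integral -/

/-- The integrand of Faddeev's integral. -/
def fadKernel (b x w : ℂ) : ℂ :=
  exp (-2 * I * x * w) / (4 * sinh (b * w) * sinh (b⁻¹ * w) * w)

theorem inv_re_pos {b : ℂ} (hb : 0 < b.re) : 0 < b⁻¹.re := by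
  have h0 : b ≠ 0 := fun h => by simp [h] at hb
  rw [inv_re]
  exact div_pos hb (normSq_pos.2 h0)

/-- The numerator grows at rate 2|Im x|, the two sinh factors at rates Re b and Re b⁻¹, and |w|
stays above y₀/2. Uniformity in b as well as in x is what later yields analyticity in τ. -/
theorem fadKernel_bound {b₀ x₀ : ℂ} {y₀ : ℝ} (hb : 0 < b₀.re)
    (hx : 2 * |x₀.im| < b₀.re + b₀⁻¹.re) (hy : 0 < y₀) (h₁ : y₀ < Real.pi * b₀.re)
    (h₂ : y₀ < Real.pi * b₀⁻¹.re) :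
    ∃ C δ : ℝ, 0 < δ ∧ ∀ᶠ p : (ℂ × ℂ) × ℝ in 𝓝 ((b₀, x₀), y₀), ∀ u : ℝ,
      ‖fadKernel p.1.1 p.1.2 (u + p.2 * I)‖ ≤ C * Real.exp (-δ * |u|) := by
  have hb0 : b₀ ≠ 0 := fun h => by simp [h] at hb
  obtain ⟨c, hc, H⟩ := eventually_le_norm_sinh hb hy h₂
  obtain ⟨c', hc', H'⟩ := eventually_le_norm_sinh (inv_re_pos hb) hy (by rwa [inv_inv])
  have hinv : ContinuousAt (fun p : (ℂ × ℂ) × ℝ => p.1.1⁻¹) ((b₀, x₀), y₀) :=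
    ContinuousAt.inv₀ (by fun_prop) hb0
  have K : ∀ᶠ p : (ℂ × ℂ) × ℝ in 𝓝 ((b₀, x₀), y₀), ∀ u : ℝ,
      c * Real.exp (p.1.1.re * |u|) ≤ ‖sinh (p.1.1 * (u + p.2 * I))‖ := by
    have : Tendsto (fun p : (ℂ × ℂ) × ℝ => (p.1.1, p.2)) (𝓝 ((b₀, x₀), y₀)) (𝓝 (b₀, y₀)) :=
      ContinuousAt.tendsto (f := fun p : (ℂ × ℂ) × ℝ => (p.1.1, p.2)) (x := ((b₀, x₀), y₀))
        (by fun_prop)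
    exact this.eventually H
  have K' : ∀ᶠ p : (ℂ × ℂ) × ℝ in 𝓝 ((b₀, x₀), y₀), ∀ u : ℝ,
      c' * Real.exp (p.1.1⁻¹.re * |u|) ≤ ‖sinh (p.1.1⁻¹ * (u + p.2 * I))‖ := by
    have : Tendsto (fun p : (ℂ × ℂ) × ℝ => (p.1.1⁻¹, p.2)) (𝓝 ((b₀, x₀), y₀))
        (𝓝 (b₀⁻¹, y₀)) :=
      ContinuousAt.tendsto (f := fun p : (ℂ × ℂ) × ℝ => (p.1.1⁻¹, p.2)) (x := ((b₀, x₀), y₀))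
        (hinv.prodMk (by fun_prop))
    exact this.eventually H'
  set δ := (b₀.re + b₀⁻¹.re - 2 * |x₀.im|) / 2 with hδ
  have e₁ : ∀ᶠ p : (ℂ × ℂ) × ℝ in 𝓝 ((b₀, x₀), y₀),
      2 * |p.1.2.im| < p.1.1.re + p.1.1⁻¹.re - δ :=
    ContinuousAt.eventually_lt (by fun_prop)
      ((ContinuousAt.add (by fun_prop) (continuous_re.continuousAt.comp hinv)).sub
        continuousAt_const) (by simp only [hδ]; linarith)
  have e₂ : ∀ᶠ p : (ℂ × ℂ) × ℝ in 𝓝 ((b₀, x₀), y₀),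
      2 * |p.1.2.re * p.2| < 2 * |x₀.re * y₀| + 1 :=
    ContinuousAt.eventually_lt (by fun_prop) continuousAt_const (by simp)
  have e₃ : ∀ᶠ p : (ℂ × ℂ) × ℝ in 𝓝 ((b₀, x₀), y₀), y₀ / 2 < p.2 :=
    ContinuousAt.eventually_lt continuousAt_const (by fun_prop) (by simp [hy])
  refine ⟨Real.exp (2 * |x₀.re * y₀| + 1) / (4 * c * c' * (y₀ / 2)), δ,
    by simp only [hδ]; linarith, ?_⟩
  filter_upwards [K, K', e₁, e₂, e₃] with p hp hp' q₁ q₂ q₃ u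
  rw [fadKernel, norm_div, norm_mul, norm_mul, norm_mul]
  have hw : y₀ / 2 ≤ ‖(u : ℂ) + p.2 * I‖ := by
    have := abs_im_le_norm ((u : ℂ) + p.2 * I)
    simp only [add_im, ofReal_im, mul_im, ofReal_re, I_im, mul_one, I_re, mul_zero, add_zero,
      zero_add] at this
    linarith [le_abs_self p.2]
  have h4 : ‖(4 : ℂ)‖ = 4 := by simp
  rw [h4]
  calc _ ≤ Real.exp (2 * |p.1.2.re * p.2|) * Real.exp (2 * |p.1.2.im| * |u|) /
        (4 * (c * Real.exp (p.1.1.re * |u|)) * (c' * Real.exp (p.1.1⁻¹.re * |u|)) * (y₀ / 2)) := by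
        refine div_le_div₀ (by positivity) (norm_exp_kernel_le _ _ _) (by positivity) ?_
        gcongr
        · exact hp u
        · exact hp' u
    _ ≤ Real.exp (2 * |x₀.re * y₀| + 1) *
          Real.exp ((p.1.1.re + p.1.1⁻¹.re - δ) * |u|) /
        (4 * (c * Real.exp (p.1.1.re * |u|)) * (c' * Real.exp (p.1.1⁻¹.re * |u|)) * (y₀ / 2)) := by
        gcongr
    _ = _ := by
        have : Real.exp ((p.1.1.re + p.1.1⁻¹.re - δ) * |u|) =
            Real.exp (-δ * |u|) * Real.exp (p.1.1.re * |u|) * Real.exp (p.1.1⁻¹.re * |u|) := by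
          rw [← Real.exp_add, ← Real.exp_add]; ring_nf
        rw [this]
        field_simp

theorem fadKernel_lineDecay {b x : ℂ} {y : ℝ} (hb : 0 < b.re)
    (hx : 2 * |x.im| < b.re + b⁻¹.re) (hy : 0 < y) (h₁ : y < Real.pi * b.re)
    (h₂ : y < Real.pi * b⁻¹.re) : LineDecay (fadKernel b x) y := by
  obtain ⟨C, δ, hδ, H⟩ := fadKernel_bound hb hx hy h₁ h₂
  have ht : Tendsto (fun y : ℝ => ((b, x), y)) (𝓝 y) (𝓝 ((b, x), y)) :=
    (Continuous.prodMk_right (b, x)).tendsto y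
  exact ⟨C, δ, hδ, ht.eventually H⟩

theorem fadKernel_denom_ne_zero {b w : ℂ} (hb : 0 < b.re) (hw : 0 < w.im)
    (h₁ : w.im < Real.pi * b.re) (h₂ : w.im < Real.pi * b⁻¹.re) :
    4 * sinh (b * w) * sinh (b⁻¹ * w) * w ≠ 0 := by
  have h3 := sinh_ne_zero_of_strip hb hw h₂
  have h4 := sinh_ne_zero_of_strip (inv_re_pos hb) hw (by rwa [inv_inv])
  have h5 : w ≠ 0 := fun h => by simp [h] at hw
  simp [h3, h4, h5]

theorem fadKernel_differentiableOn {b x : ℂ} (hb : 0 < b.re) :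
    DifferentiableOn ℂ (fadKernel b x)
      (im ⁻¹' Ioo 0 (min (Real.pi * b.re) (Real.pi * b⁻¹.re))) := by
  unfold fadKernel
  refine DifferentiableOn.div (by fun_prop) (by fun_prop) fun w hw => ?_
  exact fadKernel_denom_ne_zero hb hw.1 (lt_min_iff.1 hw.2).1 (lt_min_iff.1 hw.2).2

theorem fadKernel_integrable {b x : ℂ} {y : ℝ} (hb : 0 < b.re)
    (hx : 2 * |x.im| < b.re + b⁻¹.re) (hy : 0 < y) (h₁ : y < Real.pi * b.re)
    (h₂ : y < Real.pi * b⁻¹.re) : Integrable fun u : ℝ => fadKernel b x (u + y * I) :=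
  (fadKernel_lineDecay hb hx hy h₁ h₂).integrable (fadKernel_differentiableOn hb).continuousOn
    (s := Ioo 0 (min (Real.pi * b.re) (Real.pi * b⁻¹.re))) ⟨hy, lt_min h₁ h₂⟩

theorem faddeevIntegral_def (b x : ℂ) :
    faddeevIntegral b x = ∫ u : ℝ, fadKernel b x (u + (min b.re b⁻¹.re : ℝ) * I) := rfl

theorem height_spec {b : ℂ} (hb : 0 < b.re) : 0 < min b.re b⁻¹.re ∧
    min b.re b⁻¹.re < Real.pi * b.re ∧ min b.re b⁻¹.re < Real.pi * b⁻¹.re := by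
  have hb' := inv_re_pos hb
  have hπ := Real.pi_gt_three
  refine ⟨lt_min hb hb', (min_le_left _ _).trans_lt ?_, (min_le_right _ _).trans_lt ?_⟩ <;> nlinarith

/-- Faddeev's integral may be computed at every admissible height. -/
theorem faddeevIntegral_eq_line {b x : ℂ} {y : ℝ} (hb : 0 < b.re)
    (hx : 2 * |x.im| < b.re + b⁻¹.re) (hy : 0 < y) (h₁ : y < Real.pi * b.re)
    (h₂ : y < Real.pi * b⁻¹.re) : faddeevIntegral b x = ∫ u : ℝ, fadKernel b x (u + y * I) := by
  have key : ∀ {y₁ y₂ : ℝ}, 0 < y₁ → y₁ ≤ y₂ → y₂ < Real.pi * b.re → y₂ < Real.pi * b⁻¹.re →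
      ∫ u : ℝ, fadKernel b x (u + y₁ * I) = ∫ u : ℝ, fadKernel b x (u + y₂ * I) :=
    fun p₁ p₂ p₃ p₄ => integral_line_eq p₂
      ((fadKernel_differentiableOn hb).mono (preimage_mono fun _ hy =>
        ⟨p₁.trans_le hy.1, lt_min (hy.2.trans_lt p₃) (hy.2.trans_lt p₄)⟩))
      fun _ hy => fadKernel_lineDecay hb hx (p₁.trans_le hy.1) (hy.2.trans_lt p₃)
        (hy.2.trans_lt p₄)
  obtain ⟨m₀, m₁, m₂⟩ := height_spec hb
  rw [faddeevIntegral_def]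
  rcases le_total (min b.re b⁻¹.re) y with h | h
  · exact key m₀ h h₁ h₂
  · exact (key hy h m₁ m₂).symm

/-- This symmetry turns the functional equation for shifts by b into the one for shifts by b⁻¹. -/
theorem faddeevIntegral_inv (b x : ℂ) : faddeevIntegral b⁻¹ x = faddeevIntegral b x := by
  rw [faddeevIntegral_def, faddeevIntegral_def, inv_inv, min_comm]
  congr 1
  funext u
  simp only [fadKernel, inv_inv]
  ring_nf

theorem norm_exp_kernel (x : ℂ) (u y : ℝ) : ‖exp (-2 * I * x * (u + y * I))‖ =
    Real.exp (2 * y * x.re) * Real.exp (2 * x.im * u) := by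
  rw [norm_exp, ← Real.exp_add]
  congr 1
  simp; ring

/-- Faddeev's integral tends to zero as `Re x → -∞`, uniformly in closed substrips. -/
theorem exists_norm_faddeevIntegral_le {b : ℂ} {h : ℝ} (hb : 0 < b.re) (h₀ : 0 ≤ h)
    (hh : 2 * h < b.re + b⁻¹.re) :
    ∃ M : ℝ, ∀ x : ℂ, |x.im| ≤ h →
      ‖faddeevIntegral b x‖ ≤ M * Real.exp (2 * min b.re b⁻¹.re * x.re) := by
  obtain ⟨m₀, m₁, m₂⟩ := height_spec hb
  set y := min b.re b⁻¹.re with hy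
  have a₁ : |((h : ℂ) * I).im| = h := by simp [abs_of_nonneg h₀]
  have a₂ : |(-(h : ℂ) * I).im| = h := by simp [abs_of_nonneg h₀]
  have i₁ := (fadKernel_integrable (x := h * I) hb (by rwa [a₁]) m₀ m₁ m₂).norm
  have i₂ := (fadKernel_integrable (x := -h * I) hb (by rwa [a₂]) m₀ m₁ m₂).norm
  -- For |Im x| ≤ h one has e^{2u Im x} ≤ e^{2hu} + e^{-2hu}, so the kernels at ±ih dominate; the
  -- height y of the line contributes the factor e^{2y Re x}.
  refine ⟨∫ u : ℝ, (‖fadKernel b (h * I) (u + y * I)‖ + ‖fadKernel b (-h * I) (u + y * I)‖),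
    fun x hx => ?_⟩
  rw [faddeevIntegral_def, ← hy, mul_comm _ (Real.exp _), ← integral_const_mul]
  refine norm_integral_le_of_norm_le ((i₁.add i₂).const_mul _) (Eventually.of_forall fun u => ?_)
  simp only [fadKernel, norm_div, norm_exp_kernel]
  rw [← add_div, ← mul_div_assoc]
  refine div_le_div_of_nonneg_right ?_ (norm_nonneg _)
  simp only [mul_re, ofReal_re, I_re, mul_zero, ofReal_im, I_im, mul_one, sub_self, Real.exp_zero,
    one_mul, mul_im, add_zero, neg_re, neg_im, neg_zero]
  refine mul_le_mul_of_nonneg_left ?_ (Real.exp_pos _).le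
  obtain ⟨hx₁, hx₂⟩ := abs_le.1 hx
  rcases le_total 0 u with hu | hu
  · have : Real.exp (2 * x.im * u) ≤ Real.exp (2 * h * u) := by gcongr
    linarith [Real.exp_pos (2 * -h * u)]
  · have : Real.exp (2 * x.im * u) ≤ Real.exp (2 * -h * u) :=
      Real.exp_le_exp.2 (by nlinarith)
    linarith [Real.exp_pos (2 * h * u)]

/-! ### The functional equation -/

/-- `∫ e^{-2ixw}/(w sinh(aw)) dw` along the line at height `y`. -/
def sinhDivLine (a x : ℂ) (y : ℝ) : ℂ := ∫ u : ℝ, sinhKernel a x (u + y * I) / (u + y * I)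

theorem line_ne_zero {y : ℝ} (hy : 0 < y) (u : ℝ) : (u : ℂ) + y * I ≠ 0 := fun h => by
  have := congrArg im h
  simp at this
  exact hy.ne' this

theorem norm_div_line_le {y : ℝ} (hy : 0 < y) (u : ℝ) (z : ℂ) :
    ‖z / ((u : ℂ) + y * I)‖ ≤ y⁻¹ * ‖z‖ := by
  rw [norm_div, div_eq_inv_mul]
  have := abs_im_le_norm ((u : ℂ) + y * I)
  simp only [add_im, ofReal_im, mul_im, ofReal_re, I_im, mul_one, I_re, mul_zero, add_zero,
    zero_add, abs_of_pos hy] at this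
  gcongr

theorem sinhKernel_div_continuous {a x : ℂ} {y : ℝ} (ha : 0 < a.re) (hy : 0 < y)
    (hy' : y < Real.pi * a⁻¹.re) :
    Continuous fun u : ℝ => sinhKernel a x (u + y * I) / (u + y * I) :=
  (continuous_line (sinhKernel_differentiableOn ha).continuousOn
    (s := Ioo 0 (Real.pi * a⁻¹.re)) ⟨hy, hy'⟩).div (by fun_prop) (line_ne_zero hy)

/-- Differentiation under the integral brings down -2iw, which cancels the factor 1/w. -/
theorem hasDerivAt_sinhDivLine {a x : ℂ} {y : ℝ} (hx : 2 * |x.im| < a.re) (hy : 0 < y)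
    (hy' : y < Real.pi * a⁻¹.re) :
    HasDerivAt (fun x => sinhDivLine a x y) (-2 * I * sinhLine a x y) x := by
  have ha : 0 < a.re := by have := abs_nonneg x.im; linarith
  obtain ⟨C, δ, hδ, H⟩ := sinhKernel_bound hx hy hy'
  have ht : Tendsto (fun x : ℂ => (x, y)) (𝓝 x) (𝓝 (x, y)) :=
    (Continuous.prodMk_left y).tendsto x
  have H' := ht.eventually H
  have hint : Integrable fun u : ℝ => sinhKernel a x (u + y * I) / (u + y * I) :=
    ((sinhKernel_integrable hx hy hy').norm.const_mul y⁻¹).mono'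
      (sinhKernel_div_continuous ha hy hy').aestronglyMeasurable
      (Eventually.of_forall fun u => norm_div_line_le hy u _)
  have := (hasDerivAt_integral_of_dominated_loc_of_deriv_le (μ := volume) (𝕜 := ℂ)
    (F := fun x (u : ℝ) => sinhKernel a x (u + y * I) / (u + y * I))
    (F' := fun x (u : ℝ) => -2 * I * sinhKernel a x (u + y * I)) (x₀ := x)
    (bound := fun u => 2 * (C * Real.exp (-δ * |u|))) H'
    (Eventually.of_forall fun x => (sinhKernel_div_continuous ha hy hy').aestronglyMeasurable)
    hint ((sinhKernel_integrable hx hy hy').const_mul _).aestronglyMeasurable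
    (Eventually.of_forall fun u x hx => by
      rw [norm_mul, norm_mul, norm_I]
      simpa using hx u)
    ((integrable_exp_neg_mul_abs hδ C).const_mul 2)
    (Eventually.of_forall fun u x _ => by
      have h0 := line_ne_zero hy u
      simp only [sinhKernel]
      have h1 : HasDerivAt (fun x : ℂ => exp (-2 * I * x * (u + y * I)))
          (exp (-2 * I * x * (u + y * I)) * (-2 * I * (u + y * I))) x := by
        have := (((hasDerivAt_id x).const_mul (-2 * I)).mul_const ((u : ℂ) + y * I)).cexp
        simpa using this
      have h2 := (h1.div_const (sinh (a * (u + y * I)))).div_const ((u : ℂ) + y * I)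
      convert! h2 using 1
      rw [eq_div_iff h0]
      ring)).2
  rw [sinhLine, ← integral_const_mul]
  exact this

/-- The product Q of exp(½∫) with 1 + e^{2πx/a} has zero derivative by the evaluation of `sinhLine`,
hence is constant on the strip; it tends to 1 as x → -∞ along the reals. Working with exponentials
avoids choosing a logarithm. -/
theorem exp_neg_half_sinhDivLine {a x : ℂ} {y : ℝ} (hx : 2 * |x.im| < a.re) (hy : 0 < y)
    (hy' : y < Real.pi * a⁻¹.re) :
    exp (-(sinhDivLine a x y / 2)) = 1 + exp (2 * Real.pi * a⁻¹ * x) := by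
  have ha : 0 < a.re := by have := abs_nonneg x.im; linarith
  set s : Set ℂ := im ⁻¹' Ioo (-(a.re / 2)) (a.re / 2) with hs
  have hmem : ∀ x : ℂ, x ∈ s ↔ 2 * |x.im| < a.re := fun x => by
    rw [hs, mem_preimage, mem_Ioo]
    constructor
    · intro h
      have := abs_lt.2 ⟨h.1, h.2⟩
      linarith
    · intro h
      exact abs_lt.1 (by linarith)
  set Q : ℂ → ℂ := fun x => exp (sinhDivLine a x y / 2) * (1 + exp (2 * Real.pi * a⁻¹ * x)) with hQ
  have hQd : ∀ x ∈ s, HasDerivAt Q 0 x := by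
    intro x hx
    have h1 := ((hasDerivAt_sinhDivLine ((hmem x).1 hx) hy hy').div_const 2).cexp
    have h2 : HasDerivAt (fun x : ℂ => 1 + exp (2 * Real.pi * a⁻¹ * x))
        (exp (2 * Real.pi * a⁻¹ * x) * (2 * Real.pi * a⁻¹)) x := by
      have := (((hasDerivAt_id x).const_mul (2 * Real.pi * a⁻¹)).cexp).const_add 1
      simpa using this
    have h3 := h1.mul h2
    convert! h3 using 1
    have h4 := one_add_exp_mul_sinhLine ((hmem x).1 hx) hy hy'
    linear_combination (exp (sinhDivLine a x y / 2) * I) * h4 -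
      (exp (sinhDivLine a x y / 2) * (2 * Real.pi * a⁻¹ * exp (2 * Real.pi * a⁻¹ * x))) * I_mul_I
  have hso : IsOpen s := isOpen_Ioo.preimage continuous_im
  have hsc : IsPreconnected s :=
    ((convex_Ioo (-(a.re / 2)) (a.re / 2)).linear_preimage imLm).isPreconnected
  have hconst : ∀ r : ℝ, Q r = Q x := fun r =>
    hso.is_const_of_deriv_eq_zero hsc
      (fun x hx => (hQd x hx).differentiableAt.differentiableWithinAt)
      (fun x hx => (hQd x hx).deriv) ((hmem r).2 (by simpa using ha)) ((hmem x).2 hx)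
  have hκ : Tendsto (fun r : ℝ => sinhDivLine a r y) atBot (𝓝 0) := by
    -- On the line at height y > 0, a real x = r changes the norm of the integrand only by the
    -- factor e^{2yr}.
    have hM : ∀ r : ℝ, ‖sinhDivLine a r y‖ ≤ Real.exp (2 * y * r) *
        ∫ u : ℝ, ‖sinhKernel a 0 (u + y * I) / (u + y * I)‖ := fun r => by
      rw [← integral_const_mul]
      refine (norm_integral_le_integral_norm _).trans (le_of_eq ?_)
      congr 1
      funext u
      simp only [sinhKernel, norm_div, norm_exp_kernel]
      simp only [ofReal_re, ofReal_im, zero_re, zero_im, mul_zero, zero_mul, Real.exp_zero]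
      ring
    refine squeeze_zero_norm hM ?_
    have : Tendsto (fun r : ℝ => 2 * y * r) atBot atBot :=
      tendsto_id.const_mul_atBot (by positivity)
    simpa using (Real.tendsto_exp_atBot.comp this).mul_const
      (∫ u : ℝ, ‖sinhKernel a 0 (u + y * I) / (u + y * I)‖)
  have he : Tendsto (fun r : ℝ => exp (2 * Real.pi * a⁻¹ * r)) atBot (𝓝 0) := by
    refine tendsto_exp_comap_re_atBot.comp ?_
    rw [tendsto_comap_iff]
    have : (re ∘ fun r : ℝ => 2 * Real.pi * a⁻¹ * (r : ℂ)) =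
        fun r : ℝ => (2 * Real.pi * a⁻¹.re) * r := by
      funext r
      simp
    rw [this]
    exact tendsto_id.const_mul_atBot (by have := inv_re_pos ha; positivity)
  have hlim : Tendsto (fun r : ℝ => Q r) atBot (𝓝 1) := by
    have := ((hκ.div_const 2).cexp).mul (he.const_add 1)
    simpa using this
  have hQx : Q x = 1 := tendsto_nhds_unique (tendsto_const_nhds.congr fun r => (hconst r).symm) hlim
  rw [exp_neg]
  exact (eq_inv_of_mul_eq_one_right hQx).symm

/-- Functional equation of `exp` of Faddeev's integral. -/
theorem exp_faddeevIntegral_shift {b x : ℂ} (hb : 0 < b.re) (hx : 2 * |x.im| < b⁻¹.re) :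
    exp (faddeevIntegral b (x - I * b / 2)) =
      (1 + exp (2 * Real.pi * b * x)) * exp (faddeevIntegral b (x + I * b / 2)) := by
  obtain ⟨m₀, m₁, m₂⟩ := height_spec hb
  have h := exp_neg_half_sinhDivLine hx m₀ (by rwa [inv_inv])
  rw [inv_inv] at h
  rw [← h, ← Complex.exp_add]
  congr 1
  have him : ∀ s : ℝ, |s| = 1 → 2 * |x.im + s * (b.re / 2)| < b.re + b⁻¹.re := fun s hs => by
    have := abs_add_le x.im (s * (b.re / 2))
    rw [abs_mul, hs, one_mul, abs_of_pos (half_pos hb)] at this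
    linarith
  have i₁ := fadKernel_integrable (x := x - I * b / 2) hb (by
    have := him (-1) (by simp)
    convert this using 3
    simp; ring) m₀ m₁ m₂
  have i₂ := fadKernel_integrable (x := x + I * b / 2) hb (by
    have := him 1 (by simp)
    convert this using 3
    simp) m₀ m₁ m₂
  rw [← sub_eq_iff_eq_add, faddeevIntegral_def, faddeevIntegral_def, ← integral_sub i₁ i₂,
    sinhDivLine, ← integral_div, ← integral_neg]
  refine integral_congr_ae (Eventually.of_forall fun u => ?_)
  simp only
  set w : ℂ := (u : ℂ) + (min b.re b⁻¹.re : ℝ) * I with hw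
  have hwim : w.im = min b.re b⁻¹.re := by simp [hw]
  have hd := fadKernel_denom_ne_zero hb (w := w) (by rw [hwim]; exact m₀) (by rw [hwim]; exact m₁)
    (by rw [hwim]; exact m₂)
  have hs : sinh (b * w) ≠ 0 := fun h => by simp [h] at hd
  have hs' : sinh (b⁻¹ * w) ≠ 0 := fun h => by simp [h] at hd
  have hw0 : w ≠ 0 := fun h => by simp [h] at hd
  have e₁ : exp (-2 * I * (x - I * b / 2) * w) = exp (-2 * I * x * w) * exp (-(b * w)) := by
    rw [← Complex.exp_add]
    congr 1
    linear_combination (b * w) * I_mul_I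
  have e₂ : exp (-2 * I * (x + I * b / 2) * w) = exp (-2 * I * x * w) * exp (b * w) := by
    rw [← Complex.exp_add]
    congr 1
    linear_combination (-b * w) * I_mul_I
  -- The difference of the two numerators is -2 sinh(bw) times e^{-2ixw}; it cancels one sinh and
  -- leaves -½ times the integrand of `sinhDivLine` for a = b⁻¹.
  have e₃ : exp (b * w) = exp (-(b * w)) + 2 * sinh (b * w) := by
    rw [two_sinh]; ring
  simp only [fadKernel, sinhKernel, e₁, e₂, e₃]
  generalize sinh (b * w) = S at hs
  generalize sinh (b⁻¹ * w) = S' at hs'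
  field_simp
  ring

/-! ### Osgood's lemma -/

/-- The bilinear form `(g, h) ↦ ∫∫ M(θ,φ) g(θ) h(φ) dφ dθ` over `[0, 2π]²`. -/
theorem exists_bilinear_integral {M : ℝ → ℝ → ℂ} (hM : Continuous fun p : ℝ × ℝ => M p.1 p.2) :
    ∃ T : (ℝ →ᵇ ℂ) →L[ℂ] (ℝ →ᵇ ℂ) →L[ℂ] ℂ, ∀ g h, T g h =
      ∫ θ in (0 : ℝ)..2 * Real.pi, g θ * ∫ φ in (0 : ℝ)..2 * Real.pi, h φ * M θ φ := by
  have c₁ : ∀ (h : ℝ →ᵇ ℂ) (θ : ℝ), Continuous fun φ => h φ * M θ φ := fun h θ =>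
    h.continuous.mul (hM.comp (Continuous.prodMk_right θ))
  have c₂ : ∀ h : ℝ →ᵇ ℂ, Continuous fun θ => ∫ φ in (0 : ℝ)..2 * Real.pi, h φ * M θ φ :=
    fun h => intervalIntegral.continuous_parametric_intervalIntegral_of_continuous'
      (f := fun θ φ => h φ * M θ φ) ((h.continuous.comp continuous_snd).mul hM) _ _
  have c₃ : ∀ g h : ℝ →ᵇ ℂ, Continuous fun θ =>
      g θ * ∫ φ in (0 : ℝ)..2 * Real.pi, h φ * M θ φ := fun g h => g.continuous.mul (c₂ h)
  obtain ⟨B, hB⟩ := (isCompact_Icc (a := (0 : ℝ)) (b := 2 * Real.pi)).prod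
    (isCompact_Icc (a := (0 : ℝ)) (b := 2 * Real.pi)) |>.exists_bound_of_continuousOn
    hM.continuousOn
  have hπ : (0 : ℝ) ≤ 2 * Real.pi := by positivity
  have hsub : ∀ θ ∈ uIoc (0 : ℝ) (2 * Real.pi), θ ∈ Icc (0 : ℝ) (2 * Real.pi) := fun θ hθ =>
    Ioc_subset_Icc_self (by rwa [uIoc_of_le hπ] at hθ)
  let L : (ℝ →ᵇ ℂ) →ₗ[ℂ] (ℝ →ᵇ ℂ) →ₗ[ℂ] ℂ := LinearMap.mk₂ ℂ
    (fun g h => ∫ θ in (0 : ℝ)..2 * Real.pi, g θ * ∫ φ in (0 : ℝ)..2 * Real.pi, h φ * M θ φ)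
    (fun g₁ g₂ h => by
      rw [← intervalIntegral.integral_add
        ((c₃ g₁ h).intervalIntegrable _ _)
        ((c₃ g₂ h).intervalIntegrable _ _)]
      simp [add_mul])
    (fun c g h => by
      rw [smul_eq_mul, ← intervalIntegral.integral_const_mul]
      simp [mul_assoc])
    (fun g h₁ h₂ => by
      rw [← intervalIntegral.integral_add
        ((c₃ g h₁).intervalIntegrable _ _)
        ((c₃ g h₂).intervalIntegrable _ _)]
      refine intervalIntegral.integral_congr fun θ _ => ?_
      rw [← mul_add, ← intervalIntegral.integral_add
        ((c₁ h₁ θ).intervalIntegrable _ _) ((c₁ h₂ θ).intervalIntegrable _ _)]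
      simp [add_mul])
    (fun c g h => by
      rw [smul_eq_mul, ← intervalIntegral.integral_const_mul]
      refine intervalIntegral.integral_congr fun θ _ => ?_
      rw [mul_left_comm, ← intervalIntegral.integral_const_mul]
      simp [mul_assoc])
  refine ⟨L.mkContinuous₂ ((2 * Real.pi) * (2 * Real.pi) * B) fun g h => ?_, fun g h => rfl⟩
  have hin : ∀ θ ∈ uIoc (0 : ℝ) (2 * Real.pi),
      ‖g θ * ∫ φ in (0 : ℝ)..2 * Real.pi, h φ * M θ φ‖ ≤ ‖g‖ * (‖h‖ * B * |2 * Real.pi - 0|) := by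
    intro θ hθ
    rw [norm_mul]
    refine mul_le_mul (g.norm_coe_le_norm θ)
      (intervalIntegral.norm_integral_le_of_norm_le_const fun φ hφ => ?_) (norm_nonneg _)
      (norm_nonneg _)
    rw [norm_mul]
    exact mul_le_mul (h.norm_coe_le_norm φ) (hB (θ, φ) ⟨hsub θ hθ, hsub φ hφ⟩) (norm_nonneg _)
      (norm_nonneg _)
  have := intervalIntegral.norm_integral_le_of_norm_le_const hin
  rw [sub_zero, abs_of_nonneg hπ] at this
  calc _ ≤ _ := this
    _ = _ := by ring

/-- The Cauchy kernel on a circle is an analytic function with values in the bounded continuous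
functions. -/
theorem exists_analytic_cauchyKernel (c : ℂ) {r : ℝ} (hr : 0 < r) :
    ∃ K : ℂ → (ℝ →ᵇ ℂ), AnalyticAt ℂ K c ∧
      ∀ z ∈ Metric.ball c r, ∀ θ, K z θ = (circleMap c r θ - z)⁻¹ := by
  have hcb : ∀ θ, ‖circleMap c r θ‖ ≤ ‖c‖ + r := fun θ => by
    rw [circleMap]
    refine (norm_add_le _ _).trans ?_
    simp [abs_of_pos hr]
  -- In the Banach algebra of bounded continuous functions the Cauchy kernel is the inverse of m -
  -- z, affine in z, and inversion is analytic at units.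
  let m : ℝ →ᵇ ℂ := BoundedContinuousFunction.ofNormedAddCommGroup (circleMap c r)
    (continuous_circleMap c r) (‖c‖ + r) hcb
  have hunit : ∀ z ∈ Metric.ball c r, ∃ u : (ℝ →ᵇ ℂ)ˣ, (u : ℝ →ᵇ ℂ) = m - z • 1 ∧
      ∀ θ, (↑u⁻¹ : ℝ →ᵇ ℂ) θ = (circleMap c r θ - z)⁻¹ := by
    intro z hz
    have hlow : ∀ θ, r - dist z c ≤ ‖circleMap c r θ - z‖ := fun θ => by
      have h1 : ‖circleMap c r θ - c‖ = r := by simp [circleMap, abs_of_pos hr]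
      have h2 := norm_sub_le_norm_sub_add_norm_sub (circleMap c r θ) z c
      rw [h1] at h2
      rw [dist_eq_norm]
      linarith
    have hpos : 0 < r - dist z c := sub_pos.2 hz
    have hne : ∀ θ, circleMap c r θ - z ≠ 0 := fun θ h => by
      have := hlow θ
      rw [h, norm_zero] at this
      linarith
    let v : ℝ →ᵇ ℂ := BoundedContinuousFunction.ofNormedAddCommGroup
      (fun θ => (circleMap c r θ - z)⁻¹)
      (((continuous_circleMap c r).sub continuous_const).inv₀ hne) (r - dist z c)⁻¹
      (fun θ => by
        rw [norm_inv]
        exact inv_anti₀ hpos (hlow θ))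
    have hmv : (m - z • 1) * v = 1 := by
      ext θ
      simp [m, v, hne θ]
    exact ⟨⟨m - z • 1, v, hmv, by rw [mul_comm, hmv]⟩, rfl, fun θ => rfl⟩
  refine ⟨fun z => Ring.inverse (m - z • 1), ?_, fun z hz θ => ?_⟩
  · obtain ⟨u, hu, -⟩ := hunit c (Metric.mem_ball_self hr)
    have h1 : AnalyticAt ℂ (fun z : ℂ => m - z • (1 : ℝ →ᵇ ℂ)) c :=
      analyticAt_const.sub (analyticAt_id.smul analyticAt_const)
    refine AnalyticAt.fun_comp (g := Ring.inverse) ?_ h1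
    rw [← hu]
    exact analyticAt_inverse u
  · obtain ⟨u, hu, hu'⟩ := hunit z hz
    simp only
    rw [← hu, Ring.inverse_unit, hu']

theorem cauchy_formula_interval {c : ℂ} {r : ℝ} {f : ℂ → ℂ}
    (hf : DifferentiableOn ℂ f (Metric.closedBall c r)) {z : ℂ} (hz : z ∈ Metric.ball c r) :
    f z = ∫ θ in (0 : ℝ)..2 * Real.pi, (circleMap c r θ - z)⁻¹ *
      ((2 * Real.pi * I)⁻¹ * deriv (circleMap c r) θ * f (circleMap c r θ)) := by
  have h := hf.circleIntegral_sub_inv_smul hz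
  rw [circleIntegral] at h
  have hne : (2 * Real.pi * I : ℂ) ≠ 0 := by simp [Real.pi_ne_zero]
  rw [← inv_mul_cancel_left₀ hne (f z), ← smul_eq_mul (2 * Real.pi * I : ℂ), ← h,
    ← intervalIntegral.integral_const_mul]
  refine intervalIntegral.integral_congr fun θ _ => ?_
  simp only [smul_eq_mul]
  ring

/-- **Osgood's lemma**: a continuous function of two complex variables that is holomorphic in each
variable is analytic. -/
theorem analyticAt_of_separately_differentiable {f : ℂ × ℂ → ℂ} {U : Set (ℂ × ℂ)} (hU : IsOpen U)
    (hc : ContinuousOn f U) (h₁ : ∀ p ∈ U, DifferentiableAt ℂ (fun z => f (z, p.2)) p.1)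
    (h₂ : ∀ p ∈ U, DifferentiableAt ℂ (fun w => f (p.1, w)) p.2) {p : ℂ × ℂ} (hp : p ∈ U) :
    AnalyticAt ℂ f p := by
  obtain ⟨R, hR, hRU⟩ := Metric.isOpen_iff.1 hU p hp
  obtain ⟨r, hr, hrR⟩ := exists_between hR
  have hball : ∀ z ∈ Metric.closedBall p.1 r, ∀ w ∈ Metric.closedBall p.2 r, (z, w) ∈ U := by
    intro z hz w hw
    refine hRU ?_
    rw [Metric.mem_ball, Prod.dist_eq]
    exact max_lt (lt_of_le_of_lt hz hrR) (lt_of_le_of_lt hw hrR)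
  have hcirc : ∀ (c : ℂ) θ, circleMap c r θ ∈ Metric.closedBall c r := fun c θ =>
    circleMap_mem_closedBall c hr.le θ
  obtain ⟨K, hK, hK'⟩ := exists_analytic_cauchyKernel p.1 hr
  obtain ⟨L, hL, hL'⟩ := exists_analytic_cauchyKernel p.2 hr
  have hdc : ∀ c : ℂ, Continuous (deriv (circleMap c r)) := fun c => by
    have : deriv (circleMap c r) = fun θ => circleMap 0 r θ * I := by
      funext θ; simp
    rw [this]
    fun_prop
  set M : ℝ → ℝ → ℂ := fun θ φ => (2 * Real.pi * I)⁻¹ * deriv (circleMap p.1 r) θ *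
    ((2 * Real.pi * I)⁻¹ * deriv (circleMap p.2 r) φ *
      f (circleMap p.1 r θ, circleMap p.2 r φ)) with hMdef
  have hM : Continuous fun q : ℝ × ℝ => M q.1 q.2 := by
    refine (continuous_const.mul ((hdc _).comp continuous_fst)).mul
      ((continuous_const.mul ((hdc _).comp continuous_snd)).mul ?_)
    exact hc.comp_continuous (((continuous_circleMap _ _).comp continuous_fst).prodMk
      ((continuous_circleMap _ _).comp continuous_snd)) fun q =>
        hball _ (hcirc _ _) _ (hcirc _ _)
  obtain ⟨T, hT⟩ := exists_bilinear_integral hM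
  -- The iterated Cauchy formula presents f as a continuous bilinear form evaluated at two analytic
  -- functions of one variable each, so no double power series is needed.
  have hfT : ∀ᶠ q in 𝓝 p, f q = T (K q.1) (L q.2) := by
    have hnear : Metric.ball p.1 r ×ˢ Metric.ball p.2 r ∈ 𝓝 p :=
      prod_mem_nhds (Metric.ball_mem_nhds _ hr) (Metric.ball_mem_nhds _ hr)
    filter_upwards [hnear] with q hq
    have e₁ := cauchy_formula_interval (f := fun z => f (z, q.2))
      (fun z hz => (h₁ (z, q.2)
        (hball z hz q.2 (Metric.ball_subset_closedBall hq.2))).differentiableWithinAt) hq.1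
    rw [hT, show f q = f (q.1, q.2) from rfl, e₁]
    refine intervalIntegral.integral_congr fun θ _ => ?_
    have e₂ := cauchy_formula_interval (f := fun w => f (circleMap p.1 r θ, w))
      (fun w hw => (h₂ (circleMap p.1 r θ, w)
        (hball _ (hcirc _ _) w hw)).differentiableWithinAt) hq.2
    rw [hK' _ hq.1, e₂, ← intervalIntegral.integral_const_mul]
    congr 1
    refine intervalIntegral.integral_congr fun φ _ => ?_
    simp only [hMdef]
    rw [hL' _ hq.2]
    ring
  refine AnalyticAt.congr ?_ (EventuallyEq.symm hfT)
  have h1 : AnalyticAt ℂ (fun q : ℂ × ℂ => K q.1) p := hK.fun_comp analyticAt_fst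
  have h2 : AnalyticAt ℂ (fun q : ℂ × ℂ => L q.2) p := hL.fun_comp analyticAt_snd
  exact (T.analyticAt_bilinear (K p.1, L p.2)).comp₂ h1 h2

/-! ### Holomorphic dependence of integrals on parameters -/

/-- Cauchy's estimate converts a bound for F into a bound for its derivative, so domination of F
alone is enough. -/
theorem differentiableAt_integral_of_dominated {α : Type*} [MeasurableSpace α] {μ : Measure α}
    {F : ℂ → α → ℂ} {U : Set ℂ} (hU : IsOpen U)
    {g : α → ℝ} (hg : Integrable g μ) (hm : ∀ z ∈ U, AEStronglyMeasurable (F z) μ)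
    (hd : ∀ u, DifferentiableOn ℂ (fun z => F z u) U) (hb : ∀ z ∈ U, ∀ u, ‖F z u‖ ≤ g u)
    {z₀ : ℂ} (hz : z₀ ∈ U) : DifferentiableAt ℂ (fun z => ∫ u, F z u ∂μ) z₀ := by
  obtain ⟨R, hR, hRU⟩ := Metric.isOpen_iff.1 hU z₀ hz
  -- Closed discs of radius r about points of the r-ball then remain inside U.
  set r := R / 3 with hr
  have hr0 : 0 < r := by positivity
  have hsub : ∀ z ∈ Metric.ball z₀ r, Metric.closedBall z r ⊆ U := fun z hz w hw => by
    refine hRU ?_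
    rw [Metric.mem_ball] at hz ⊢
    rw [Metric.mem_closedBall] at hw
    have := dist_triangle w z z₀
    linarith
  have hmem : ∀ z ∈ Metric.ball z₀ r, z ∈ U := fun z hz =>
    hsub z hz (Metric.mem_closedBall_self hr0.le)
  have hda : ∀ u, ∀ z ∈ Metric.ball z₀ r, HasDerivAt (fun z => F z u) (deriv (fun z => F z u) z) z :=
    fun u z hz => ((hd u).differentiableAt (hU.mem_nhds (hmem z hz))).hasDerivAt
  refine (hasDerivAt_integral_of_dominated_loc_of_deriv_le (F := F)
    (F' := fun z u => deriv (fun z => F z u) z) (bound := fun u => r⁻¹ * g u)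
    (Metric.ball_mem_nhds z₀ hr0) ?_ (hg.mono' (hm z₀ hz) (Eventually.of_forall (hb z₀ hz))) ?_
    (Eventually.of_forall fun u z hz => ?_) (hg.const_mul _)
    (Eventually.of_forall fun u z hz => hda u z hz)).2.differentiableAt
  · filter_upwards [hU.mem_nhds hz] with z hz using hm z hz
  -- Measurability of the derivative at z₀: it is a limit of difference quotients. The 2 in the
  -- denominator keeps every step strictly shorter than r.
  · set t : ℕ → ℂ := fun n => ((r / (n + 2) : ℝ) : ℂ) with ht
    have ht0 : Tendsto t atTop (𝓝[≠] 0) := by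
      refine tendsto_nhdsWithin_iff.2 ⟨?_, Eventually.of_forall fun n => ?_⟩
      · have h1 : Tendsto (fun n : ℕ => r / ((n : ℝ) + 2)) atTop (𝓝 0) :=
          tendsto_const_nhds.div_atTop
            (tendsto_atTop_add_const_right _ _ tendsto_natCast_atTop_atTop)
        have := (continuous_ofReal.tendsto 0).comp h1
        simpa [ht, Function.comp_def] using this
      · have : r / ((n : ℝ) + 2) ≠ 0 := by positivity
        simpa only [ht, mem_compl_iff, mem_singleton_iff, ofReal_eq_zero] using this
    refine aestronglyMeasurable_of_tendsto_ae atTop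
      (f := fun n u => (t n)⁻¹ • (F (z₀ + t n) u - F z₀ u)) (fun n => ?_)
      (Eventually.of_forall fun u => ?_)
    · refine AEStronglyMeasurable.const_smul (𝕜 := ℂ) ((hm _ (hmem _ ?_)).sub (hm z₀ hz)) _
      have hn : (0 : ℝ) < (n : ℝ) + 2 := by positivity
      rw [Metric.mem_ball, dist_eq_norm, add_sub_cancel_left, ht, norm_real, Real.norm_eq_abs,
        abs_of_pos (by positivity)]
      refine div_lt_self hr0 ?_
      have : (0 : ℝ) ≤ n := n.cast_nonneg
      linarith
    · exact (hda u z₀ (Metric.mem_ball_self hr0)).tendsto_slope_zero.comp ht0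
  · have := norm_deriv_le_of_forall_mem_sphere_norm_le (f := fun z => F z u) (C := g u) hr0
      (DifferentiableOn.diffContOnCl (by
        rw [closure_ball _ hr0.ne']
        exact (hd u).mono (hsub z hz)))
      fun w hw => hb w (hsub z hz (Metric.sphere_subset_closedBall hw)) u
    rwa [div_eq_inv_mul] at this

/-- Joint continuity follows from dominated convergence and holomorphy in each variable from the
one-variable case; Osgood's lemma combines them. -/
theorem analyticAt_integral_of_dominated {α : Type*} [MeasurableSpace α] {μ : Measure α}
    {F : ℂ × ℂ → α → ℂ} {U : Set (ℂ × ℂ)} (hU : IsOpen U)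
    {g : α → ℝ} (hg : Integrable g μ) (hm : ∀ z ∈ U, AEStronglyMeasurable (F z) μ)
    (hd : ∀ u, DifferentiableOn ℂ (fun z => F z u) U) (hb : ∀ z ∈ U, ∀ u, ‖F z u‖ ≤ g u)
    {p : ℂ × ℂ} (hp : p ∈ U) : AnalyticAt ℂ (fun z => ∫ u, F z u ∂μ) p := by
  refine analyticAt_of_separately_differentiable hU (fun q hq => ?_) (fun q hq => ?_)
    (fun q hq => ?_) hp
  · refine (continuousAt_of_dominated (bound := g) ?_ ?_ hg ?_).continuousWithinAt
    · filter_upwards [hU.mem_nhds hq] with z hz using hm z hz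
    · filter_upwards [hU.mem_nhds hq] with z hz using Eventually.of_forall (hb z hz)
    · exact Eventually.of_forall fun u =>
        ((hd u).differentiableAt (hU.mem_nhds hq)).continuousAt
  · have hV : IsOpen ((fun z => (z, q.2)) ⁻¹' U) := hU.preimage (by fun_prop)
    exact differentiableAt_integral_of_dominated (F := fun z => F (z, q.2)) hV hg
      (fun z hz => hm _ hz)
      (fun u => (hd u).comp (f := fun z : ℂ => (z, q.2)) (by fun_prop) fun z hz => hz)
      (fun z hz => hb _ hz) hq
  · have hV : IsOpen ((fun z => (q.1, z)) ⁻¹' U) := hU.preimage (by fun_prop)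
    exact differentiableAt_integral_of_dominated (F := fun z => F (q.1, z)) hV hg
      (fun z hz => hm _ hz)
      (fun u => (hd u).comp (f := fun z : ℂ => (q.1, z)) (by fun_prop) fun z hz => hz)
      (fun z hz => hb _ hz) hq

/-- Faddeev's integral is an analytic function of `(b, x)`. -/
theorem analyticAt_faddeevIntegral {b₀ x₀ : ℂ} (hb : 0 < b₀.re)
    (hx : 2 * |x₀.im| < b₀.re + b₀⁻¹.re) :
    AnalyticAt ℂ (fun p : ℂ × ℂ => faddeevIntegral p.1 p.2) (b₀, x₀) := by
  have hb0 : b₀ ≠ 0 := fun h => by simp [h] at hb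
  obtain ⟨m₀, m₁, m₂⟩ := height_spec hb
  -- The height in `faddeevIntegral` depends on b, and not holomorphically. It is frozen at its
  -- value for b₀, which is admissible for all nearby b, and the two integrals agree.
  set y := min b₀.re b₀⁻¹.re
  obtain ⟨C, δ, hδ, H⟩ := fadKernel_bound hb hx m₀ m₁ m₂
  have ht : Tendsto (fun p : ℂ × ℂ => (p, y)) (𝓝 (b₀, x₀)) (𝓝 ((b₀, x₀), y)) :=
    (Continuous.prodMk_left y).tendsto (b₀, x₀)
  have hinv : ContinuousAt (fun p : ℂ × ℂ => p.1⁻¹.re) (b₀, x₀) :=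
    continuous_re.continuousAt.comp (ContinuousAt.inv₀ (by fun_prop) hb0)
  have e₁ : ∀ᶠ p : ℂ × ℂ in 𝓝 (b₀, x₀), 0 < p.1.re :=
    ContinuousAt.eventually_lt continuousAt_const (by fun_prop) hb
  have e₂ : ∀ᶠ p : ℂ × ℂ in 𝓝 (b₀, x₀), 2 * |p.2.im| < p.1.re + p.1⁻¹.re :=
    ContinuousAt.eventually_lt (by fun_prop) (ContinuousAt.add (by fun_prop) hinv) hx
  have e₃ : ∀ᶠ p : ℂ × ℂ in 𝓝 (b₀, x₀), y < Real.pi * p.1.re :=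
    ContinuousAt.eventually_lt continuousAt_const (by fun_prop) m₁
  have e₄ : ∀ᶠ p : ℂ × ℂ in 𝓝 (b₀, x₀), y < Real.pi * p.1⁻¹.re :=
    ContinuousAt.eventually_lt continuousAt_const (continuousAt_const.mul hinv) m₂
  obtain ⟨U, hUs, hU, hpU⟩ := mem_nhds_iff.1
    ((ht.eventually H).and (e₁.and (e₂.and (e₃.and e₄))))
  have key : AnalyticAt ℂ (fun p : ℂ × ℂ => ∫ u : ℝ, fadKernel p.1 p.2 (u + y * I)) (b₀, x₀) := by
    refine analyticAt_integral_of_dominated hU (integrable_exp_neg_mul_abs hδ C)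
      (fun p hp => ?_) (fun u => ?_) (fun p hp u => (hUs hp).1 u) hpU
    · obtain ⟨-, q₁, q₂, q₃, q₄⟩ := hUs hp
      exact (fadKernel_integrable q₁ q₂ m₀ q₃ q₄).aestronglyMeasurable
    · unfold fadKernel
      have hdi : DifferentiableOn ℂ (fun p : ℂ × ℂ => p.1⁻¹) U := fun p hp =>
        (differentiableAt_fst.inv fun h => by
          have := (hUs hp).2.1
          rw [h] at this
          simp at this).differentiableWithinAt
      have hs : DifferentiableOn ℂ (fun p : ℂ × ℂ => sinh (p.1⁻¹ * ((u : ℂ) + y * I))) U :=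
        (hdi.mul_const _).csinh
      have hn : DifferentiableOn ℂ (fun p : ℂ × ℂ => exp (-2 * I * p.2 * ((u : ℂ) + y * I))) U := by
        fun_prop
      have hd : DifferentiableOn ℂ (fun p : ℂ × ℂ => 4 * sinh (p.1 * ((u : ℂ) + y * I)) *
          sinh (p.1⁻¹ * ((u : ℂ) + y * I)) * ((u : ℂ) + y * I)) U :=
        ((by fun_prop : DifferentiableOn ℂ
          (fun p : ℂ × ℂ => 4 * sinh (p.1 * ((u : ℂ) + y * I))) U).mul hs).mul_const _
      refine fun p hp => ((hn p hp).mul ((hd p hp).inv ?_)).congr_of_eventuallyEq ?_ ?_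
      · obtain ⟨-, q₁, q₂, q₃, q₄⟩ := hUs hp
        exact fadKernel_denom_ne_zero q₁ (by simpa using m₀) (by simpa using q₃)
          (by simpa only [add_im, ofReal_im, mul_im, ofReal_re, I_im, mul_one, I_re, mul_zero,
            add_zero, zero_add] using q₄)
      · exact Eventually.of_forall fun _ => div_eq_mul_inv _ _
      · exact div_eq_mul_inv _ _
  refine key.congr ?_
  filter_upwards [hU.mem_nhds hpU] with p hp
  obtain ⟨-, q₁, q₂, q₃, q₄⟩ := hUs hp
  exact (faddeevIntegral_eq_line q₁ q₂ m₀ q₃ q₄).symm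

/-! ### Exponentials and lattices -/

theorem e_add (x y : ℂ) : e (x + y) = e x * e y := by
  rw [e, e, e, ← Complex.exp_add]; ring_nf

theorem e_ne_zero (x : ℂ) : e x ≠ 0 := Complex.exp_ne_zero _

theorem e_neg (x : ℂ) : e (-x) = (e x)⁻¹ := by
  rw [e, e, ← Complex.exp_neg]; ring_nf

theorem e_intCast (n : ℤ) : e n = 1 := by
  rw [e, mul_comm]
  exact Complex.exp_int_mul_two_pi_mul_I n

theorem e_add_intCast (x : ℂ) (n : ℤ) : e (x + n) = e x := by rw [e_add, e_intCast, mul_one]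

theorem e_add_one (x : ℂ) : e (x + 1) = e x := by simpa using e_add_intCast x 1

theorem e_int_mul (n : ℤ) (x : ℂ) : e (n * x) = e x ^ n := by
  rw [e, e, ← Complex.exp_int_mul]; ring_nf

theorem e_nat_mul (n : ℕ) (x : ℂ) : e (n * x) = e x ^ n := by
  rw [e, e, ← Complex.exp_nat_mul]; ring_nf

theorem e_eq_one_iff {x : ℂ} : e x = 1 ↔ ∃ n : ℤ, x = n := by
  rw [e, Complex.exp_eq_one_iff]
  refine exists_congr fun n => ?_
  constructor
  · intro h
    have : (2 * Real.pi * I : ℂ) ≠ 0 := Complex.two_pi_I_ne_zero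
    apply mul_left_cancel₀ this
    rw [h]; ring
  · rintro rfl; ring

theorem norm_e (x : ℂ) : ‖e x‖ = Real.exp (-(2 * Real.pi * x.im)) := by
  rw [e, norm_exp]
  congr 1
  simp

theorem mem_lattice_iff {z τ : ℂ} :
    z ∈ latticeTranslates {0} τ ↔ ∃ m n : ℤ, z = m + n * τ := by
  simp [latticeTranslates]

theorem add_mem_lattice_iff {z τ : ℂ} (m n : ℤ) :
    z + m + n * τ ∈ latticeTranslates {0} τ ↔ z ∈ latticeTranslates {0} τ := by
  rw [mem_lattice_iff, mem_lattice_iff]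
  constructor
  · rintro ⟨a, b, h⟩
    refine ⟨a - m, b - n, ?_⟩
    push_cast
    linear_combination h
  · rintro ⟨a, b, h⟩
    refine ⟨a + m, b + n, ?_⟩
    push_cast
    linear_combination h

theorem one_sub_e_ne_zero {z τ : ℂ} (hz : z ∉ latticeTranslates {0} τ) (n : ℤ) :
    1 - e (z + n * τ) ≠ 0 := by
  intro h
  obtain ⟨m, hm⟩ := e_eq_one_iff.1 (sub_eq_zero.1 h).symm
  exact hz (mem_lattice_iff.2 ⟨m, -n, by push_cast; linear_combination hm⟩)

/-! ### The function `exp(-∫)` in the variables `(z, τ)` -/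

/-- The square root `b = √τ`. -/
def rootTau (τ : ℂ) : ℂ := τ ^ (1 / 2 : ℂ)

theorem rootTau_sq (τ : ℂ) : rootTau τ * rootTau τ = τ := by
  rw [rootTau, ← sq]
  simp

theorem rootTau_re_pos {τ : ℂ} (hτ : τ ∈ slitPlane) : 0 < (rootTau τ).re := by
  have h0 := slitPlane_ne_zero hτ
  have him : (log τ * (1 / 2)).im = τ.arg / 2 := by
    rw [show (1 / 2 : ℂ) = ((1 / 2 : ℝ) : ℂ) by push_cast; rfl, im_mul_ofReal, log_im]; ring
  rw [rootTau, cpow_def_of_ne_zero h0, exp_re, him]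
  refine mul_pos (Real.exp_pos _) (Real.cos_pos_of_mem_Ioo ⟨?_, ?_⟩)
  · have := neg_pi_lt_arg τ; linarith
  · have h1 := arg_le_pi τ
    have h2 := (mem_slitPlane_iff_arg.1 hτ).1
    have := lt_of_le_of_ne h1 h2
    linarith

theorem rootTau_ne_zero {τ : ℂ} (hτ : τ ∈ slitPlane) : rootTau τ ≠ 0 := fun h => by
  have := rootTau_re_pos hτ
  simp [h] at this

/-- The argument `iz/b + ib/2 + 1/(2ib)` of the quantum dilogarithm. -/
def dilogArg (z τ : ℂ) : ℂ :=
  I * z / rootTau τ + I * rootTau τ / 2 + 1 / (2 * I * rootTau τ)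

/-- The exponential of minus Faddeev's integral at `dilogArg z τ`. -/
def stripFun (z τ : ℂ) : ℂ := exp (-faddeevIntegral (rootTau τ) (dilogArg z τ))

/-- The strip of convergence in the variable `z`. -/
def InStrip (z τ : ℂ) : Prop :=
  -(rootTau τ).re < (z / rootTau τ).re ∧ (z / rootTau τ).re < (rootTau τ)⁻¹.re

theorem dilogArg_eq {z τ : ℂ} : dilogArg z τ =
    I * (z / rootTau τ + rootTau τ / 2 - (rootTau τ)⁻¹ / 2) := by
  have : 1 / (2 * I * rootTau τ) = -I * (rootTau τ)⁻¹ / 2 := by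
    rw [one_div, mul_inv, mul_inv, inv_I]; ring
  rw [dilogArg, this]; ring

theorem dilogArg_im {z τ : ℂ} : (dilogArg z τ).im =
    (z / rootTau τ).re + (rootTau τ).re / 2 - (rootTau τ)⁻¹.re / 2 := by
  rw [dilogArg_eq, I_mul_im, sub_re, add_re]
  simp only [div_ofNat_re]

theorem dilogArg_re {z τ : ℂ} : (dilogArg z τ).re =
    -((z / rootTau τ).im + (rootTau τ).im / 2 - (rootTau τ)⁻¹.im / 2) := by
  rw [dilogArg_eq, I_mul_re, sub_im, add_im]
  simp only [div_ofNat_im]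

theorem inStrip_iff {z τ : ℂ} :
    InStrip z τ ↔ 2 * |(dilogArg z τ).im| < (rootTau τ).re + (rootTau τ)⁻¹.re := by
  rw [dilogArg_im, InStrip]
  constructor
  · rintro ⟨h1, h2⟩
    have := abs_lt.2 (show -(((rootTau τ).re + (rootTau τ)⁻¹.re) / 2) < (z / rootTau τ).re +
      (rootTau τ).re / 2 - (rootTau τ)⁻¹.re / 2 ∧ (z / rootTau τ).re +
      (rootTau τ).re / 2 - (rootTau τ)⁻¹.re / 2 < ((rootTau τ).re + (rootTau τ)⁻¹.re) / 2 from
      ⟨by linarith, by linarith⟩)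
    linarith
  · intro h
    have := abs_lt.1 (show |(z / rootTau τ).re + (rootTau τ).re / 2 - (rootTau τ)⁻¹.re / 2| <
      ((rootTau τ).re + (rootTau τ)⁻¹.re) / 2 by linarith)
    constructor <;> linarith [this.1, this.2]

theorem tau_div_rootTau {τ : ℂ} (hτ : τ ∈ slitPlane) : τ / rootTau τ = rootTau τ :=
  (div_eq_iff (rootTau_ne_zero hτ)).2 (rootTau_sq τ).symm

/-- In the coordinate Re(z/√τ), translation by τ is a step of Re √τ and translation by 1 a step of
Re(1/√τ). The strip has exactly the sum of the two as width. -/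
theorem add_mul_div_rootTau_re {z τ : ℂ} (hτ : τ ∈ slitPlane) (N : ℤ) :
    ((z + N * τ) / rootTau τ).re = (z / rootTau τ).re + N * (rootTau τ).re := by
  rw [add_div, mul_div_assoc, tau_div_rootTau hτ, add_re, ← ofReal_intCast, re_ofReal_mul]

theorem add_one_div_rootTau_re {z τ : ℂ} :
    ((z + 1) / rootTau τ).re = (z / rootTau τ).re + (rootTau τ)⁻¹.re := by
  rw [add_div, add_re, one_div]

/-- This is Faddeev's functional equation at the midpoint x of the two arguments, where e^{2πbx} =
-e(z+τ). Both ends lying in the strip is what puts x in the range where the equation is known. -/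
theorem stripFun_add_tau {z τ : ℂ} (hτ : τ ∈ slitPlane) (h₁ : InStrip z τ)
    (h₂ : InStrip (z + τ) τ) : stripFun (z + τ) τ = (1 - e (z + τ)) * stripFun z τ := by
  set b := rootTau τ with hb
  have hb0 : b ≠ 0 := rootTau_ne_zero hτ
  have hbb : b * b = τ := rootTau_sq τ
  have hs : (dilogArg z τ + I * b / 2).im = (dilogArg z τ).im + b.re / 2 := by
    rw [add_im, mul_div_assoc, I_mul_im, div_ofNat_re]
  have h₂' := h₂.2
  have h₃ := add_mul_div_rootTau_re (z := z) hτ 1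
  rw [Int.cast_one, one_mul, Int.cast_one, one_mul] at h₃
  have hx : 2 * |(dilogArg z τ + I * b / 2).im| < b⁻¹.re := by
    have := abs_lt.2 (show -(b⁻¹.re / 2) < (dilogArg z τ + I * b / 2).im ∧
      (dilogArg z τ + I * b / 2).im < b⁻¹.re / 2 by
        rw [hs, dilogArg_im, ← hb]
        rw [h₃] at h₂'
        constructor <;> linarith [h₁.1])
    linarith
  have key := exp_faddeevIntegral_shift (rootTau_re_pos hτ) hx
  have a₁ : dilogArg z τ + I * b / 2 - I * b / 2 = dilogArg z τ := by ring
  have a₂ : dilogArg z τ + I * b / 2 + I * b / 2 = dilogArg (z + τ) τ := by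
    rw [dilogArg_eq, dilogArg_eq, add_div z, tau_div_rootTau hτ]; ring
  have a₃ : exp (2 * Real.pi * b * (dilogArg z τ + I * b / 2)) = -e (z + τ) := by
    have : 2 * Real.pi * b * (dilogArg z τ + I * b / 2) =
        2 * Real.pi * I * (z + τ) - Real.pi * I := by
      rw [dilogArg_eq, ← hb, ← hbb]
      field_simp
      ring
    rw [this, exp_sub, exp_pi_mul_I, e, div_neg, div_one]
  rw [← hb, a₁, a₂, a₃] at key
  rw [stripFun, stripFun, exp_neg, exp_neg, ← hb, key, mul_inv, ← sub_eq_add_neg, ← mul_assoc,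
    mul_inv_cancel₀, one_mul]
  intro h
  rw [← sub_eq_add_neg, h, zero_mul] at key
  exact Complex.exp_ne_zero _ key

/-- The same midpoint argument with b⁻¹ in place of b. -/
theorem stripFun_add_one {z τ : ℂ} (hτ : τ ∈ slitPlane) (h₁ : InStrip z τ)
    (h₂ : InStrip (z + 1) τ) : stripFun (z + 1) τ = (1 - e (z / τ)) * stripFun z τ := by
  set b := rootTau τ with hb
  have hb0 : b ≠ 0 := rootTau_ne_zero hτ
  have hbb : b * b = τ := rootTau_sq τ
  have hs : (dilogArg z τ + I * b⁻¹ / 2).im = (dilogArg z τ).im + b⁻¹.re / 2 := by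
    rw [add_im, mul_div_assoc, I_mul_im, div_ofNat_re]
  have h₂' := h₂.2
  have h₃ := add_one_div_rootTau_re (z := z) (τ := τ)
  have hx : 2 * |(dilogArg z τ + I * b⁻¹ / 2).im| < b⁻¹⁻¹.re := by
    have := abs_lt.2 (show -(b.re / 2) < (dilogArg z τ + I * b⁻¹ / 2).im ∧
      (dilogArg z τ + I * b⁻¹ / 2).im < b.re / 2 by
        rw [hs, dilogArg_im, ← hb]
        rw [h₃] at h₂'
        constructor <;> linarith [h₁.1])
    rw [inv_inv]
    linarith
  have key := exp_faddeevIntegral_shift (inv_re_pos (rootTau_re_pos hτ)) hx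
  have a₁ : dilogArg z τ + I * b⁻¹ / 2 - I * b⁻¹ / 2 = dilogArg z τ := by ring
  have a₂ : dilogArg z τ + I * b⁻¹ / 2 + I * b⁻¹ / 2 = dilogArg (z + 1) τ := by
    rw [dilogArg_eq, dilogArg_eq, add_div z, one_div]; ring
  have a₃ : exp (2 * Real.pi * b⁻¹ * (dilogArg z τ + I * b⁻¹ / 2)) = -e (z / τ) := by
    have : 2 * Real.pi * b⁻¹ * (dilogArg z τ + I * b⁻¹ / 2) =
        2 * Real.pi * I * (z / τ) + Real.pi * I := by
      rw [dilogArg_eq, ← hb, ← hbb]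
      field_simp
      ring
    rw [this, Complex.exp_add, exp_pi_mul_I, e, mul_neg, mul_one]
  rw [← hb, faddeevIntegral_inv, faddeevIntegral_inv, a₁, a₂, a₃] at key
  rw [stripFun, stripFun, exp_neg, exp_neg, ← hb, key, mul_inv, ← sub_eq_add_neg, ← mul_assoc,
    mul_inv_cancel₀, one_mul]
  intro h
  rw [← sub_eq_add_neg, h, zero_mul] at key
  exact Complex.exp_ne_zero _ key

/-! ### Extension by the functional equation -/

/-- The numerator relating the values at `z` and at `z + Nτ`. -/
def shiftNum (N : ℤ) (z τ : ℂ) : ℂ := ∏ k ∈ Finset.range (-N).toNat, (1 - e (z - k * τ))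

/-- The denominator relating the values at `z` and at `z + Nτ`. -/
def shiftDen (N : ℤ) (z τ : ℂ) : ℂ := ∏ k ∈ Finset.range N.toNat, (1 - e (z + (k + 1) * τ))

/-- The continuation of `stripFun` to the strip translated by `-Nτ`. -/
def stripExt (N : ℤ) (z τ : ℂ) : ℂ :=
  stripFun (z + N * τ) τ * shiftNum N z τ / shiftDen N z τ

theorem shiftNum_ne_zero {z τ : ℂ} (hz : z ∉ latticeTranslates {0} τ) (N : ℤ) :
    shiftNum N z τ ≠ 0 :=
  Finset.prod_ne_zero_iff.2 fun k _ => by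
    have := one_sub_e_ne_zero hz (-k)
    push_cast at this
    rwa [neg_mul, ← sub_eq_add_neg] at this

theorem shiftDen_ne_zero {z τ : ℂ} (hz : z ∉ latticeTranslates {0} τ) (N : ℤ) :
    shiftDen N z τ ≠ 0 :=
  Finset.prod_ne_zero_iff.2 fun k _ => by
    have := one_sub_e_ne_zero hz (k + 1)
    push_cast at this
    exact this

/-- At most one of the two products is nonempty: for N < 0 a factor leaves the numerator, for N ≥ 0
one enters the denominator, and the two cases obey one rule. -/
theorem shift_quotient_succ {N : ℤ} {z τ : ℂ} (h : 1 - e (z + (N + 1) * τ) ≠ 0) :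
    shiftNum N z τ / shiftDen N z τ =
      (1 - e (z + (N + 1) * τ)) * (shiftNum (N + 1) z τ / shiftDen (N + 1) z τ) := by
  rcases lt_or_ge N 0 with hN | hN
  · obtain ⟨m, rfl⟩ : ∃ m : ℕ, N = -(m + 1) := ⟨(-N - 1).toNat, by omega⟩
    have t₁ : (-(-((m : ℤ) + 1))).toNat = m + 1 := by omega
    have t₂ : (-(-((m : ℤ) + 1) + 1)).toNat = m := by omega
    have t₃ : (-((m : ℤ) + 1)).toNat = 0 := by omega
    have t₄ : (-((m : ℤ) + 1) + 1).toNat = 0 := by omega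
    rw [shiftNum, shiftNum, shiftDen, shiftDen, t₁, t₂, t₃, t₄, Finset.prod_range_succ]
    push_cast
    simp only [Finset.range_zero, Finset.prod_empty, div_one]
    rw [show z + (-((m : ℂ) + 1) + 1) * τ = z - m * τ by ring, mul_comm]
  · obtain ⟨m, rfl⟩ := Int.eq_ofNat_of_zero_le hN
    have t₁ : (-(m : ℤ)).toNat = 0 := by omega
    have t₂ : (-((m : ℤ) + 1)).toNat = 0 := by omega
    have t₃ : ((m : ℤ)).toNat = m := by omega
    have t₄ : ((m : ℤ) + 1).toNat = m + 1 := by omega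
    rw [shiftNum, shiftNum, shiftDen, shiftDen, t₁, t₂, t₃, t₄, Finset.prod_range_succ]
    push_cast at h ⊢
    simp only [Finset.range_zero, Finset.prod_empty]
    rw [one_div, one_div, mul_inv, mul_comm _ (1 - _)⁻¹, mul_inv_cancel_left₀ h]

theorem stripExt_succ {N : ℤ} {z τ : ℂ} (hτ : τ ∈ slitPlane) (h₁ : InStrip (z + N * τ) τ)
    (h₂ : InStrip (z + (N + 1 : ℤ) * τ) τ) : stripExt N z τ = stripExt (N + 1) z τ := by
  have hz : z + (N + 1 : ℤ) * τ = z + N * τ + τ := by push_cast; ring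
  have h := stripFun_add_tau hτ h₁ (by rwa [← hz])
  rw [← hz] at h
  -- No lattice hypothesis is needed: by the functional equation this factor divides an exponential.
  have hne : 1 - e (z + (N + 1) * τ) ≠ 0 := by
    intro h0
    push_cast at h
    rw [h0, zero_mul] at h
    exact Complex.exp_ne_zero _ h
  rw [stripExt, stripExt, mul_div_assoc, mul_div_assoc, shift_quotient_succ hne, h]
  push_cast
  ring

theorem stripExt_eq_of_le {N M : ℤ} {z τ : ℂ} (hτ : τ ∈ slitPlane) (hNM : N ≤ M)
    (h₁ : InStrip (z + N * τ) τ) (h₂ : InStrip (z + M * τ) τ) :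
    stripExt N z τ = stripExt M z τ := by
  induction M, hNM using Int.leInduction with
  | base => rfl
  | succ M hM ih =>
    -- The strip is convex, so every intermediate translate lies in it.
    have hmid : InStrip (z + M * τ) τ := by
      have hb := rootTau_re_pos hτ
      have hM' : (N : ℝ) ≤ M := by exact_mod_cast hM
      rw [InStrip, add_mul_div_rootTau_re hτ] at h₁ h₂ ⊢
      push_cast at h₂
      constructor
      · nlinarith [h₁.1]
      · nlinarith [h₂.2]
    exact (ih hmid).trans (stripExt_succ hτ hmid h₂)

/-- The index of a translate of the strip that contains `z`. -/
def stripIndex (z τ : ℂ) : ℤ := -⌈(z / rootTau τ).re / (rootTau τ).re⌉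

theorem stripIndex_spec {τ : ℂ} (hτ : τ ∈ slitPlane) (z : ℂ) :
    -(rootTau τ).re < ((z + stripIndex z τ * τ) / rootTau τ).re ∧
      ((z + stripIndex z τ * τ) / rootTau τ).re ≤ 0 := by
  have hb := rootTau_re_pos hτ
  rw [add_mul_div_rootTau_re hτ, stripIndex]
  have h1 := Int.le_ceil ((z / rootTau τ).re / (rootTau τ).re)
  have h2 := Int.ceil_lt_add_one ((z / rootTau τ).re / (rootTau τ).re)
  rw [div_le_iff₀ hb] at h1
  rw [← sub_lt_iff_lt_add, lt_div_iff₀ hb] at h2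
  push_cast
  constructor <;> linarith

theorem inStrip_stripIndex {τ : ℂ} (hτ : τ ∈ slitPlane) (z : ℂ) :
    InStrip (z + stripIndex z τ * τ) τ :=
  ⟨(stripIndex_spec hτ z).1,
    (stripIndex_spec hτ z).2.trans_lt (inv_re_pos (rootTau_re_pos hτ))⟩

/-- The meromorphic continuation of `stripFun`. -/
def dilogExt (z τ : ℂ) : ℂ := stripExt (stripIndex z τ) z τ

/-- The value is the same for every admissible N. Hence N can be held fixed near a given point,
although `stripIndex` jumps. -/
theorem dilogExt_eq {N : ℤ} {z τ : ℂ} (hτ : τ ∈ slitPlane) (h : InStrip (z + N * τ) τ) :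
    dilogExt z τ = stripExt N z τ := by
  rcases le_total N (stripIndex z τ) with hN | hN
  · exact (stripExt_eq_of_le hτ hN h (inStrip_stripIndex hτ z)).symm
  · exact stripExt_eq_of_le hτ hN (inStrip_stripIndex hτ z) h

theorem shift_quotient_add_tau (N : ℤ) {z τ : ℂ} (h : 1 - e (z + τ) ≠ 0) :
    shiftNum N (z + τ) τ / shiftDen N (z + τ) τ =
      (1 - e (z + τ)) * (shiftNum (N + 1) z τ / shiftDen (N + 1) z τ) := by
  rcases lt_or_ge N 0 with hN | hN
  · obtain ⟨m, rfl⟩ : ∃ m : ℕ, N = -(m + 1) := ⟨(-N - 1).toNat, by omega⟩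
    have t₁ : (-(-((m : ℤ) + 1))).toNat = m + 1 := by omega
    have t₂ : (-(-((m : ℤ) + 1) + 1)).toNat = m := by omega
    have t₃ : (-((m : ℤ) + 1)).toNat = 0 := by omega
    have t₄ : (-((m : ℤ) + 1) + 1).toNat = 0 := by omega
    rw [shiftNum, shiftNum, shiftDen, shiftDen, t₁, t₂, t₃, t₄, Finset.prod_range_succ']
    push_cast
    simp only [Finset.range_zero, Finset.prod_empty, div_one, zero_mul, sub_zero]
    rw [mul_comm]
    congr 1
    exact Finset.prod_congr rfl fun k _ => by ring_nf
  · obtain ⟨m, rfl⟩ := Int.eq_ofNat_of_zero_le hN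
    have t₁ : (-(m : ℤ)).toNat = 0 := by omega
    have t₂ : (-((m : ℤ) + 1)).toNat = 0 := by omega
    have t₃ : ((m : ℤ)).toNat = m := by omega
    have t₄ : ((m : ℤ) + 1).toNat = m + 1 := by omega
    rw [shiftNum, shiftNum, shiftDen, shiftDen, t₁, t₂, t₃, t₄, Finset.prod_range_succ']
    push_cast
    simp only [Finset.range_zero, Finset.prod_empty, zero_add, one_mul]
    rw [one_div, one_div, mul_inv, mul_comm _ (1 - _)⁻¹, mul_inv_cancel_left₀ h]
    congr 1
    exact Finset.prod_congr rfl fun k _ => by ring_nf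

/-- The index N at z+τ and the index N+1 at z lead to the same point of the strip, so only the
finite products differ. -/
theorem dilogExt_add_tau {z τ : ℂ} (hτ : τ ∈ slitPlane) (hz : z ∉ latticeTranslates {0} τ) :
    dilogExt (z + τ) τ = (1 - e (z + τ)) * dilogExt z τ := by
  have h := inStrip_stripIndex hτ (z + τ)
  set N := stripIndex (z + τ) τ
  have hzN : z + τ + N * τ = z + (N + 1 : ℤ) * τ := by push_cast; ring
  have hne : 1 - e (z + τ) ≠ 0 := by simpa using one_sub_e_ne_zero hz 1
  rw [dilogExt_eq hτ h, dilogExt_eq hτ (N := N + 1) (by rwa [← hzN]), stripExt, stripExt,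
    mul_div_assoc, mul_div_assoc, shift_quotient_add_tau N hne, hzN]
  ring

theorem shiftNum_add_one (N : ℤ) (z τ : ℂ) : shiftNum N (z + 1) τ = shiftNum N z τ :=
  Finset.prod_congr rfl fun k _ => by
    rw [show z + 1 - k * τ = z - k * τ + 1 by ring, e_add_one]

theorem shiftDen_add_one (N : ℤ) (z τ : ℂ) : shiftDen N (z + 1) τ = shiftDen N z τ :=
  Finset.prod_congr rfl fun k _ => by
    rw [show z + 1 + (k + 1) * τ = z + (k + 1) * τ + 1 by ring, e_add_one]

theorem dilogExt_add_one_of_inStrip {N : ℤ} {z τ : ℂ} (hτ : τ ∈ slitPlane)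
    (h₁ : InStrip (z + N * τ) τ) (h₂ : InStrip (z + N * τ + 1) τ) :
    dilogExt (z + 1) τ = (1 - e (z / τ)) * dilogExt z τ := by
  have h0 := slitPlane_ne_zero hτ
  have hz : z + 1 + N * τ = z + N * τ + 1 := by ring
  have hq : (z + N * τ) / τ = z / τ + N := by field_simp
  rw [dilogExt_eq hτ h₁, dilogExt_eq hτ (N := N) (by rwa [hz]), stripExt, stripExt,
    shiftNum_add_one, shiftDen_add_one, hz, stripFun_add_one hτ h₁ h₂, hq, e_add_intCast]
  ring

/-! ### Quotients of analytic functions without zeros and poles off the lattice -/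

/-- Near `p`, `F` is a quotient of analytic functions without zeros off the lattice. -/
def IsLatticeQuotientAt (F : ℂ × ℂ → ℂ) (p : ℂ × ℂ) : Prop :=
  ∃ g h : ℂ × ℂ → ℂ, AnalyticAt ℂ g p ∧ AnalyticAt ℂ h p ∧
    ∀ᶠ x in 𝓝 p, (x.1 ∉ latticeTranslates {0} x.2 → g x ≠ 0 ∧ h x ≠ 0) ∧ F x = g x / h x

theorem countable_lattice (τ : ℂ) : (latticeTranslates {0} τ).Countable := by
  have : latticeTranslates {0} τ = range fun k : ℤ × ℤ => (k.1 + k.2 * τ : ℂ) := by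
    ext z
    rw [mem_lattice_iff]
    simp [eq_comm]
  rw [this]
  exact countable_range _

/-- For fixed τ the lattice is countable, so its complement is dense. This shows that the
denominators of lattice quotients do not vanish identically near a point. -/
theorem frequently_notMem_lattice (p : ℂ × ℂ) :
    ∃ᶠ x : ℂ × ℂ in 𝓝 p, x.1 ∉ latticeTranslates {0} x.2 := by
  have h1 : ∃ᶠ z in 𝓝 p.1, z ∈ (latticeTranslates {0} p.2)ᶜ :=
    mem_closure_iff_frequently.1 (((countable_lattice p.2).dense_compl ℝ) p.1)
  have ht : Tendsto (fun z : ℂ => (z, p.2)) (𝓝 p.1) (𝓝 p) :=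
    (Continuous.prodMk_left p.2).tendsto p.1
  exact ht.frequently h1

theorem IsLatticeQuotientAt.meromorphic {F : ℂ × ℂ → ℂ} {p : ℂ × ℂ}
    (hF : IsLatticeQuotientAt F p) : Meromorphic₂At F p := by
  obtain ⟨g, h, hg, hh, H⟩ := hF
  refine ⟨g, h, hg, hh, ?_, H.mono fun x hx _ => hx.2⟩
  exact ((frequently_notMem_lattice p).and_eventually H).mono fun x hx => (hx.2.1 hx.1).2

theorem IsLatticeQuotientAt.analyticAt {F : ℂ × ℂ → ℂ} {p : ℂ × ℂ}
    (hF : IsLatticeQuotientAt F p) (hp : p.1 ∉ latticeTranslates {0} p.2) : AnalyticAt ℂ F p := by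
  obtain ⟨g, h, hg, hh, H⟩ := hF
  exact (hg.div hh (H.self_of_nhds.1 hp).2).congr (H.mono fun x hx => hx.2.symm)

theorem IsLatticeQuotientAt.mul {F G : ℂ × ℂ → ℂ} {p : ℂ × ℂ} (hF : IsLatticeQuotientAt F p)
    (hG : IsLatticeQuotientAt G p) : IsLatticeQuotientAt (fun x => F x * G x) p := by
  obtain ⟨g, h, hg, hh, H⟩ := hF
  obtain ⟨g', h', hg', hh', H'⟩ := hG
  refine ⟨fun x => g x * g' x, fun x => h x * h' x, hg.mul hg', hh.mul hh', ?_⟩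
  filter_upwards [H, H'] with x hx hx'
  refine ⟨fun hn => ⟨mul_ne_zero (hx.1 hn).1 (hx'.1 hn).1, mul_ne_zero (hx.1 hn).2 (hx'.1 hn).2⟩,
    ?_⟩
  rw [hx.2, hx'.2, div_mul_div_comm]

/-- The equality F = g/h is required at every nearby point, division by zero giving 0, so exchanging
g and h is exact even at zeros and poles. -/
theorem IsLatticeQuotientAt.inv {F : ℂ × ℂ → ℂ} {p : ℂ × ℂ} (hF : IsLatticeQuotientAt F p) :
    IsLatticeQuotientAt (fun x => (F x)⁻¹) p := by
  obtain ⟨g, h, hg, hh, H⟩ := hF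
  refine ⟨h, g, hh, hg, H.mono fun x hx => ⟨fun hn => (hx.1 hn).symm, ?_⟩⟩
  simp only [hx.2, inv_div]

theorem isLatticeQuotientAt_one (p : ℂ × ℂ) : IsLatticeQuotientAt (fun _ => 1) p :=
  ⟨fun _ => 1, fun _ => 1, analyticAt_const, analyticAt_const, by simp⟩

theorem isLatticeQuotientAt_prod {ι : Type*} (s : Finset ι) {F : ι → ℂ × ℂ → ℂ} {p : ℂ × ℂ}
    (hF : ∀ i ∈ s, IsLatticeQuotientAt (F i) p) :
    IsLatticeQuotientAt (fun x => ∏ i ∈ s, F i x) p := by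
  classical
  induction s using Finset.induction_on with
  | empty => simpa using isLatticeQuotientAt_one p
  | insert i s hi ih =>
    simp only [Finset.prod_insert hi]
    exact (hF i (Finset.mem_insert_self _ _)).mul
      (ih fun j hj => hF j (Finset.mem_insert_of_mem hj))

theorem IsLatticeQuotientAt.comp {F : ℂ × ℂ → ℂ} {φ : ℂ × ℂ → ℂ × ℂ} {p : ℂ × ℂ}
    (hF : IsLatticeQuotientAt F (φ p)) (hφ : AnalyticAt ℂ φ p)
    (hL : ∀ᶠ x in 𝓝 p, x.1 ∉ latticeTranslates {0} x.2 →
      (φ x).1 ∉ latticeTranslates {0} (φ x).2) :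
    IsLatticeQuotientAt (fun x => F (φ x)) p := by
  obtain ⟨g, h, hg, hh, H⟩ := hF
  refine ⟨fun x => g (φ x), fun x => h (φ x), hg.fun_comp hφ, hh.fun_comp hφ, ?_⟩
  filter_upwards [hφ.continuousAt.eventually H, hL] with x hx hl
  exact ⟨fun hn => hx.1 (hl hn), hx.2⟩

/-! ### Analyticity of the continuation -/

theorem analyticAt_rootTau {τ : ℂ} (hτ : τ ∈ slitPlane) : AnalyticAt ℂ rootTau τ :=
  analyticAt_id.cpow analyticAt_const hτ

theorem analyticAt_e (x : ℂ) : AnalyticAt ℂ e x := by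
  unfold e
  fun_prop

theorem analyticAt_stripFun {p : ℂ × ℂ} (hτ : p.2 ∈ slitPlane) (h : InStrip p.1 p.2) :
    AnalyticAt ℂ (fun x : ℂ × ℂ => stripFun x.1 x.2) p := by
  have hb : AnalyticAt ℂ (fun x : ℂ × ℂ => rootTau x.2) p :=
    (analyticAt_rootTau hτ).fun_comp analyticAt_snd
  have hb0 := rootTau_ne_zero hτ
  have ha : AnalyticAt ℂ (fun x : ℂ × ℂ => dilogArg x.1 x.2) p := by
    unfold dilogArg
    refine ((AnalyticAt.div (analyticAt_const.mul analyticAt_fst) hb hb0).add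
      ((analyticAt_const.mul hb).div analyticAt_const two_ne_zero)).add
      (analyticAt_const.div (analyticAt_const.mul hb) ?_)
    simp [hb0]
  have hG := analyticAt_faddeevIntegral (rootTau_re_pos hτ) (inStrip_iff.1 h)
  exact (AnalyticAt.fun_comp (g := fun p : ℂ × ℂ => faddeevIntegral p.1 p.2)
    (f := fun x : ℂ × ℂ => (rootTau x.2, dilogArg x.1 x.2)) hG (hb.prod ha)).neg.cexp

theorem eventually_inStrip {p : ℂ × ℂ} (hτ : p.2 ∈ slitPlane) {N : ℤ}
    (h : InStrip (p.1 + N * p.2) p.2) : ∀ᶠ x : ℂ × ℂ in 𝓝 p, InStrip (x.1 + N * x.2) x.2 := by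
  have hb : ContinuousAt (fun x : ℂ × ℂ => rootTau x.2) p :=
    ((analyticAt_rootTau hτ).fun_comp analyticAt_snd).continuousAt
  have hb0 := rootTau_ne_zero hτ
  have h1 : ContinuousAt (fun x : ℂ × ℂ => ((x.1 + N * x.2) / rootTau x.2).re) p :=
    continuous_re.continuousAt.comp (ContinuousAt.div (by fun_prop) hb hb0)
  exact (ContinuousAt.eventually_lt (continuous_re.continuousAt.comp hb).neg h1 h.1).and
    (ContinuousAt.eventually_lt h1 (continuous_re.continuousAt.comp (hb.inv₀ hb0)) h.2)

theorem eventually_slitPlane {p : ℂ × ℂ} (hτ : p.2 ∈ slitPlane) :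
    ∀ᶠ x : ℂ × ℂ in 𝓝 p, x.2 ∈ slitPlane :=
  (continuous_snd.tendsto p).eventually (isOpen_slitPlane.mem_nhds hτ)

theorem analyticAt_shiftNum (N : ℤ) (p : ℂ × ℂ) :
    AnalyticAt ℂ (fun x : ℂ × ℂ => shiftNum N x.1 x.2) p :=
  Finset.analyticAt_fun_prod _ fun k _ => analyticAt_const.sub
    ((analyticAt_e _).fun_comp (f := fun x : ℂ × ℂ => x.1 - k * x.2)
      (analyticAt_fst.sub (analyticAt_const.mul analyticAt_snd)))

theorem analyticAt_shiftDen (N : ℤ) (p : ℂ × ℂ) :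
    AnalyticAt ℂ (fun x : ℂ × ℂ => shiftDen N x.1 x.2) p :=
  Finset.analyticAt_fun_prod _ fun k _ => analyticAt_const.sub
    ((analyticAt_e _).fun_comp (f := fun x : ℂ × ℂ => x.1 + (k + 1) * x.2)
      (analyticAt_fst.add (analyticAt_const.mul analyticAt_snd)))

theorem analyticAt_stripFun_shift {p : ℂ × ℂ} (hτ : p.2 ∈ slitPlane) {N : ℤ}
    (h : InStrip (p.1 + N * p.2) p.2) :
    AnalyticAt ℂ (fun x : ℂ × ℂ => stripFun (x.1 + N * x.2) x.2) p :=
  AnalyticAt.fun_comp (g := fun x : ℂ × ℂ => stripFun x.1 x.2)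
    (f := fun x : ℂ × ℂ => (x.1 + N * x.2, x.2)) (analyticAt_stripFun hτ h)
    ((analyticAt_fst.add (analyticAt_const.mul analyticAt_snd)).prod analyticAt_snd)

/-- With N held fixed, the exponential never vanishes and the finite products vanish only on the
lattice. -/
theorem isLatticeQuotientAt_dilogExt {p : ℂ × ℂ} (hτ : p.2 ∈ slitPlane) :
    IsLatticeQuotientAt (fun x => dilogExt x.1 x.2) p := by
  have h := inStrip_stripIndex hτ p.1
  set N := stripIndex p.1 p.2
  refine ⟨fun x => stripFun (x.1 + N * x.2) x.2 * shiftNum N x.1 x.2,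
    fun x => shiftDen N x.1 x.2, (analyticAt_stripFun_shift hτ h).mul (analyticAt_shiftNum N p),
    analyticAt_shiftDen N p, ?_⟩
  filter_upwards [eventually_inStrip hτ h, eventually_slitPlane hτ] with x hx hx'
  exact ⟨fun hn => ⟨mul_ne_zero (Complex.exp_ne_zero _) (shiftNum_ne_zero hn N),
    shiftDen_ne_zero hn N⟩, dilogExt_eq hx' hx⟩

theorem continuousAt_dilogExt {z τ : ℂ} (hτ : τ ∈ slitPlane)
    (hz : z ∉ latticeTranslates {0} τ) : ContinuousAt (fun z => dilogExt z τ) z := by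
  have h := ((isLatticeQuotientAt_dilogExt (p := (z, τ)) hτ).analyticAt hz).continuousAt
  exact ContinuousAt.comp (f := fun z : ℂ => (z, τ)) (g := fun x : ℂ × ℂ => dilogExt x.1 x.2) h
    (by fun_prop)

/-- The normalized translate of z has real coordinate in (-Re b, 0]. Adding 1 may land on the
excluded edge Re b⁻¹ of the strip, so the rule is proved at z - δb for small δ > 0 and passed to the
limit by continuity. -/
theorem dilogExt_add_one {z τ : ℂ} (hτ : τ ∈ slitPlane) (hz : z ∉ latticeTranslates {0} τ) :
    dilogExt (z + 1) τ = (1 - e (z / τ)) * dilogExt z τ := by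
  set b := rootTau τ with hb
  have hb0 : 0 < b.re := rootTau_re_pos hτ
  have hbi : 0 < b⁻¹.re := inv_re_pos hb0
  have hbn : b ≠ 0 := rootTau_ne_zero hτ
  obtain ⟨hN₁, hN₂⟩ := stripIndex_spec hτ z
  set N := stripIndex z τ
  rw [← hb] at hN₁ hN₂
  have hev : ∀ᶠ δ : ℝ in 𝓝[>] 0,
      dilogExt (z - δ * b + 1) τ = (1 - e ((z - δ * b) / τ)) * dilogExt (z - δ * b) τ := by
    have h1 : ∀ᶠ δ : ℝ in 𝓝[>] 0, δ < ((z + N * τ) / b).re + b.re :=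
      mem_nhdsWithin_of_mem_nhds (Iio_mem_nhds (by linarith))
    filter_upwards [h1, self_mem_nhdsWithin] with δ hδ hδ0
    have hδ0' : 0 < δ := hδ0
    have e₁ : ((z - δ * b + N * τ) / b).re = ((z + N * τ) / b).re - δ := by
      rw [show (z - δ * b + N * τ) / b = (z + N * τ) / b - δ by field_simp; ring, sub_re, ofReal_re]
    have e₂ := add_one_div_rootTau_re (z := z - δ * b + N * τ) (τ := τ)
    rw [← hb, e₁] at e₂
    refine dilogExt_add_one_of_inStrip (N := N) hτ ?_ ?_
    · rw [InStrip, ← hb, e₁]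
      constructor <;> linarith
    · rw [InStrip, ← hb, e₂]
      constructor <;> linarith
  have hlin : Tendsto (fun δ : ℝ => z - δ * b) (𝓝[>] 0) (𝓝 z) := by
    have : Continuous fun δ : ℝ => z - δ * b := by fun_prop
    have := (this.tendsto 0).mono_left (nhdsWithin_le_nhds (s := Ioi (0 : ℝ)))
    simpa using this
  have hz1 : z + 1 ∉ latticeTranslates {0} τ := by
    have := add_mem_lattice_iff (z := z) (τ := τ) 1 0
    simp only [Int.cast_one, Int.cast_zero, zero_mul, add_zero] at this
    rwa [this]
  have t₁ : Tendsto (fun δ : ℝ => dilogExt (z - δ * b + 1) τ) (𝓝[>] 0)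
      (𝓝 (dilogExt (z + 1) τ)) :=
    (continuousAt_dilogExt hτ hz1).tendsto.comp (hlin.add_const 1)
  have t₂ : Tendsto (fun δ : ℝ => (1 - e ((z - δ * b) / τ)) * dilogExt (z - δ * b) τ) (𝓝[>] 0)
      (𝓝 ((1 - e (z / τ)) * dilogExt z τ)) :=
    ((tendsto_const_nhds.sub ((analyticAt_e _).continuousAt.tendsto.comp
      (hlin.div_const τ)))).mul ((continuousAt_dilogExt hτ hz).tendsto.comp hlin)
  exact tendsto_nhds_unique (t₁.congr' hev) t₂

/-! ### Identification with the quantum dilogarithm -/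

/-- Identity theorem: near any point two meromorphic functions either agree or differ throughout a
punctured neighbourhood, so the set where the germs agree is clopen. Normal form carries the
agreement over to the centre. -/
theorem MeromorphicNFOn.eq_of_eventuallyEq {f g : ℂ → ℂ} (hf : MeromorphicNFOn f univ)
    (hg : MeromorphicNFOn g univ) {x₀ : ℂ} (h : f =ᶠ[𝓝 x₀] g) : f = g := by
  set A : Set ℂ := {x | f =ᶠ[𝓝 x] g} with hA
  have hopen : IsOpen A := isOpen_setOfPred_eventually_nhds
  have hclosed : IsClosed A := by
    rw [← isOpen_compl_iff, isOpen_iff_mem_nhds]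
    intro x hx
    have hne : ¬ f =ᶠ[𝓝[≠] x] g := fun h =>
      hx (((hf (mem_univ x)).eventuallyEq_nhdsNE_iff_eventuallyEq_nhds (hg (mem_univ x))).1 h)
    have hev : ∀ᶠ y in 𝓝[≠] x, f y ≠ g y := by
      by_contra hcon
      exact hne (((hf (mem_univ x)).meromorphicAt.frequently_eq_iff_eventuallyEq
        (hg (mem_univ x)).meromorphicAt).1 hcon)
    have hev' : ∀ᶠ y in 𝓝[≠] x, y ∈ Aᶜ := hev.mono fun y hy hyA => hy (EventuallyEq.eq_of_nhds hyA)
    rw [eventually_nhdsWithin_iff] at hev'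
    filter_upwards [hev'] with y hy
    by_cases hyx : y = x
    · rwa [hyx]
    · exact hy hyx
  have huniv : A = univ := IsClopen.eq_univ ⟨hclosed, hopen⟩ ⟨x₀, h⟩
  funext x
  have : x ∈ A := huniv ▸ mem_univ x
  exact EventuallyEq.eq_of_nhds this

/-- Needed because `faddeevDilog` is defined by choice. -/
theorem IsFaddeevDilog.unique {b : ℂ} (hb : 0 < b.re) {Φ Ψ : ℂ → ℂ} (hΦ : IsFaddeevDilog b Φ)
    (hΨ : IsFaddeevDilog b Ψ) : Φ = Ψ := by
  refine MeromorphicNFOn.eq_of_eventuallyEq hΦ.1 hΨ.1 (x₀ := 0) ?_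
  have hb' := inv_re_pos hb
  have : ∀ᶠ x : ℂ in 𝓝 0, |x.im| < (b + b⁻¹).re / 2 :=
    ContinuousAt.eventually_lt (by fun_prop) continuousAt_const (by
      simp only [zero_im, abs_zero, add_re]; linarith)
  filter_upwards [this] with x hx
  rw [hΦ.2 x hx, hΨ.2 x hx]

theorem isFaddeevDilog_dilogExt {τ : ℂ} (hτ : τ ∈ slitPlane) :
    IsFaddeevDilog (rootTau τ) fun x =>
      (dilogExt (rootTau τ * (-I * x - rootTau τ / 2 + (rootTau τ)⁻¹ / 2)) τ)⁻¹ := by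
  set b := rootTau τ with hb
  have hbn : b ≠ 0 := rootTau_ne_zero hτ
  set Z : ℂ → ℂ := fun x => b * (-I * x - b / 2 + b⁻¹ / 2) with hZ
  have hZa : ∀ x, AnalyticAt ℂ (fun x => (Z x, τ)) x := fun x => by
    simp only [hZ]; fun_prop
  have hZx : ∀ x, dilogArg (Z x) τ = x := fun x => by
    rw [dilogArg_eq, ← hb, hZ]
    field_simp
    linear_combination (-2 * b * x) * I_sq
  constructor
  · intro x _
    have h := inStrip_stripIndex hτ (Z x)
    set N := stripIndex (Z x) τ
    have hev : (fun x => dilogExt (Z x) τ) =ᶠ[𝓝 x] fun x => stripExt N (Z x) τ := by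
      have := (hZa x).continuousAt.tendsto.eventually (eventually_inStrip (p := (Z x, τ)) hτ h)
      filter_upwards [this] with y hy using dilogExt_eq hτ hy
    have aE : AnalyticAt ℂ (fun x => stripFun (Z x + N * τ) τ) x :=
      AnalyticAt.fun_comp (f := fun x => (Z x, τ))
        (analyticAt_stripFun_shift (p := (Z x, τ)) hτ h) (hZa x)
    have aN : AnalyticAt ℂ (fun x => shiftNum N (Z x) τ) x :=
      AnalyticAt.fun_comp (f := fun x => (Z x, τ)) (analyticAt_shiftNum N (Z x, τ)) (hZa x)
    have aD : AnalyticAt ℂ (fun x => shiftDen N (Z x) τ) x :=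
      AnalyticAt.fun_comp (f := fun x => (Z x, τ)) (analyticAt_shiftDen N (Z x, τ)) (hZa x)
    -- Zeros and poles never meet: for N ≤ 0 the denominator is empty and D is analytic at the
    -- point, for N ≥ 0 the numerator is empty and D⁻¹ is analytic there. Either way D⁻¹ is in
    -- normal form.
    rcases le_total N 0 with hN | hN
    · refine MeromorphicNFAt.inv (f := fun x => dilogExt (Z x) τ) ?_
      refine (meromorphicNFAt_congr hev).2 (AnalyticAt.meromorphicNFAt ?_)
      have : shiftDen N = fun _ _ => 1 := by
        funext z τ
        simp [shiftDen, Int.toNat_of_nonpos hN]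
      exact (aE.mul aN).congr (Eventually.of_forall fun y => by simp [stripExt, this])
    · have hnum : shiftNum N = fun _ _ => 1 := by
        funext z τ
        simp [shiftNum, Int.toNat_of_nonpos (neg_nonpos.2 hN)]
      have hev' : (fun x => (dilogExt (Z x) τ)⁻¹) =ᶠ[𝓝 x]
          fun x => (stripFun (Z x + N * τ) τ)⁻¹ * shiftDen N (Z x) τ := by
        filter_upwards [hev] with y hy
        rw [hy, stripExt, hnum, mul_one, inv_div, div_eq_mul_inv, mul_comm]
      exact (meromorphicNFAt_congr hev').2
        ((aE.inv (Complex.exp_ne_zero _)).mul aD).meromorphicNFAt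
  · intro x hx
    have hin : InStrip (Z x + (0 : ℤ) * τ) τ := by
      rw [Int.cast_zero, zero_mul, add_zero, inStrip_iff, hZx, ← hb]
      rw [add_re] at hx
      linarith
    change (dilogExt (Z x) τ)⁻¹ = _
    rw [dilogExt_eq hτ hin]
    simp only [stripExt, shiftNum, shiftDen, Int.cast_zero, zero_mul, add_zero, neg_zero,
      Int.toNat_zero, Finset.range_zero, Finset.prod_empty, mul_one, div_one, stripFun, hZx]
    rw [exp_neg, inv_inv]

theorem invDilog_eq {z τ : ℂ} (hτ : τ ∈ slitPlane) : invDilog (z, τ) = dilogExt z τ := by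
  have hex : ∃ Φ, IsFaddeevDilog (rootTau τ) Φ := ⟨_, isFaddeevDilog_dilogExt hτ⟩
  have h : faddeevDilog (rootTau τ) = fun x =>
      (dilogExt (rootTau τ * (-I * x - rootTau τ / 2 + (rootTau τ)⁻¹ / 2)) τ)⁻¹ := by
    rw [faddeevDilog, dif_pos hex]
    exact IsFaddeevDilog.unique (rootTau_re_pos hτ) hex.choose_spec (isFaddeevDilog_dilogExt hτ)
  have hbn := rootTau_ne_zero hτ
  change (faddeevDilog (rootTau τ) (dilogArg z τ))⁻¹ = _
  rw [h, inv_inv, dilogArg_eq]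
  congr 1
  generalize rootTau τ = b at *
  field_simp
  linear_combination (-2 * z - b ^ 2 + 1) * I_sq

/-! ### Infinite products -/

/-- `∏_{k ≥ 0} (1 - q^k x)`. -/
def qProd (x q : ℂ) : ℂ := ∏' k : ℕ, (1 - q ^ k * x)

theorem summable_qProd {q : ℂ} (hq : ‖q‖ < 1) (x : ℂ) : Summable fun k : ℕ => ‖-(q ^ k * x)‖ := by
  simp only [norm_neg, norm_mul, norm_pow]
  exact (summable_geometric_of_lt_one (norm_nonneg _) hq).mul_right _

theorem multipliable_qProd {q : ℂ} (hq : ‖q‖ < 1) (x : ℂ) :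
    Multipliable fun k : ℕ => 1 - q ^ k * x := by
  simpa only [sub_eq_add_neg] using multipliable_one_add_of_summable (summable_qProd hq x)

theorem tendsto_qProd {q : ℂ} (hq : ‖q‖ < 1) (x : ℂ) :
    Tendsto (fun n : ℕ => ∏ k ∈ Finset.range n, (1 - q ^ k * x)) atTop (𝓝 (qProd x q)) :=
  (multipliable_qProd hq x).hasProd.tendsto_prod_nat

theorem qProd_ne_zero {q : ℂ} (hq : ‖q‖ < 1) {x : ℂ} (hx : ∀ k : ℕ, 1 - q ^ k * x ≠ 0) :
    qProd x q ≠ 0 := by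
  have := tprod_one_add_ne_zero_of_summable (f := fun k : ℕ => -(q ^ k * x))
    (fun k => by simpa only [← sub_eq_add_neg] using hx k) (summable_qProd hq x)
  rw [qProd]
  simpa only [← sub_eq_add_neg] using this

theorem qProd_eq_mul {q : ℂ} (hq : ‖q‖ < 1) (x : ℂ) : qProd x q = (1 - x) * qProd (q * x) q := by
  have h1 := (tendsto_qProd hq (q * x)).const_mul (1 - x)
  have h2 := (tendsto_add_atTop_iff_nat 1).2 (tendsto_qProd hq x)
  refine tendsto_nhds_unique h2 (h1.congr fun n => ?_)
  rw [Finset.prod_range_succ', pow_zero, one_mul, mul_comm]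
  congr 1
  exact Finset.prod_congr rfl fun k _ => by ring

theorem norm_qProd_sub_one_le {q : ℂ} (hq : ‖q‖ < 1) (x : ℂ) :
    ‖qProd x q - 1‖ ≤ Real.exp ((1 - ‖q‖)⁻¹ * ‖x‖) - 1 := by
  refine le_of_tendsto ((tendsto_qProd hq x).sub_const 1).norm (Eventually.of_forall fun n => ?_)
  have h := Finset.norm_prod_one_add_sub_one_le (Finset.range n) fun k : ℕ => -(q ^ k * x)
  simp only [← sub_eq_add_neg] at h
  refine h.trans (sub_le_sub_right (Real.exp_le_exp.2 ?_) 1)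
  simp only [norm_neg, norm_mul, norm_pow]
  rw [← Finset.sum_mul]
  refine mul_le_mul_of_nonneg_right ?_ (norm_nonneg _)
  rw [← tsum_geometric_of_lt_one (norm_nonneg q) hq]
  exact (summable_geometric_of_lt_one (norm_nonneg q) hq).sum_le_tsum _
    fun k _ => pow_nonneg (norm_nonneg _) k

theorem tendsto_qProd_one {α : Type*} {l : Filter α} {q : ℂ} (hq : ‖q‖ < 1) {f : α → ℂ}
    (hf : Tendsto f l (𝓝 0)) : Tendsto (fun a => qProd (f a) q) l (𝓝 1) := by
  rw [tendsto_iff_norm_sub_tendsto_zero]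
  refine squeeze_zero (fun _ => norm_nonneg _) (fun a => norm_qProd_sub_one_le hq (f a)) ?_
  have h1 : Tendsto (fun a => (1 - ‖q‖)⁻¹ * ‖f a‖) l (𝓝 0) := by
    simpa using (hf.norm).const_mul (1 - ‖q‖)⁻¹
  have h2 := ((Real.continuous_exp.tendsto 0).comp h1).sub_const 1
  simpa using h2

theorem prod_range_mul_eq {M : Type*} [CommMonoid M] (f : ℕ → M) (c n : ℕ) :
    ∏ i ∈ Finset.range (c * n), f i =
      ∏ j ∈ Finset.range c, ∏ k ∈ Finset.range n, f (c * k + j) := by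
  induction n with
  | zero => simp
  | succ n ih =>
    rw [Nat.mul_succ, Finset.prod_range_add, ih, ← Finset.prod_mul_distrib]
    exact Finset.prod_congr rfl fun j _ => by rw [Finset.prod_range_succ]

/-- Sorting the factors by the residue j of the exponent modulo c; each class is a product with base
q^c. -/
theorem qProd_eq_prod {q : ℂ} (hq : ‖q‖ < 1) (x : ℂ) {c : ℕ} (hc : 0 < c) :
    qProd x q = ∏ j ∈ Finset.range c, qProd (q ^ j * x) (q ^ c) := by
  have hqc : ‖q ^ c‖ < 1 := by
    rw [norm_pow]; exact pow_lt_one₀ (norm_nonneg _) hq hc.ne'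
  have h1 := (tendsto_qProd hq x).comp
    (tendsto_id.const_mul_atTop' hc : Tendsto (fun n : ℕ => c * n) atTop atTop)
  have h2 := tendsto_finsetProd (Finset.range c) fun j _ => tendsto_qProd hqc (q ^ j * x)
  refine tendsto_nhds_unique h1 (h2.congr fun n => ?_)
  simp only [Function.comp]
  rw [prod_range_mul_eq]
  refine Finset.prod_congr rfl fun j _ => Finset.prod_congr rfl fun k _ => ?_
  rw [pow_add, pow_mul]
  ring

/-! ### The Jacobi triple product -/

/-- The `q`-binomial coefficient. -/
def qBinom (q : ℂ) : ℕ → ℕ → ℂ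
  | _, 0 => 1
  | 0, _ + 1 => 0
  | n + 1, m + 1 => qBinom q n m + q ^ (m + 1) * qBinom q n (m + 1)

theorem qBinom_zero_right (q : ℂ) (n : ℕ) : qBinom q n 0 = 1 := by cases n <;> rfl

theorem qBinom_succ_succ (q : ℂ) (n m : ℕ) :
    qBinom q (n + 1) (m + 1) = qBinom q n m + q ^ (m + 1) * qBinom q n (m + 1) := rfl

theorem qBinom_eq_zero (q : ℂ) {n m : ℕ} (h : n < m) : qBinom q n m = 0 := by
  induction n generalizing m with
  | zero =>
    obtain ⟨m, rfl⟩ := Nat.exists_eq_succ_of_ne_zero (by omega : m ≠ 0)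
    rfl
  | succ n ih =>
    obtain ⟨m, rfl⟩ := Nat.exists_eq_succ_of_ne_zero (by omega : m ≠ 0)
    rw [Nat.succ_eq_add_one, qBinom_succ_succ, ih (by omega), ih (by omega)]; ring

/-- The Gauss binomial formula. -/
theorem prod_one_add_mul_pow (q x : ℂ) (n : ℕ) :
    ∏ j ∈ Finset.range n, (1 + x * q ^ j) =
      ∑ m ∈ Finset.range (n + 1), q ^ (m.choose 2) * x ^ m * qBinom q n m := by
  induction n generalizing x with
  | zero => simp [qBinom]
  | succ n ih =>
    -- Removing the factor j = 0 leaves the product for xq, which is why the induction generalizes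
    -- x.
    rw [Finset.prod_range_succ', pow_zero, mul_one]
    have h1 : ∏ k ∈ Finset.range n, (1 + x * q ^ (k + 1)) =
        ∏ k ∈ Finset.range n, (1 + x * q * q ^ k) :=
      Finset.prod_congr rfl fun k _ => by ring
    rw [h1, ih, Finset.sum_range_succ' _ (n + 1)]
    have h2 : ∀ m : ℕ, q ^ ((m + 1).choose 2) * x ^ (m + 1) * qBinom q (n + 1) (m + 1) =
        x * (q ^ (m.choose 2) * (x * q) ^ m * qBinom q n m) +
        q ^ ((m + 1).choose 2) * (x * q) ^ (m + 1) * qBinom q n (m + 1) := fun m => by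
      rw [qBinom_succ_succ, Nat.choose_succ_succ' m 1, Nat.choose_one_right, pow_add]
      ring
    rw [Finset.sum_congr rfl fun m _ => h2 m, Finset.sum_add_distrib, ← Finset.mul_sum]
    have h3 : (∑ m ∈ Finset.range (n + 1),
        q ^ ((m + 1).choose 2) * (x * q) ^ (m + 1) * qBinom q n (m + 1)) + 1 =
        ∑ m ∈ Finset.range (n + 1), q ^ (m.choose 2) * (x * q) ^ m * qBinom q n m := by
      rw [Finset.sum_range_succ, qBinom_eq_zero q (Nat.lt_succ_self n), mul_zero, add_zero,
        Finset.sum_range_succ' _ n]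
      simp [qBinom_zero_right]
    simp only [Nat.choose_zero_succ, pow_zero, qBinom_zero_right, mul_one]
    rw [add_assoc, h3]
    ring

/-- `(q;q)_n`. -/
def qFact (q : ℂ) (n : ℕ) : ℂ := ∏ k ∈ Finset.range n, (1 - q ^ k * q)

theorem qFact_succ (q : ℂ) (n : ℕ) : qFact q (n + 1) = qFact q n * (1 - q ^ (n + 1)) := by
  rw [qFact, qFact, Finset.prod_range_succ, pow_succ]

theorem one_sub_pow_mul_ne_zero {q : ℂ} (hq : ‖q‖ < 1) (k : ℕ) : 1 - q ^ k * q ≠ 0 := by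
  intro h
  have h1 : ‖q ^ k * q‖ < 1 := by
    rw [← pow_succ, norm_pow]; exact pow_lt_one₀ (norm_nonneg _) hq k.succ_ne_zero
  rw [← sub_eq_zero.1 h, norm_one] at h1
  exact lt_irrefl _ h1

theorem qFact_ne_zero {q : ℂ} (hq : ‖q‖ < 1) (n : ℕ) : qFact q n ≠ 0 :=
  Finset.prod_ne_zero_iff.2 fun k _ => one_sub_pow_mul_ne_zero hq k

/-- Division-free form of the quotient formula for the q-binomial, proved by double induction along
the Pascal rule; it gives the limit of the coefficients in the triple product. -/
theorem qBinom_mul_qFact (q : ℂ) (n m : ℕ) :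
    qBinom q (n + m) m * (qFact q m * qFact q n) = qFact q (n + m) := by
  induction n generalizing m with
  | zero =>
    induction m with
    | zero => simp [qBinom, qFact]
    | succ m ih =>
      rw [Nat.zero_add] at ih ⊢
      rw [qBinom_succ_succ, qBinom_eq_zero q (Nat.lt_succ_self m), qFact_succ]
      linear_combination (1 - q ^ (m + 1)) * ih
  | succ n ih =>
    induction m with
    | zero => simp [qBinom_zero_right, qFact]
    | succ m ihm =>
      have h1 := ih (m + 1)
      rw [show n + 1 + (m + 1) = (n + 1 + m) + 1 by ring, qBinom_succ_succ, qFact_succ q (n + 1 + m),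
        ← ihm]
      rw [show n + (m + 1) = n + 1 + m by ring, ← ihm, qFact_succ q m, qFact_succ q n] at h1
      rw [qFact_succ q m, qFact_succ q n]
      have h2 : q ^ (m + 1) * (qBinom q (n + 1 + m) (m + 1) * (qFact q m * (1 - q ^ (m + 1)) *
          qFact q n)) * (1 - q ^ (n + 1)) = q ^ (m + 1) * (qBinom q (n + 1 + m) m *
          (qFact q m * (qFact q n * (1 - q ^ (n + 1))))) * (1 - q ^ (n + 1)) := by rw [h1]
      have h3 : q ^ (n + 1 + m + 1) = q ^ (n + 1) * q ^ (m + 1) := by ring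
      rw [h3]
      linear_combination h2

/-- The terms of the theta series. -/
def thetaTerm (t q : ℂ) (k : ℤ) : ℂ := (-1) ^ k * q ^ (k * (k + 1) / 2) * t ^ k

theorem thetaTerm_zero (t q : ℂ) : thetaTerm t q 0 = 1 := by simp [thetaTerm]

/-- Apart from nonvanishing and the value at 0, this recursion is all that is later used about the
exponent k(k+1)/2. -/
theorem thetaTerm_succ {t q : ℂ} (hq : q ≠ 0) (ht : t ≠ 0) (k : ℤ) :
    thetaTerm t q (k + 1) = -(q ^ (k + 1) * t) * thetaTerm t q k := by
  have h : (k + 1) * (k + 1 + 1) / 2 = k * (k + 1) / 2 + (k + 1) := by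
    rw [show (k + 1) * (k + 1 + 1) = k * (k + 1) + (k + 1) * 2 by ring,
      Int.add_mul_ediv_right _ _ (by norm_num)]
  rw [thetaTerm, thetaTerm, h, zpow_add₀ hq, zpow_add_one₀ ht,
    zpow_add_one₀ (by norm_num : (-1 : ℂ) ≠ 0)]
  ring

theorem summable_thetaTerm {t q : ℂ} (hq0 : q ≠ 0) (hq : ‖q‖ < 1) (ht : t ≠ 0) :
    Summable fun k => ‖thetaTerm t q k‖ := by
  have hne : ∀ k, thetaTerm t q k ≠ 0 := fun k =>
    mul_ne_zero (mul_ne_zero (zpow_ne_zero _ (by norm_num)) (zpow_ne_zero _ hq0))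
      (zpow_ne_zero _ ht)
  have hlim : ∀ c : ℝ, Tendsto (fun n : ℕ => ‖q‖ ^ n * c) atTop (𝓝 0) := fun c => by
    simpa using (tendsto_pow_atTop_nhds_zero_of_lt_one (norm_nonneg q) hq).mul_const c
  refine Summable.of_nat_of_neg ?_ ?_
  · refine summable_of_ratio_test_tendsto_lt_one zero_lt_one
      (Eventually.of_forall fun n => (norm_pos_iff.2 (hne n)).ne') ?_
    refine (hlim (‖q‖ * ‖t‖)).congr fun n => ?_
    have h0 := (norm_pos_iff.2 (hne n)).ne'
    rw [Nat.cast_succ, thetaTerm_succ hq0 ht, norm_norm, norm_norm, eq_div_iff h0, norm_mul,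
      norm_neg, norm_mul, zpow_add_one₀ hq0, norm_mul, zpow_natCast, norm_pow]
    ring
  · refine summable_of_ratio_test_tendsto_lt_one zero_lt_one
      (Eventually.of_forall fun n => (norm_pos_iff.2 (hne _)).ne') ?_
    refine (hlim ‖t‖⁻¹).congr fun n => ?_
    have h0 := (norm_pos_iff.2 (hne (-((n + 1 : ℕ) : ℤ)))).ne'
    have h1 := thetaTerm_succ hq0 ht (-((n + 1 : ℕ) : ℤ))
    have h2 : -((n + 1 : ℕ) : ℤ) + 1 = -(n : ℤ) := by push_cast; ring
    rw [h2] at h1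
    have h3 := (norm_pos_iff.2 (hne (-(n : ℤ)))).ne'
    rw [norm_norm, norm_norm, eq_div_iff h3, h1, norm_mul, norm_neg, norm_mul, zpow_neg, norm_inv,
      zpow_natCast, norm_pow]
    have hqn : ‖q‖ ^ n ≠ 0 := pow_ne_zero _ (norm_ne_zero_iff.2 hq0)
    have htn : ‖t‖ ≠ 0 := norm_ne_zero_iff.2 ht
    field_simp

theorem pow_mul_thetaTerm {t q : ℂ} (hq : q ≠ 0) (ht : t ≠ 0) (n m : ℕ) :
    thetaTerm t q (-n) * (q ^ (m.choose 2) * (-(t * q ^ (1 - n : ℤ))) ^ m) =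
      thetaTerm t q (m - n) := by
  induction m with
  | zero => simp
  | succ m ih =>
    rw [Nat.choose_succ_succ' m 1, Nat.choose_one_right, pow_add, pow_succ,
      show ((m + 1 : ℕ) : ℤ) - n = (m - n : ℤ) + 1 by push_cast; ring, thetaTerm_succ hq ht, ← ih,
      show (m - n : ℤ) + 1 = m + (1 - n) by ring, zpow_add₀ hq, zpow_natCast]
    ring

/-- Each factor is 1 - tq^{-i} = -tq^{-i}(1 - q^i t⁻¹), and the theta term of index -n is the
product of the inverses of the monomials. -/
theorem thetaTerm_mul_prod {t q : ℂ} (hq : q ≠ 0) (ht : t ≠ 0) (n : ℕ) :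
    thetaTerm t q (-n) * ∏ i ∈ Finset.range n, (1 - t * q ^ (-i : ℤ)) =
      ∏ i ∈ Finset.range n, (1 - q ^ i * t⁻¹) := by
  induction n with
  | zero => simp [thetaTerm_zero]
  | succ n ih =>
    rw [Finset.prod_range_succ, Finset.prod_range_succ, ← ih]
    have h := thetaTerm_succ hq ht (-((n + 1 : ℕ) : ℤ))
    rw [show -((n + 1 : ℕ) : ℤ) + 1 = -(n : ℤ) by push_cast; ring] at h
    rw [h, zpow_neg, zpow_natCast]
    have hqn : q ^ n ≠ 0 := pow_ne_zero _ hq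
    field_simp
    ring

/-- The finite form of the triple product identity. -/
theorem finite_triple_product {t q : ℂ} (hq : q ≠ 0) (ht : t ≠ 0) (n : ℕ) :
    (∏ i ∈ Finset.range n, (1 - q ^ i * t⁻¹)) * ∏ i ∈ Finset.range n, (1 - q ^ i * (q * t)) =
      ∑ m ∈ Finset.range (2 * n + 1), qBinom q (2 * n) m * thetaTerm t q (m - n) := by
  -- With this argument the 2n factors carry the exponents 1-n, …, n: the first half gives the
  -- product in t⁻¹, the second half the product in qt.
  have h1 := prod_one_add_mul_pow q (-(t * q ^ (1 - n : ℤ))) (2 * n)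
  have h2 : ∑ m ∈ Finset.range (2 * n + 1), qBinom q (2 * n) m * thetaTerm t q (m - n) =
      thetaTerm t q (-n) * ∏ j ∈ Finset.range (2 * n), (1 + -(t * q ^ (1 - n : ℤ)) * q ^ j) := by
    rw [h1, Finset.mul_sum]
    refine Finset.sum_congr rfl fun m _ => ?_
    rw [← pow_mul_thetaTerm hq ht]
    ring
  rw [h2, two_mul, Finset.prod_range_add, ← thetaTerm_mul_prod hq ht, mul_assoc]
  congr 2
  · rw [← Finset.prod_range_reflect]
    refine Finset.prod_congr rfl fun j hj => ?_
    have hj' := Finset.mem_range.1 hj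
    rw [neg_mul, ← sub_eq_add_neg, mul_assoc, ← zpow_natCast, ← zpow_add₀ hq]
    congr 3
    push_cast [Nat.sub_sub, Nat.cast_sub (show 1 + j ≤ n by omega)]
    ring
  · refine Finset.prod_congr rfl fun j _ => ?_
    rw [neg_mul, ← sub_eq_add_neg, mul_assoc, ← zpow_natCast q (n + j), ← zpow_add₀ hq,
      show (1 - n : ℤ) + ((n + j : ℕ) : ℤ) = ((j + 1 : ℕ) : ℤ) by push_cast; ring, zpow_natCast]
    ring

/-- The **Jacobi triple product**. -/
theorem jacobi_triple_product {t q : ℂ} (hq0 : q ≠ 0) (hq : ‖q‖ < 1) (ht : t ≠ 0) :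
    thetaSeries t q = qProd (q * t) q * qProd t⁻¹ q * qProd q q := by
  set L := qProd q q with hL
  have hL0 : L ≠ 0 := qProd_ne_zero hq (one_sub_pow_mul_ne_zero hq)
  have hF : Tendsto (qFact q) atTop (𝓝 L) := tendsto_qProd hq q
  -- Since (q;q)_n converges to L ≠ 0, it and its inverse are bounded; this bounds all q-binomials
  -- uniformly and allows dominated convergence of the sums.
  obtain ⟨B, hB⟩ := hF.norm.bddAbove_range
  obtain ⟨B', hB'⟩ := (hF.inv₀ hL0).norm.bddAbove_range
  have hB1 : ∀ n, ‖qFact q n‖ ≤ B := fun n => hB ⟨n, rfl⟩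
  have hB2 : ∀ n, ‖(qFact q n)⁻¹‖ ≤ B' := fun n => hB' ⟨n, rfl⟩
  have hform : ∀ n m, qBinom q (n + m) m = qFact q (n + m) * ((qFact q m)⁻¹ * (qFact q n)⁻¹) :=
    fun n m => by
      rw [← qBinom_mul_qFact q n m]
      have := qFact_ne_zero hq m
      have := qFact_ne_zero hq n
      field_simp
  have hbound : ∀ n m, m ≤ n → ‖qBinom q n m‖ ≤ B * (B' * B') := fun n m hmn => by
    obtain ⟨k, rfl⟩ := Nat.exists_eq_add_of_le' hmn
    rw [hform, norm_mul, norm_mul]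
    have h0 := (norm_nonneg _).trans (hB1 0)
    have h0' := (norm_nonneg _).trans (hB2 0)
    gcongr
    · exact hB1 _
    · exact hB2 _
    · exact hB2 _
  set c : ℕ → ℤ → ℂ := fun n k =>
    if k ∈ Finset.Icc (-(n : ℤ)) n then qBinom q (2 * n) (k + n).toNat else 0 with hc
  have hsum : ∀ n : ℕ, ∑ m ∈ Finset.range (2 * n + 1), qBinom q (2 * n) m * thetaTerm t q (m - n) =
      ∑' k : ℤ, c n k * thetaTerm t q k := fun n => by
    rw [tsum_eq_sum (s := Finset.Icc (-(n : ℤ)) n) fun k hk => by simp only [hc, if_neg hk, zero_mul]]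
    refine Finset.sum_nbij' (fun m => (m : ℤ) - n) (fun k => (k + n).toNat) ?_ ?_ ?_ ?_ ?_
    · intro m hm; simp only [Finset.mem_range, Finset.mem_Icc] at *; omega
    · intro m hm; simp only [Finset.mem_range, Finset.mem_Icc] at *; omega
    · intro m hm; simp
    · intro m hm; simp only [Finset.mem_Icc] at *; omega
    · intro m hm
      have : (m : ℤ) - n ∈ Finset.Icc (-(n : ℤ)) n := by
        simp only [Finset.mem_range, Finset.mem_Icc] at *; omega
      simp only [hc]
      rw [if_pos this]
      simp
  have hlim : Tendsto (fun n : ℕ => ∑' k : ℤ, c n k * thetaTerm t q k) atTop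
      (𝓝 (∑' k : ℤ, L⁻¹ * thetaTerm t q k)) := by
    refine tendsto_tsum_of_dominated_convergence
      ((summable_thetaTerm hq0 hq ht).mul_left (B * (B' * B'))) (fun k => ?_)
      (Eventually.of_forall fun n k => ?_)
    · refine Tendsto.mul_const _ ?_
      have h1 : Tendsto (fun n : ℕ => 2 * n) atTop atTop := tendsto_id.const_mul_atTop' two_pos
      have h2 : Tendsto (fun n : ℕ => (k + n).toNat) atTop atTop :=
        tendsto_atTop.2 fun b => by
          filter_upwards [eventually_ge_atTop (b + k.natAbs)] with n hn
          omega
      have h3 : Tendsto (fun n : ℕ => (n - k).toNat) atTop atTop :=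
        tendsto_atTop.2 fun b => by
          filter_upwards [eventually_ge_atTop (b + k.natAbs)] with n hn
          omega
      -- The coefficient with 2n over n+k is (q;q)_{2n}/((q;q)_{n+k}(q;q)_{n-k}), which tends to
      -- L/L² = 1/L.
      have h4 := (hF.comp h1).mul
        (((hF.inv₀ hL0).comp h2).mul ((hF.inv₀ hL0).comp h3))
      rw [mul_inv_cancel_left₀ hL0] at h4
      refine h4.congr' ?_
      filter_upwards [eventually_ge_atTop k.natAbs] with n hn
      have hk : k ∈ Finset.Icc (-(n : ℤ)) n := by simp only [Finset.mem_Icc]; omega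
      simp only [hc, if_pos hk, Function.comp]
      have h5 : 2 * n = (n - k).toNat + (k + n).toNat := by omega
      rw [h5, hform]
    · rw [norm_mul]
      refine mul_le_mul_of_nonneg_right ?_ (norm_nonneg _)
      simp only [hc]
      split_ifs with hk
      · exact hbound _ _ (by simp only [Finset.mem_Icc] at hk; omega)
      · rw [norm_zero]; exact (norm_nonneg _).trans (hbound 0 0 le_rfl)
  have hlim' : Tendsto (fun n : ℕ => ∑' k : ℤ, c n k * thetaTerm t q k) atTop
      (𝓝 (qProd t⁻¹ q * qProd (q * t) q)) := by
    refine ((tendsto_qProd hq t⁻¹).mul (tendsto_qProd hq (q * t))).congr fun n => ?_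
    rw [finite_triple_product hq0 ht, hsum]
  have h := tendsto_nhds_unique hlim hlim'
  rw [tsum_mul_left, inv_mul_eq_iff_eq_mul₀ hL0] at h
  change ∑' k : ℤ, thetaTerm t q k = _
  rw [h]
  ring

/-! ### The two solutions -/

theorem one_lt_norm_of {q : ℂ} (h1 : ‖q‖ ≠ 1) (h : ¬‖q‖ < 1) : ‖q⁻¹‖ < 1 := by
  rw [norm_inv]
  exact inv_lt_one_of_one_lt₀ (lt_of_le_of_ne (not_lt.1 h) h1.symm)

theorem f0_of_lt {t q : ℂ} (hq : ‖q‖ < 1) : f0 t q = qProd (q * t) q := by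
  rw [f0, qPoch, if_pos hq, qProd]

theorem f0_of_not_lt {t q : ℂ} (hq0 : q ≠ 0) (hq : ¬‖q‖ < 1) : f0 t q = (qProd t q⁻¹)⁻¹ := by
  rw [f0, qPoch, if_neg hq, qProd]
  congr 1
  refine tprod_congr fun k => ?_
  rw [pow_succ, mul_assoc, inv_mul_cancel_left₀ hq0]

theorem qProd_ne_zero_of_notMem {t q : ℂ} (hq : ‖q‖ < 1) (hq0 : q ≠ 0) (n : ℤ)
    (ht : ∀ n : ℤ, t ≠ q ^ n) : qProd (q ^ n * t) q ≠ 0 := by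
  refine qProd_ne_zero hq fun k h => ht (-(k + n)) ?_
  rw [zpow_neg, zpow_add₀ hq0, zpow_natCast]
  refine eq_inv_of_mul_eq_one_right ?_
  rw [mul_assoc]
  exact (sub_eq_zero.1 h).symm

theorem notMem_inv {t q : ℂ} (ht : ∀ n : ℤ, t ≠ q ^ n) : ∀ n : ℤ, t ≠ q⁻¹ ^ n := fun n => by
  rw [inv_zpow']; exact ht _

theorem inv_notMem {t q : ℂ} (ht : ∀ n : ℤ, t ≠ q ^ n) : ∀ n : ℤ, t⁻¹ ≠ q ^ n := fun n h =>
  ht (-n) (by rw [zpow_neg, ← h, inv_inv])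

theorem f0_ne_zero {t q : ℂ} (hq0 : q ≠ 0) (hq : ‖q‖ ≠ 1) (ht : ∀ n : ℤ, t ≠ q ^ n) :
    f0 t q ≠ 0 := by
  by_cases h : ‖q‖ < 1
  · rw [f0_of_lt h]
    simpa using qProd_ne_zero_of_notMem h hq0 1 ht
  · rw [f0_of_not_lt hq0 h]
    refine inv_ne_zero ?_
    simpa using qProd_ne_zero_of_notMem (one_lt_norm_of hq h) (inv_ne_zero hq0) 0 (notMem_inv ht)

theorem pochEq_f0 {t q : ℂ} (hq0 : q ≠ 0) (hq : ‖q‖ ≠ 1) (ht : ∀ n : ℤ, t ≠ q ^ n) :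
    PochEq f0 t q := by
  rw [PochEq]
  by_cases h : ‖q‖ < 1
  · rw [f0_of_lt h, f0_of_lt h, qProd_eq_mul h (q * t)]
  · rw [f0_of_not_lt hq0 h, f0_of_not_lt hq0 h, qProd_eq_mul (one_lt_norm_of hq h) (q * t),
      inv_mul_cancel_left₀ hq0, mul_inv, mul_inv_cancel_left₀]
    intro h0
    refine ht (-1) ?_
    rw [zpow_neg_one]
    exact eq_inv_of_mul_eq_one_right (sub_eq_zero.1 h0).symm

/-- For |q| < 1 the triple product cancels both factors of the denominator. For |q| > 1 the
conventions turn this into the inverse of the same identity at (t⁻¹,q⁻¹). -/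
theorem g1_eq_f0 {t q : ℂ} (hq0 : q ≠ 0) (hq : ‖q‖ ≠ 1) (ht0 : t ≠ 0) (ht : ∀ n : ℤ, t ≠ q ^ n) :
    g1 t q = f0 t q := by
  by_cases h : ‖q‖ < 1
  · have h1 : qProd t⁻¹ q ≠ 0 := by
      simpa using qProd_ne_zero_of_notMem h hq0 0 (inv_notMem ht)
    have h2 : qProd q q ≠ 0 := qProd_ne_zero h (one_sub_pow_mul_ne_zero h)
    have h3 : qPoch t⁻¹ q = qProd t⁻¹ q := by rw [qPoch, if_pos h, qProd]
    have h4 : qEuler q = qProd q q := by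
      rw [qEuler, if_pos h, qProd]; exact tprod_congr fun k => by rw [pow_succ]
    rw [g1, f0_of_lt h, theta, if_pos h, jacobi_triple_product hq0 h ht0, h3, h4]
    generalize qProd t⁻¹ q = A at *
    generalize qProd q q = B at *
    field_simp
  · have h' := one_lt_norm_of hq h
    have hqi := inv_ne_zero hq0
    have h1 : qProd (q⁻¹ * t⁻¹) q⁻¹ ≠ 0 := by
      simpa using qProd_ne_zero_of_notMem h' hqi 1 (notMem_inv (inv_notMem ht))
    have h2 : qProd q⁻¹ q⁻¹ ≠ 0 := qProd_ne_zero h' (one_sub_pow_mul_ne_zero h')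
    have h3 : qPoch t⁻¹ q = (qProd (q⁻¹ * t⁻¹) q⁻¹)⁻¹ := by
      rw [qPoch, if_neg h, qProd]
      congr 1
      exact tprod_congr fun k => by rw [pow_succ, mul_assoc]
    have h4 : qEuler q = (qProd q⁻¹ q⁻¹)⁻¹ := by
      rw [qEuler, if_neg h, qProd]
      congr 1
    rw [g1, f0_of_not_lt hq0 h, theta, if_neg h, jacobi_triple_product hqi h' (inv_ne_zero ht0), h3,
      h4, inv_inv]
    generalize qProd (q⁻¹ * t⁻¹) q⁻¹ = A at *
    generalize qProd q⁻¹ q⁻¹ = B at *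
    generalize qProd t q⁻¹ = C at *
    rw [mul_inv, mul_inv]
    field_simp

theorem mul_notMem {t q : ℂ} (hq0 : q ≠ 0) (ht : ∀ n : ℤ, t ≠ q ^ n) : ∀ n : ℤ, q * t ≠ q ^ n :=
  fun n h => ht (n - 1) (by rw [zpow_sub_one₀ hq0, ← h]; field_simp)

theorem pochEq_g1 {t q : ℂ} (hq0 : q ≠ 0) (hq : ‖q‖ ≠ 1) (ht0 : t ≠ 0) (ht : ∀ n : ℤ, t ≠ q ^ n) :
    PochEq g1 t q := by
  rw [PochEq, g1_eq_f0 hq0 hq ht0 ht, g1_eq_f0 hq0 hq (mul_ne_zero hq0 ht0) (mul_notMem hq0 ht)]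
  exact pochEq_f0 hq0 hq ht

theorem U_eq (t q : ℂ) : U t q = !![f0 t q] := by
  ext i j
  fin_cases i; fin_cases j
  simp [U, wronskian]

theorem V_eq (t q : ℂ) : V t q = !![g1 t q] := by
  ext i j
  fin_cases i; fin_cases j
  simp [V, wronskian]

theorem inv_one_by_one (x : ℂ) : (!![x] : Matrix (Fin 1) (Fin 1) ℂ)⁻¹ = !![x⁻¹] := by
  rw [Matrix.inv_def]
  ext i j
  fin_cases i; fin_cases j
  simp

theorem mul_one_by_one (x y : ℂ) : (!![x] : Matrix (Fin 1) (Fin 1) ℂ) * !![y] = !![x * y] := by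
  ext i j
  fin_cases i; fin_cases j
  simp

/-! ### The solution as a function of `(z, τ)` -/

/-- `f⁽⁰⁾` as a function of `(z, τ)`. -/
def uFun (z τ : ℂ) : ℂ := f0 (e z) (e τ)

theorem norm_e_ne_one {τ : ℂ} (hτ : τ.im ≠ 0) : ‖e τ‖ ≠ 1 := by
  rw [norm_e, Ne, Real.exp_eq_one_iff]
  simp [Real.pi_ne_zero, hτ]

theorem norm_e_lt_one_iff {τ : ℂ} : ‖e τ‖ < 1 ↔ 0 < τ.im := by
  rw [norm_e, Real.exp_lt_one_iff]
  have := Real.pi_pos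
  constructor
  · intro h
    by_contra hc
    nlinarith
  · intro h
    have : 0 < 2 * Real.pi * τ.im := by positivity
    linarith

theorem e_notMem {z τ : ℂ} (hz : z ∉ latticeTranslates {0} τ) : ∀ n : ℤ, e z ≠ e τ ^ n := by
  intro n h
  have h1 : e (z + (-n : ℤ) * τ) = 1 := by
    rw [e_add, e_int_mul, h, ← zpow_add₀ (e_ne_zero τ)]
    simp
  exact one_sub_e_ne_zero hz (-n) (by rw [h1, sub_self])

theorem uFun_ne_zero {z τ : ℂ} (hτ : τ.im ≠ 0) (hz : z ∉ latticeTranslates {0} τ) :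
    uFun z τ ≠ 0 := f0_ne_zero (e_ne_zero τ) (norm_e_ne_one hτ) (e_notMem hz)

theorem g1_eq_uFun {z τ : ℂ} (hτ : τ.im ≠ 0) (hz : z ∉ latticeTranslates {0} τ) :
    g1 (e z) (e τ) = uFun z τ :=
  g1_eq_f0 (e_ne_zero τ) (norm_e_ne_one hτ) (e_ne_zero z) (e_notMem hz)

theorem uFun_add_intCast_left (z τ : ℂ) (n : ℤ) : uFun (z + n) τ = uFun z τ := by
  rw [uFun, uFun, e_add_intCast]

theorem uFun_add_intCast_right (z τ : ℂ) (n : ℤ) : uFun z (τ + n) = uFun z τ := by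
  rw [uFun, uFun, e_add_intCast]

theorem uFun_add_tau {z τ : ℂ} (hτ : τ.im ≠ 0) (hz : z ∉ latticeTranslates {0} τ) :
    (1 - e (z + τ)) * uFun (z + τ) τ = uFun z τ := by
  have := pochEq_f0 (e_ne_zero τ) (norm_e_ne_one hτ) (e_notMem hz)
  rw [PochEq] at this
  rw [uFun, uFun, add_comm z τ, e_add, this]

theorem tendsto_uFun {α : Type*} {l : Filter α} {τ : ℂ} (hτ : τ.im ≠ 0) {f : α → ℂ}
    (hf : Tendsto (fun a => (f a).im) l atTop) : Tendsto (fun a => uFun (f a) τ) l (𝓝 1) := by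
  have he : Tendsto (fun a => e (f a)) l (𝓝 0) := by
    rw [tendsto_zero_iff_norm_tendsto_zero]
    simp only [norm_e]
    exact Real.tendsto_exp_neg_atTop_nhds_zero.comp (hf.const_mul_atTop (by positivity))
  by_cases h : ‖e τ‖ < 1
  · simp only [uFun, f0_of_lt h]
    exact tendsto_qProd_one h (by simpa using he.const_mul (e τ))
  · simp only [uFun, f0_of_not_lt (e_ne_zero τ) h]
    simpa using (tendsto_qProd_one (one_lt_norm_of (norm_e_ne_one hτ) h) he).inv₀ one_ne_zero

/-- The convention for |q| > 1 in Jacobi variables; it transfers product formulas from the upper to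
the lower half-plane. -/
theorem uFun_neg {z τ : ℂ} (hτ : τ.im ≠ 0) : uFun z τ = (uFun (z + τ) (-τ))⁻¹ := by
  by_cases h : ‖e τ‖ < 1
  · have h' : ¬‖e (-τ)‖ < 1 := by
      rw [norm_e_lt_one_iff] at h ⊢
      rw [neg_im]; linarith
    rw [uFun, uFun, f0_of_lt h, f0_of_not_lt (e_ne_zero _) h', inv_inv, e_neg, inv_inv, add_comm,
      e_add]
  · have h' : ‖e (-τ)‖ < 1 := by
      rw [norm_e_lt_one_iff] at h ⊢
      rw [neg_im]
      have := lt_of_le_of_ne (not_lt.1 h) hτ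
      linarith
    rw [uFun, uFun, f0_of_not_lt (e_ne_zero _) h, f0_of_lt h', ← e_add, ← e_neg]
    congr 3
    ring

/-- The class j modulo c contributes q^{j+1} = q^c · q^{-(c-1-j)}; hence the reversed index and the
shifts by -jτ. -/
theorem uFun_eq_prod_of_pos {z τ : ℂ} (hτ : 0 < τ.im) {c : ℕ} (hc : 0 < c) :
    uFun z τ = ∏ j ∈ Finset.range c, uFun (z - j * τ) (c * τ) := by
  have h : ‖e τ‖ < 1 := norm_e_lt_one_iff.2 hτ
  have h' : ‖e (c * τ)‖ < 1 := by
    rw [e_nat_mul, norm_pow]; exact pow_lt_one₀ (norm_nonneg _) h hc.ne'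
  rw [uFun, f0_of_lt h, qProd_eq_prod h _ hc, ← Finset.prod_range_reflect]
  refine Finset.prod_congr rfl fun j hj => ?_
  have hj' := Finset.mem_range.1 hj
  rw [uFun, f0_of_lt h', e_nat_mul, ← e_nat_mul, ← e_nat_mul, ← e_add, ← e_add, ← e_add]
  congr 2
  rw [Nat.sub_sub, Nat.cast_sub (by omega)]
  push_cast
  ring

theorem uFun_eq_prod {z τ : ℂ} (hτ : τ.im ≠ 0) {c : ℕ} (hc : 0 < c) :
    uFun z τ = ∏ j ∈ Finset.range c, uFun (z - j * τ) (c * τ) := by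
  rcases lt_or_gt_of_ne hτ with h | h
  · rw [uFun_neg hτ, uFun_eq_prod_of_pos (by simpa using h) hc, ← Finset.prod_inv_distrib,
      ← Finset.prod_range_reflect]
    refine Finset.prod_congr rfl fun j hj => ?_
    have hj' := Finset.mem_range.1 hj
    have hcτ : ((c : ℂ) * τ).im ≠ 0 := by
      rw [← ofReal_natCast, im_ofReal_mul]
      exact mul_ne_zero (by exact_mod_cast hc.ne') hτ
    rw [uFun_neg (z := z - j * τ) hcτ]
    congr 2
    · rw [Nat.sub_sub, Nat.cast_sub (by omega)]
      push_cast
      ring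
    · ring
  · exact uFun_eq_prod_of_pos h hc

/-! ### The cocycle at `S` is the quantum dilogarithm -/

/-- Multiplication by cτ+d carries the lattice of the transformed τ into ℤ+τℤ; this inclusion needs
no condition on the determinant. -/
theorem div_notMem_lattice {z τ : ℂ} {a b c d : ℤ} (hσ : (c * τ + d : ℂ) ≠ 0)
    (hz : z ∉ latticeTranslates {0} τ) :
    z / (c * τ + d) ∉ latticeTranslates {0} ((a * τ + b) / (c * τ + d)) := by
  rw [mem_lattice_iff] at hz ⊢
  rintro ⟨m, n, h⟩
  refine hz ⟨m * d + n * b, m * c + n * a, ?_⟩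
  field_simp at h
  push_cast
  linear_combination h

theorem slitPlane_of_im_ne_zero {τ : ℂ} (hτ : τ.im ≠ 0) : τ ∈ slitPlane :=
  mem_slitPlane_iff.2 (Or.inr hτ)

theorem neg_one_div_im_ne_zero {τ : ℂ} (hτ : τ.im ≠ 0) : (-1 / τ).im ≠ 0 := by
  have h0 : τ ≠ 0 := fun h => hτ (by simp [h])
  rw [neg_div, one_div, neg_im, inv_im, neg_div, neg_neg]
  exact div_ne_zero hτ (normSq_eq_zero.not.2 h0)

theorem div_tau_notMem {z τ : ℂ} (hτ : τ ≠ 0) (hz : z ∉ latticeTranslates {0} τ) :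
    z / τ ∉ latticeTranslates {0} (-1 / τ) := by
  have := div_notMem_lattice (a := 0) (b := -1) (c := 1) (d := 0) (by simpa using hτ) hz
  simpa using this

theorem add_one_mem_lattice_iff {z τ : ℂ} :
    z + 1 ∈ latticeTranslates {0} τ ↔ z ∈ latticeTranslates {0} τ := by
  simpa using add_mem_lattice_iff (z := z) (τ := τ) 1 0

theorem add_tau_mem_lattice_iff {z τ : ℂ} :
    z + τ ∈ latticeTranslates {0} τ ↔ z ∈ latticeTranslates {0} τ := by
  simpa using add_mem_lattice_iff (z := z) (τ := τ) 0 1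

/-- The only entry of the cocycle at `S`. -/
def omegaS (z τ : ℂ) : ℂ := uFun (z / τ) (-1 / τ) / uFun z τ

theorem omegaS_ne_zero {z τ : ℂ} (hτ : τ.im ≠ 0) (hz : z ∉ latticeTranslates {0} τ) :
    omegaS z τ ≠ 0 :=
  div_ne_zero (uFun_ne_zero (neg_one_div_im_ne_zero hτ)
    (div_tau_notMem (fun h => hτ (by simp [h])) hz)) (uFun_ne_zero hτ hz)

/-- Under z ↦ z+τ the numerator is periodic and the denominator supplies the factor; under z ↦ z+1
the roles are exchanged. -/
theorem omegaS_add_tau {z τ : ℂ} (hτ : τ.im ≠ 0) (hz : z ∉ latticeTranslates {0} τ) :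
    omegaS (z + τ) τ = (1 - e (z + τ)) * omegaS z τ := by
  have h0 : τ ≠ 0 := fun h => hτ (by simp [h])
  have h1 : uFun ((z + τ) / τ) (-1 / τ) = uFun (z / τ) (-1 / τ) := by
    rw [add_div, div_self h0]
    simpa using uFun_add_intCast_left (z / τ) (-1 / τ) 1
  have h2 := uFun_add_tau hτ hz
  have h3 := uFun_ne_zero hτ hz
  rw [← h2] at h3
  rw [omegaS, omegaS, h1, ← h2, mul_div_assoc', mul_div_mul_left _ _ (left_ne_zero_of_mul h3)]

theorem omegaS_add_one {z τ : ℂ} (hτ : τ.im ≠ 0) (hz : z ∉ latticeTranslates {0} τ) :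
    omegaS (z + 1) τ = (1 - e (z / τ)) * omegaS z τ := by
  have h0 : τ ≠ 0 := fun h => hτ (by simp [h])
  have h1 : uFun (z + 1) τ = uFun z τ := by simpa using uFun_add_intCast_left z τ 1
  have h2 := uFun_add_tau (neg_one_div_im_ne_zero hτ)
    (div_tau_notMem h0 (mt add_one_mem_lattice_iff.1 hz))
  rw [← add_div, show z + 1 + -1 = z by ring] at h2
  rw [omegaS, omegaS, h1, ← h2, mul_div_assoc]

theorem tendsto_mul_im_atTop {α : Type*} {l : Filter α} {w : α → ℂ} {c : ℂ} (hc : 0 < c.re) {C : ℝ}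
    (hre : ∀ a, |(w a).re| ≤ C) (him : Tendsto (fun a => (w a).im) l atTop) :
    Tendsto (fun a => (c * w a).im) l atTop := by
  refine tendsto_atTop_mono (fun a => ?_) (tendsto_atTop_add_const_right l (-(|c.im| * C))
    (him.const_mul_atTop hc))
  rw [mul_im]
  have h1 : |c.im * (w a).re| ≤ |c.im| * C := by
    rw [abs_mul]; exact mul_le_mul_of_nonneg_left (hre a) (abs_nonneg _)
  linarith [(abs_le.1 h1).1]

theorem tendsto_stripFun {α : Type*} {l : Filter α} {τ : ℂ} (hτ : τ ∈ slitPlane) {f : α → ℂ} {h : ℝ}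
    (h₀ : 0 ≤ h) (hh : 2 * h < (rootTau τ).re + (rootTau τ)⁻¹.re)
    (hf : ∀ a, |(dilogArg (f a) τ).im| ≤ h)
    (him : Tendsto (fun a => (f a / rootTau τ).im) l atTop) :
    Tendsto (fun a => stripFun (f a) τ) l (𝓝 1) := by
  have hb := rootTau_re_pos hτ
  obtain ⟨M, hM⟩ := exists_norm_faddeevIntegral_le hb h₀ hh
  have hre : Tendsto (fun a => (dilogArg (f a) τ).re) l atBot := by
    simp only [dilogArg_re]
    refine tendsto_neg_atTop_atBot.comp ?_
    simp only [add_sub_assoc]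
    exact tendsto_atTop_add_const_right l _ him
  have hmin : 0 < 2 * min (rootTau τ).re (rootTau τ)⁻¹.re :=
    mul_pos two_pos (lt_min hb (inv_re_pos hb))
  have h1 : Tendsto (fun a => faddeevIntegral (rootTau τ) (dilogArg (f a) τ)) l (𝓝 0) := by
    refine squeeze_zero_norm (fun a => hM _ (hf a)) ?_
    simpa using (Real.tendsto_exp_atBot.comp (hre.const_mul_atBot hmin)).const_mul M
  simpa [stripFun, Function.comp_def] using (Complex.continuous_exp.tendsto _).comp h1.neg

theorem rootTau_im_ne_zero {τ : ℂ} (hτ : τ.im ≠ 0) : (rootTau τ).im ≠ 0 := by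
  intro h
  have := congrArg Complex.im (rootTau_sq τ)
  rw [mul_im, h] at this
  simp at this
  exact hτ this.symm

/-- Translates by -εk, with ε the sign of Im √τ, are brought back to a fixed vertical band by
multiples of τ. Both translations push Im(z/√τ) upwards, at total rate |Im b|(1/|b|² + Re b⁻¹/Re b)
per step, where b = √τ. The margin η keeps the band away from the left edge of the strip. -/
theorem exists_translates_tendsto {τ : ℂ} (hτ : τ.im ≠ 0) (z : ℂ) {η : ℝ} :
    ∃ m n : ℕ → ℤ, (∀ k, -(rootTau τ).re + η < ((z + m k + n k * τ) / rootTau τ).re ∧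
      ((z + m k + n k * τ) / rootTau τ).re ≤ η) ∧
      Tendsto (fun k => ((z + m k + n k * τ) / rootTau τ).im) atTop atTop := by
  have hs := slitPlane_of_im_ne_zero hτ
  set b := rootTau τ with hb
  have hα : 0 < b.re := rootTau_re_pos hs
  have hβ : 0 < b⁻¹.re := inv_re_pos hα
  have hbn : b ≠ 0 := rootTau_ne_zero hs
  have hB : b.im ≠ 0 := rootTau_im_ne_zero hτ
  have hN : 0 < normSq b := normSq_pos.2 hbn
  obtain ⟨ε, hε⟩ : ∃ ε : ℤ, (ε : ℝ) * b.im = |b.im| := by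
    rcases lt_or_gt_of_ne hB with h | h
    · exact ⟨-1, by rw [abs_of_neg h]; push_cast; ring⟩
    · exact ⟨1, by rw [abs_of_pos h]; push_cast; ring⟩
  set m : ℕ → ℤ := fun k => -(ε * k) with hm
  -- Subtracting ηb before normalizing moves the band from (-Re b, 0] to (-Re b + η, η].
  set n : ℕ → ℤ := fun k => stripIndex (z + m k - η * b) τ with hn
  have key : ∀ k, -b.re + η < ((z + m k + n k * τ) / b).re ∧ ((z + m k + n k * τ) / b).re ≤ η := by
    intro k
    have h := stripIndex_spec hs (z + m k - η * b)
    have e₁ : (z + m k - η * b + stripIndex (z + m k - η * b) τ * τ) / rootTau τ =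
        (z + m k + n k * τ) / b - η := by
      rw [← hb]
      field_simp
      ring
    rw [e₁, sub_re, ofReal_re, ← hb] at h
    constructor <;> linarith [h.1, h.2]
  have hw : ∀ k, (z + m k + n k * τ) / b = z / b + m k * b⁻¹ + n k * b := fun k => by
    rw [add_div, add_div, mul_div_assoc, tau_div_rootTau hs, div_eq_mul_inv (m k : ℂ)]
  refine ⟨m, n, key, ?_⟩
  have hslope : 0 < |b.im| * (1 / normSq b + b⁻¹.re / b.re) :=
    mul_pos (abs_pos.2 hB) (by positivity)
  refine tendsto_atTop_mono (fun k => ?_) (tendsto_atTop_add_const_right atTop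
    ((z / b).im - |b.im| * ((|(z / b).re| + |η| + b.re) / b.re))
    (tendsto_natCast_atTop_atTop.const_mul_atTop hslope))
  have hk := key k
  set s := ((z + m k + n k * τ) / b).re with hs'
  have hre : s = (z / b).re + m k * b⁻¹.re + n k * b.re := by
    rw [hs', hw, add_re, add_re, ← ofReal_intCast, ← ofReal_intCast, re_ofReal_mul, re_ofReal_mul]
  have him : ((z + m k + n k * τ) / b).im = (z / b).im + m k * b⁻¹.im + n k * b.im := by
    rw [hw, add_im, add_im, ← ofReal_intCast, ← ofReal_intCast, im_ofReal_mul, im_ofReal_mul]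
  have hnk : (n k : ℝ) = (s - (z / b).re - m k * b⁻¹.re) / b.re := by
    rw [hre]; field_simp; ring
  have hmk : (m k : ℝ) * b.im = -(|b.im| * k) := by
    rw [← hε]; simp only [hm]; push_cast; ring
  have hsη : |b.im * ((s - (z / b).re) / b.re)| ≤
      |b.im| * ((|(z / b).re| + |η| + b.re) / b.re) := by
    rw [abs_mul, abs_div, abs_of_pos hα]
    refine mul_le_mul_of_nonneg_left (div_le_div_of_nonneg_right ?_ hα.le) (abs_nonneg _)
    have h1 : |s| ≤ |η| + b.re := by
      rw [abs_le]
      constructor <;> linarith [hk.1, hk.2, neg_abs_le η, le_abs_self η]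
    linarith [abs_sub s (z / b).re]
  have e₂ : ((z + m k + n k * τ) / b).im = (z / b).im +
      |b.im| * (1 / normSq b + b⁻¹.re / b.re) * k + b.im * ((s - (z / b).re) / b.re) := by
    rw [him, hnk, inv_im]
    have : (m k : ℝ) * (-b.im / normSq b) = |b.im| * k / normSq b := by
      rw [mul_div_assoc', mul_neg, hmk, neg_neg]
    rw [this]
    have : (s - (z / b).re - m k * b⁻¹.re) / b.re * b.im =
        b.im * ((s - (z / b).re) / b.re) - m k * b.im * (b⁻¹.re / b.re) := by ring
    rw [this, hmk]
    ring
  rw [e₂]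
  linarith [(abs_le.1 hsη).1]

theorem eq_add_int_mul_of_forall {P : ℂ → Prop} {f : ℂ → ℂ} {w : ℂ} (hP : ∀ z, P (z + w) ↔ P z)
    (hf : ∀ z, P z → f (z + w) = f z) (n : ℤ) {z : ℂ} (hz : P z) :
    P (z + n * w) ∧ f (z + n * w) = f z := by
  induction n using Int.induction_on with
  | zero => simpa using hz
  | succ n ih =>
    rw [show z + ((n + 1 : ℤ) : ℂ) * w = z + ((n : ℤ) : ℂ) * w + w by push_cast; ring]
    exact ⟨(hP _).2 ih.1, (hf _ ih.1).trans ih.2⟩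
  | pred n ih =>
    have e₁ : z + ((-n : ℤ) : ℂ) * w = z + ((-n - 1 : ℤ) : ℂ) * w + w := by push_cast; ring
    rw [e₁, hP] at ih
    exact ⟨ih.1, (hf _ ih.1).symm.trans ih.2⟩

/-- The ratio of the two sides has the same value at every lattice translate of z. Along translates
with Re(z/√τ) bounded and Im(z/√τ) → ∞, Faddeev's integral tends to 0 and both values of u tend to
1, so that common value is 1. Neither Liouville's theorem nor analyticity in z is needed for this
comparison. -/
theorem omegaS_eq_dilogExt {z τ : ℂ} (hτ : τ.im ≠ 0) (hz : z ∉ latticeTranslates {0} τ) :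
    omegaS z τ = dilogExt z τ := by
  have hs := slitPlane_of_im_ne_zero hτ
  have h0 := slitPlane_ne_zero hs
  have hα : 0 < (rootTau τ).re := rootTau_re_pos hs
  have hβ : 0 < (rootTau τ)⁻¹.re := inv_re_pos hα
  have hbn : rootTau τ ≠ 0 := rootTau_ne_zero hs
  set η : ℝ := min (rootTau τ).re (rootTau τ)⁻¹.re / 2 with hη
  have hη0 : 0 < η := half_pos (lt_min hα hβ)
  have hη1 : 2 * η ≤ (rootTau τ).re := by
    rw [hη]; linarith [min_le_left (rootTau τ).re (rootTau τ)⁻¹.re]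
  have hη2 : 2 * η ≤ (rootTau τ)⁻¹.re := by
    rw [hη]; linarith [min_le_right (rootTau τ).re (rootTau τ)⁻¹.re]
  obtain ⟨m, n, hmn, him⟩ := exists_translates_tendsto hτ z (η := η)
  set f : ℕ → ℂ := fun k => z + m k + n k * τ with hf
  have hinv : ∀ k, dilogExt (f k) τ / omegaS (f k) τ = dilogExt z τ / omegaS z τ := by
    intro k
    have h1 := eq_add_int_mul_of_forall (P := fun z => z ∉ latticeTranslates {0} τ)
      (f := fun z => dilogExt z τ / omegaS z τ) (w := 1) (fun z => not_congr add_one_mem_lattice_iff)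
      (fun z hz => by
        have h1 := omegaS_add_one hτ hz
        have h2 := omegaS_ne_zero hτ (mt add_one_mem_lattice_iff.1 hz)
        rw [h1] at h2
        change dilogExt (z + 1) τ / omegaS (z + 1) τ = _
        rw [h1, dilogExt_add_one hs hz, mul_div_mul_left _ _ (left_ne_zero_of_mul h2)]) (m k) hz
    rw [mul_one] at h1
    have h2 := eq_add_int_mul_of_forall (P := fun z => z ∉ latticeTranslates {0} τ)
      (f := fun z => dilogExt z τ / omegaS z τ) (w := τ) (fun z => not_congr add_tau_mem_lattice_iff)
      (fun z hz => by
        have h1 := omegaS_add_tau hτ hz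
        have h2 := omegaS_ne_zero hτ (mt add_tau_mem_lattice_iff.1 hz)
        rw [h1] at h2
        change dilogExt (z + τ) τ / omegaS (z + τ) τ = _
        rw [h1, dilogExt_add_tau hs hz, mul_div_mul_left _ _ (left_ne_zero_of_mul h2)]) (n k) h1.1
    exact h2.2.trans h1.2
  have hre : ∀ k, |(f k / rootTau τ).re| ≤ (rootTau τ).re := fun k => by
    rw [abs_le]
    constructor <;> linarith [(hmn k).1, (hmn k).2]
  have t₁ : Tendsto (fun k => dilogExt (f k) τ) atTop (𝓝 1) := by
    have h1 : ∀ k, dilogExt (f k) τ = stripFun (f k) τ := fun k => by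
      have : InStrip (f k + (0 : ℤ) * τ) τ := by
        rw [Int.cast_zero, zero_mul, add_zero]
        exact ⟨by linarith [(hmn k).1], by linarith [(hmn k).2]⟩
      rw [dilogExt_eq hs this]
      simp [stripExt, shiftNum, shiftDen]
    simp only [h1]
    refine tendsto_stripFun hs (h := ((rootTau τ).re + (rootTau τ)⁻¹.re) / 2 - η) (by linarith)
      (by linarith) (fun k => ?_) him
    rw [dilogArg_im, abs_le]
    constructor <;> linarith [(hmn k).1, (hmn k).2]
  have t₂ : Tendsto (fun k => omegaS (f k) τ) atTop (𝓝 1) := by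
    have h1 : ∀ k, f k = rootTau τ * (f k / rootTau τ) := fun k => (mul_div_cancel₀ _ hbn).symm
    -- Both √τ and 1/√τ have positive real part, so Im z and Im(z/τ) go to infinity together with
    -- Im(z/√τ).
    have h2 : ∀ k, f k / τ = (rootTau τ)⁻¹ * (f k / rootTau τ) := fun k => by
      rw [← div_eq_inv_mul, div_div, rootTau_sq]
    have h3 : Tendsto (fun k => (f k).im) atTop atTop := by
      refine (tendsto_mul_im_atTop hα hre him).congr fun k => ?_
      rw [← h1 k]
    have h4 : Tendsto (fun k => (f k / τ).im) atTop atTop := by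
      refine (tendsto_mul_im_atTop hβ hre him).congr fun k => ?_
      rw [← h2 k]
    have := (tendsto_uFun (neg_one_div_im_ne_zero hτ) h4).div (tendsto_uFun hτ h3) one_ne_zero
    rwa [div_one] at this
  have t₃ := t₁.div t₂ one_ne_zero
  have t₄ : Tendsto (fun _ : ℕ => dilogExt z τ / omegaS z τ) atTop (𝓝 (1 / 1)) :=
    t₃.congr hinv
  have := tendsto_nhds_unique t₄ tendsto_const_nhds
  rw [div_one, eq_comm, div_eq_one_iff_eq (omegaS_ne_zero hτ hz)] at this
  exact this.symm

/-! ### Product formulas for the cocycle -/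

/-- A system of representatives modulo `c`. -/
def residues (c : ℤ) : Finset ℤ := if 0 < c then Finset.Ico 0 c else Finset.Ico c 0

theorem exists_mem_residues {c : ℤ} (hc : c ≠ 0) (x : ℤ) :
    ∃ m : ℤ, x - c * m ∈ residues c := by
  rcases lt_or_gt_of_ne hc with h | h
  · refine ⟨x / c - 1, ?_⟩
    rw [residues, if_neg h.not_gt, Finset.mem_Ico]
    have h1 := Int.emod_nonneg x hc
    have h2 := Int.emod_lt_abs x hc
    rw [abs_of_neg h] at h2
    have h3 := Int.emod_add_mul_ediv x c
    constructor <;> linarith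
  · refine ⟨x / c, ?_⟩
    rw [residues, if_pos h, Finset.mem_Ico]
    have h1 := Int.emod_nonneg x hc
    have h2 := Int.emod_lt_of_pos x h
    have h3 := Int.emod_add_mul_ediv x c
    constructor <;> linarith

theorem eq_of_mem_residues {c x y : ℤ} (hx : x ∈ residues c) (hy : y ∈ residues c)
    (h : c ∣ x - y) : x = y := by
  have habs : |x - y| < |c| := by
    rw [residues] at hx hy
    split_ifs at hx hy with hc
    · rw [Finset.mem_Ico] at hx hy
      rw [abs_of_pos hc, abs_lt]
      constructor <;> linarith [hx.1, hx.2, hy.1, hy.2]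
    · rw [Finset.mem_Ico] at hx hy
      rw [abs_of_nonpos (not_lt.1 hc), abs_lt]
      constructor <;> linarith [hx.1, hx.2, hy.1, hy.2]
  exact sub_eq_zero.1 (Int.eq_zero_of_abs_lt_dvd ((abs_dvd c _).2 h) habs)

/-- For c < 0 the formula is applied to -τ: `uFun_neg` inverts the product and shifts z by τ, which
is why the representatives are -1, …, c and the exponent is the sign of c. -/
theorem uFun_eq_prod_residues {z τ : ℂ} (hτ : τ.im ≠ 0) {c : ℤ} (hc : c ≠ 0) :
    uFun z τ = (∏ j ∈ residues c, uFun (z - j * τ) (c * τ)) ^ c.sign := by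
  rcases lt_or_gt_of_ne hc with h | h
  · obtain ⟨n, rfl⟩ : ∃ n : ℕ, c = -n := ⟨(-c).toNat, by omega⟩
    have hn : 0 < n := by omega
    rw [Int.sign_eq_neg_one_of_neg h, zpow_neg_one, residues, if_neg h.not_gt, uFun_neg hτ,
      uFun_eq_prod (by simpa using hτ) hn]
    congr 1
    refine Finset.prod_nbij' (fun i : ℕ => -(i + 1 : ℤ)) (fun j => (-j - 1).toNat) ?_ ?_ ?_ ?_ ?_
    · intro i hi
      have := Finset.mem_range.1 hi
      rw [Finset.mem_Ico]
      omega
    · intro j hj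
      rw [Finset.mem_Ico] at hj
      rw [Finset.mem_range]
      omega
    · intro i _
      omega
    · intro j hj
      rw [Finset.mem_Ico] at hj
      omega
    · intro i _
      push_cast
      congr 1 <;> ring
  · obtain ⟨n, rfl⟩ := Int.eq_ofNat_of_zero_le h.le
    rw [Int.sign_eq_one_of_pos h, zpow_one, residues, if_pos h, uFun_eq_prod hτ (by omega : 0 < n)]
    refine Finset.prod_nbij' (fun i : ℕ => (i : ℤ)) (fun j => j.toNat) ?_ ?_ ?_ ?_ ?_
    · intro i hi
      have := Finset.mem_range.1 hi
      rw [Finset.mem_Ico]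
      omega
    · intro j hj
      rw [Finset.mem_Ico] at hj
      rw [Finset.mem_range]
      omega
    · intro i _
      omega
    · intro j hj
      rw [Finset.mem_Ico] at hj
      omega
    · intro i _
      push_cast
      rfl

theorem sub_notMem_lattice {z τ : ℂ} (c d j m : ℤ) (hz : z ∉ latticeTranslates {0} τ) :
    z - j * τ - m ∉ latticeTranslates {0} (c * τ + d) := by
  rw [mem_lattice_iff] at hz ⊢
  rintro ⟨k, l, h⟩
  refine hz ⟨k + m + l * d, j + l * c, ?_⟩
  push_cast
  linear_combination h

theorem mul_add_im_ne_zero {τ : ℂ} (hτ : τ.im ≠ 0) {c d : ℤ} (hc : c ≠ 0) :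
    (c * τ + d : ℂ).im ≠ 0 := by
  rw [add_im, ← ofReal_intCast, ← ofReal_intCast, ofReal_im, im_ofReal_mul, add_zero]
  exact mul_ne_zero (by exact_mod_cast hc) hτ

/-- Modulo integers, c·γτ is the image of σ = cτ+d under S, while cτ is σ itself. This reduces a
general γ to S. -/
theorem moebius_eq {τ : ℂ} {a b c d : ℤ} (hdet : a * d - b * c = 1)
    (hσ : (c * τ + d : ℂ) ≠ 0) :
    (c : ℂ) * ((a * τ + b) / (c * τ + d)) = -1 / (c * τ + d) + a := by
  have : (a * d - b * c : ℂ) = 1 := by exact_mod_cast hdet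
  field_simp
  linear_combination -this

theorem moebius_im_ne_zero {τ : ℂ} (hτ : τ.im ≠ 0) {a b c d : ℤ} (hdet : a * d - b * c = 1)
    (hc : c ≠ 0) : ((a * τ + b) / (c * τ + d) : ℂ).im ≠ 0 := by
  have hσ := mul_add_im_ne_zero hτ hc (d := d)
  intro h
  have h1 := congrArg Complex.im (moebius_eq hdet (fun h => hσ (by rw [h, zero_im])))
  rw [mul_im, h, intCast_im, mul_zero, zero_mul, add_zero, add_im, intCast_im, add_zero] at h1
  exact neg_one_div_im_ne_zero hσ h1.symm

/-- Both products over residues are related by multiplication by `d` modulo `c`. -/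
theorem uFun_moebius_div_eq_prod {a b c d : ℤ} (hdet : a * d - b * c = 1) (hc : c ≠ 0) :
    ∃ m : ℤ → ℤ, ∀ z τ : ℂ, τ.im ≠ 0 → z ∉ latticeTranslates {0} τ →
      uFun (z / (c * τ + d)) ((a * τ + b) / (c * τ + d)) / uFun z τ =
        (∏ j ∈ residues c, dilogExt (z - j * τ - m j) (c * τ + d)) ^ c.sign := by
  choose m hm using fun j : ℤ => exists_mem_residues hc (j * d)
  refine ⟨m, fun z τ hτ hz => ?_⟩
  have hσ := mul_add_im_ne_zero hτ hc (d := d)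
  have hσ0 : (c * τ + d : ℂ) ≠ 0 := fun h => hσ (by rw [h, zero_im])
  have hdet' : (a * d - b * c : ℂ) = 1 := by exact_mod_cast hdet
  -- Multiplication by d permutes the residues modulo c because ad ≡ 1; the witness below is the
  -- resulting quotient of i - j by c.
  have hinj : Set.InjOn (fun j : ℤ => j * d - c * m j) (residues c) := by
    intro i hi j hj hij
    refine eq_of_mem_residues hi hj ?_
    have hij' : i * d - c * m i = j * d - c * m j := hij
    refine ⟨a * (m i - m j) - b * (i - j), ?_⟩
    linear_combination (j - i) * hdet + a * hij'
  have hmaps : Set.MapsTo (fun j : ℤ => j * d - c * m j) (residues c) (residues c) :=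
    fun j _ => hm j
  rw [uFun_eq_prod_residues (moebius_im_ne_zero hτ hdet hc) hc, uFun_eq_prod_residues hτ hc,
    ← div_zpow]
  congr 1
  rw [← Finset.prod_nbij (fun j : ℤ => j * d - c * m j) (fun j _ => hm j) hinj
    (Finset.surjOn_of_injOn_of_card_le _ hmaps hinj le_rfl) (fun j _ => rfl),
    ← Finset.prod_div_distrib]
  refine Finset.prod_congr rfl fun j _ => ?_
  rw [← omegaS_eq_dilogExt hσ (sub_notMem_lattice c d j (m j) hz), omegaS]
  congr 1
  · rw [moebius_eq hdet hσ0, uFun_add_intCast_right,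
      -- With j' = jd - c·m_j, this integer is exactly the difference between z/σ - j'γτ and (z - jτ
      -- - m_j)/σ.
      ← uFun_add_intCast_left ((z - j * τ - m j) / (c * τ + d)) _ (a * m j - b * j)]
    congr 1
    push_cast
    field_simp
    linear_combination (-j * τ - m j : ℂ) * hdet'
  · rw [uFun_add_intCast_right, ← uFun_add_intCast_left (z - j * τ - m j) _ (m j),
      sub_add_cancel]

/-- The relation S² = -1: applying S twice sends (z,τ) to (-z,τ), and the two S-quotients telescope.
-/
theorem uFun_neg_div {z τ : ℂ} (hτ : τ.im ≠ 0) (hz : z ∉ latticeTranslates {0} τ) :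
    uFun (-z) τ / uFun z τ = dilogExt (z / τ) (-1 / τ) * dilogExt z τ := by
  have h0 : τ ≠ 0 := fun h => hτ (by simp [h])
  have h1 := uFun_ne_zero (neg_one_div_im_ne_zero hτ) (div_tau_notMem h0 hz)
  rw [← omegaS_eq_dilogExt hτ hz, ← omegaS_eq_dilogExt (neg_one_div_im_ne_zero hτ)
    (div_tau_notMem h0 hz), omegaS, omegaS, div_mul_div_cancel₀ h1]
  congr 2
  · field_simp
  · field_simp

/-! ### Modularity -/

theorem cocycle_zero_eq {W : ℂ → ℂ → Matrix (Fin 1) (Fin 1) ℂ} {w : ℂ → ℂ → ℂ}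
    (hW : ∀ t q, W t q = !![w t q]) (γ : Matrix.SpecialLinearGroup (Fin 2) ℤ) (p : ℂ × ℂ) :
    cocycle 0 W γ p =
      !![w (e (jacobiAct γ p).1) (e (jacobiAct γ p).2) / w (e p.1) (e p.2)] := by
  have h1 : (Matrix.diagonal fun i : Fin 1 =>
      autFactor γ p.2 ^ (-(0 : Fin 1 → ℤ) i)) = (1 : Matrix (Fin 1) (Fin 1) ℂ) := by
    simp
  rw [cocycle, slash, h1, mul_one, inJacobi, inJacobi, hW, hW, inv_one_by_one, mul_one_by_one,
    div_eq_mul_inv]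

theorem cocycle_U_eq (γ : Matrix.SpecialLinearGroup (Fin 2) ℤ) (p : ℂ × ℂ) :
    cocycle 0 U γ p = !![uFun (jacobiAct γ p).1 (jacobiAct γ p).2 / uFun p.1 p.2] :=
  cocycle_zero_eq U_eq γ p

theorem det_eq (γ : Matrix.SpecialLinearGroup (Fin 2) ℤ) :
    γ 0 0 * γ 1 1 - γ 0 1 * γ 1 0 = 1 := by
  rw [← Matrix.det_fin_two, γ.det_coe]

theorem eq_one_or_eq_neg_one_of_det {γ : Matrix.SpecialLinearGroup (Fin 2) ℤ} (hc : γ 1 0 = 0) :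
    γ 0 0 = 1 ∧ γ 1 1 = 1 ∨ γ 0 0 = -1 ∧ γ 1 1 = -1 := by
  have h := det_eq γ
  rw [hc, mul_zero, sub_zero] at h
  exact Int.mul_eq_one_iff_eq_one_or_neg_one.1 h

theorem autFactor_ne_zero {γ : Matrix.SpecialLinearGroup (Fin 2) ℤ} {τ : ℂ} (hτ : τ.im ≠ 0) :
    autFactor γ τ ≠ 0 := by
  by_cases hc : γ 1 0 = 0
  · rw [autFactor, hc]
    rcases eq_one_or_eq_neg_one_of_det hc with h | h <;> simp [h.2]
  · exact fun h => mul_add_im_ne_zero hτ hc (d := γ 1 1) (by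
      rw [autFactor] at h; rw [h, zero_im])

theorem jacobiAct_im_ne_zero (γ : Matrix.SpecialLinearGroup (Fin 2) ℤ) {p : ℂ × ℂ}
    (hτ : p.2.im ≠ 0) : (jacobiAct γ p).2.im ≠ 0 := by
  by_cases hc : γ 1 0 = 0
  · rw [jacobiAct, autFactor, hc]
    rcases eq_one_or_eq_neg_one_of_det hc with h | h <;> simp [h.1, h.2, hτ, div_neg]
  · exact moebius_im_ne_zero hτ (det_eq γ) hc

theorem jacobiAct_notMem (γ : Matrix.SpecialLinearGroup (Fin 2) ℤ) {p : ℂ × ℂ}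
    (hτ : p.2.im ≠ 0) (hz : p.1 ∉ latticeTranslates {0} p.2) :
    (jacobiAct γ p).1 ∉ latticeTranslates {0} (jacobiAct γ p).2 :=
  div_notMem_lattice (autFactor_ne_zero hτ) hz

theorem cocycle_U_eq_cocycle_V (γ : Matrix.SpecialLinearGroup (Fin 2) ℤ) {p : ℂ × ℂ}
    (hτ : p.2.im ≠ 0) (hz : p.1 ∉ latticeTranslates {0} p.2) :
    cocycle 0 U γ p = cocycle 0 V γ p := by
  rw [cocycle_U_eq, cocycle_zero_eq V_eq, g1_eq_uFun hτ hz,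
    g1_eq_uFun (jacobiAct_im_ne_zero γ hτ) (jacobiAct_notMem γ hτ hz)]

theorem isMeromorphicExtension_of {γ : Matrix.SpecialLinearGroup (Fin 2) ℤ}
    {Ω : ℂ × ℂ → Matrix (Fin 1) (Fin 1) ℂ} {G : ℂ × ℂ → ℂ}
    (hG : ∀ p : ℂ × ℂ, p.2 ∈ cutPlane γ → IsLatticeQuotientAt G p)
    (hΩ : ∀ p : ℂ × ℂ, p.2.im ≠ 0 → p.1 ∉ latticeTranslates {0} p.2 → Ω p = !![G p]) :
    IsMeromorphicExtension γ Ω {0} fun p => !![G p] where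
  meromorphic p hp i j := by
    fin_cases i; fin_cases j
    exact (hG p hp).meromorphic
  analytic p hp hz i j := by
    fin_cases i; fin_cases j
    exact (hG p hp).analyticAt hz
  extends_cocycle p hτ hz := (hΩ p hτ hz).symm

/-- The cut of ℂ_γ is where cτ+d lies in (-∞,0], the direction of the ray depending on the sign of
c. -/
theorem cutPlane_of_ne_zero {γ : Matrix.SpecialLinearGroup (Fin 2) ℤ} {τ : ℂ}
    (hc : γ 1 0 ≠ 0) (hτ : τ ∈ cutPlane γ) : ((γ 1 0 : ℂ) * τ + (γ 1 1 : ℂ)) ∈ slitPlane := by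
  by_contra h
  rw [mem_slitPlane_iff_not_le_zero, not_not, ← ofReal_zero] at h
  obtain ⟨x, hx, hxσ⟩ : ∃ x : ℝ, x ≤ 0 ∧ (γ 1 0 : ℂ) * τ + (γ 1 1 : ℂ) = x := by
    refine ⟨((γ 1 0 : ℂ) * τ + (γ 1 1 : ℂ)).re, h.1, ?_⟩
    exact Complex.ext rfl (by simpa using h.2)
  have hc' : (γ 1 0 : ℂ) ≠ 0 := by exact_mod_cast hc
  have hc'' : (γ 1 0 : ℝ) ≠ 0 := by exact_mod_cast hc
  have hτ' : τ = ((x - (γ 1 1 : ℝ)) / (γ 1 0 : ℝ) : ℝ) := by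
    push_cast
    rw [eq_div_iff hc', ← hxσ]
    ring
  rcases lt_or_gt_of_ne hc with h0 | h0
  · refine hτ.2.1 h0 _ ?_ hτ'
    have h0' : (γ 1 0 : ℝ) < 0 := by exact_mod_cast h0
    exact div_le_div_of_nonpos_of_le h0'.le (by linarith)
  · refine hτ.1 h0 _ ?_ hτ'
    have h0' : (0 : ℝ) < (γ 1 0 : ℝ) := by exact_mod_cast h0
    exact div_le_div_of_nonneg_right (by linarith) h0'.le

theorem cutPlane_of_eq_zero {γ : Matrix.SpecialLinearGroup (Fin 2) ℤ} {τ : ℂ}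
    (hc : γ 1 0 = 0) (hτ : τ ∈ cutPlane γ) : τ.im ≠ 0 := fun h =>
  hτ.2.2 hc τ.re (Complex.ext rfl (by simpa using h))

theorem isLatticeQuotientAt_dilogExt_affine {p : ℂ × ℂ} {c d : ℤ}
    (hσ : (c * p.2 + d : ℂ) ∈ slitPlane) (j m : ℤ) :
    IsLatticeQuotientAt (fun x => dilogExt (x.1 - j * x.2 - m) (c * x.2 + d)) p := by
  refine IsLatticeQuotientAt.comp (F := fun x => dilogExt x.1 x.2)
    (φ := fun x => (x.1 - j * x.2 - m, c * x.2 + d)) (isLatticeQuotientAt_dilogExt hσ) ?_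
    (Eventually.of_forall fun x hx => sub_notMem_lattice c d j m hx)
  exact ((analyticAt_fst.sub (analyticAt_const.mul analyticAt_snd)).sub analyticAt_const).prod
    ((analyticAt_const.mul analyticAt_snd).add analyticAt_const)

theorem isLatticeQuotientAt_dilogExt_inversion {p : ℂ × ℂ} (hτ : p.2.im ≠ 0) :
    IsLatticeQuotientAt (fun x => dilogExt (x.1 / x.2) (-1 / x.2)) p := by
  have h0 : p.2 ≠ 0 := fun h => hτ (by simp [h])
  refine IsLatticeQuotientAt.comp (F := fun x => dilogExt x.1 x.2)
    (φ := fun x => (x.1 / x.2, -1 / x.2))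
    (isLatticeQuotientAt_dilogExt (slitPlane_of_im_ne_zero (neg_one_div_im_ne_zero hτ))) ?_ ?_
  · exact (analyticAt_fst.div analyticAt_snd h0).prod (analyticAt_const.div analyticAt_snd h0)
  · filter_upwards [(continuous_snd.tendsto p).eventually_ne h0] with x hx hz
    exact div_tau_notMem hx hz

theorem IsLatticeQuotientAt.zpow_sign {F : ℂ × ℂ → ℂ} {p : ℂ × ℂ} (hF : IsLatticeQuotientAt F p)
    {c : ℤ} (hc : c ≠ 0) : IsLatticeQuotientAt (fun x => F x ^ c.sign) p := by
  rcases lt_or_gt_of_ne hc with h | h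
  · simpa only [Int.sign_eq_neg_one_of_neg h, zpow_neg_one] using hF.inv
  · simpa only [Int.sign_eq_one_of_pos h, zpow_one] using hF

/-- For c ≠ 0 the extension is the product over residues. For c = 0 the matrix acts by a translation
of τ, which u does not see, possibly combined with z ↦ -z, where S² = -1 gives two factors, both
defined off the real line. -/
theorem exists_isLatticeQuotientAt_cocycle (γ : Matrix.SpecialLinearGroup (Fin 2) ℤ) :
    ∃ G : ℂ × ℂ → ℂ, (∀ p : ℂ × ℂ, p.2 ∈ cutPlane γ → IsLatticeQuotientAt G p) ∧
      ∀ p : ℂ × ℂ, p.2.im ≠ 0 → p.1 ∉ latticeTranslates {0} p.2 →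
        uFun (jacobiAct γ p).1 (jacobiAct γ p).2 / uFun p.1 p.2 = G p := by
  by_cases hc : γ 1 0 = 0
  · rcases eq_one_or_eq_neg_one_of_det hc with h | h
    · refine ⟨fun _ => 1, fun p _ => isLatticeQuotientAt_one p, fun p hτ hz => ?_⟩
      have : jacobiAct γ p = (p.1, p.2 + (γ 0 1 : ℤ)) := by
        simp [jacobiAct, autFactor, hc, h.1, h.2]
      rw [this, uFun_add_intCast_right, div_self (uFun_ne_zero hτ hz)]
    · refine ⟨fun x => dilogExt (x.1 / x.2) (-1 / x.2) * dilogExt x.1 x.2, fun p hp => ?_,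
        fun p hτ hz => ?_⟩
      · have hτ := cutPlane_of_eq_zero hc hp
        exact (isLatticeQuotientAt_dilogExt_inversion hτ).mul
          (isLatticeQuotientAt_dilogExt (slitPlane_of_im_ne_zero hτ))
      · have : jacobiAct γ p = (-p.1, p.2 + (-γ 0 1 : ℤ)) := by
          simp [jacobiAct, autFactor, hc, h.1, h.2, div_neg, add_comm]
        rw [this, uFun_add_intCast_right, uFun_neg_div hτ hz]
  · obtain ⟨m, hm⟩ := uFun_moebius_div_eq_prod (det_eq γ) hc
    refine ⟨_, fun p hp => ?_, fun p hτ hz => hm p.1 p.2 hτ hz⟩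
    exact (isLatticeQuotientAt_prod _ fun j _ =>
      isLatticeQuotientAt_dilogExt_affine (cutPlane_of_ne_zero hc hp) j (m j)).zpow_sign hc

theorem isModular_cocycle_U : IsModular (cocycle 0 U) := fun γ => by
  obtain ⟨G, hG, hΩ⟩ := exists_isLatticeQuotientAt_cocycle γ
  exact ⟨{0}, _, isMeromorphicExtension_of hG fun p hτ hz => by rw [cocycle_U_eq, hΩ p hτ hz]⟩

theorem isModular_cocycle_V : IsModular (cocycle 0 V) := fun γ => by
  obtain ⟨G, hG, hΩ⟩ := exists_isLatticeQuotientAt_cocycle γ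
  exact ⟨{0}, _, isMeromorphicExtension_of hG fun p hτ hz => by
    rw [← cocycle_U_eq_cocycle_V γ hτ hz, cocycle_U_eq, hΩ p hτ hz]⟩

theorem cocycle_S_eq_invDilog {z τ : ℂ} (hτ : τ.im ≠ 0) (hz : z ∉ latticeTranslates {0} τ) :
    cocycle 0 U ModularGroup.S (z, τ) = !![invDilog (z, τ)] := by
  rw [cocycle_U_eq, invDilog_eq (slitPlane_of_im_ne_zero hτ), ← omegaS_eq_dilogExt hτ hz, omegaS]
  simp [jacobiAct, autFactor, ModularGroup.S]

theorem cutPlane_S {τ : ℂ} (hτ : τ ∈ cutPlane ModularGroup.S) : τ ∈ slitPlane := by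
  simpa [ModularGroup.S] using cutPlane_of_ne_zero (γ := ModularGroup.S)
    (by simp [ModularGroup.S]) hτ

theorem isMeromorphicExtension_invDilog :
    IsMeromorphicExtension ModularGroup.S (cocycle 0 U ModularGroup.S) {0}
      fun p => !![invDilog p] := by
  refine isMeromorphicExtension_of (fun p hp => ?_) fun p hτ hz => cocycle_S_eq_invDilog hτ hz
  obtain ⟨g, h, hg, hh, H⟩ := isLatticeQuotientAt_dilogExt (cutPlane_S hp)
  refine ⟨g, h, hg, hh, ?_⟩
  filter_upwards [H, eventually_slitPlane (cutPlane_S hp)] with x hx hx'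
  exact ⟨hx.1, (invDilog_eq hx').trans hx.2⟩

theorem fundamental_solutions {q t : ℂ} (hq0 : q ≠ 0) (hq : ‖q‖ ≠ 1) (ht0 : t ≠ 0)
    (ht : ∀ n : ℤ, t ≠ q ^ n) :
    PochEq f0 t q ∧ PochEq g1 t q ∧ (U t q).det ≠ 0 ∧ (V t q).det ≠ 0 ∧
      monodromy U V t q = !![1] := by
  have h := f0_ne_zero hq0 hq ht
  have hg := g1_eq_f0 hq0 hq ht0 ht
  refine ⟨pochEq_f0 hq0 hq ht, pochEq_g1 hq0 hq ht0 ht, ?_, ?_, ?_⟩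
  · simpa [U_eq] using h
  · simpa [V_eq, hg] using h
  · rw [monodromy, U_eq, V_eq, hg, inv_one_by_one, mul_one_by_one, inv_mul_cancel₀ h]

end QModular

end

open QModular in
theorem theorem1p4 :
    -- `f⁽⁰⁾` and `g⁽¹⁾` solve the equation, and the monodromy matrix is `(1)`
    (∀ q t : ℂ, q ≠ 0 → ‖q‖ ≠ 1 → t ≠ 0 → (∀ n : ℤ, t ≠ q ^ n) →
      PochEq f0 t q ∧ PochEq g1 t q ∧ (U t q).det ≠ 0 ∧ (V t q).det ≠ 0 ∧
        monodromy U V t q = !![1]) ∧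
    -- the two cocycles (of weight `0`) are equal
    (∀ (γ : Matrix.SpecialLinearGroup (Fin 2) ℤ) (z τ : ℂ), τ.im ≠ 0 →
      z ∉ latticeTranslates {0} τ → cocycle 0 U γ (z, τ) = cocycle 0 V γ (z, τ)) ∧
    -- and modular
    IsModular (cocycle 0 U) ∧ IsModular (cocycle 0 V) ∧
    -- `Ω_S` is the inverse of the quantum dilogarithm
    (∀ z τ : ℂ, τ.im ≠ 0 → z ∉ latticeTranslates {0} τ →
      cocycle 0 U ModularGroup.S (z, τ) = !![invDilog (z, τ)]) ∧
    -- also after extension to `ℂ × (ℂ ∖ (-∞,0])`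
    IsMeromorphicExtension ModularGroup.S (cocycle 0 U ModularGroup.S) {0}
      (fun p => !![invDilog p]) :=
  ⟨fun _ _ hq0 hq ht0 ht => fundamental_solutions hq0 hq ht0 ht,
    fun γ _ _ hτ hz => cocycle_U_eq_cocycle_V γ hτ hz, isModular_cocycle_U, isModular_cocycle_V,
    fun _ _ hτ hz => cocycle_S_eq_invDilog hτ hz, isMeromorphicExtension_invDilog⟩
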